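/- Let $(M^2,D,\Omega)$ be an equi-affine 2-manifold: $M^2$ is a (non-empty) smooth 2-manifold, $D$ is a smooth affine connection on $M^2$ (possibly with torsion), and $\Omega$ is a smooth nowhere vanishing 2-form with $D\Omega=0$; $M^2$ carries the orientation for which $\Omega$ is positive. Write $[v,w]:=\Omega(v,w)$ for $v,w\in T_pM^2$, and for a smooth curve $\gamma(t)$ in $M^2$ write $\dot\gamma=d\gamma/dt$, $\ddot\gamma=D_t\dot\gamma$, $\gamma^{(3)}=D_t\ddot\gamma$, $\gamma^{(k+1)}=D_t\gamma^{(k)}$, where $D_t$ is the covariant derivative along $\gamma$. For coprime positive integers $m,n$, let $x^{m/n}$ be the usual power for $x\ge 0$ and $x^{m/n}:=(-1)^{mn}|x|^{m/n}$ for $x<0$. A smooth curve $\gamma:(-\delta,\delta)\to M^2$ ($\delta>0$) has a $3/2$-cusp at $t=0$ if there are a smooth coordinate change $t=t(u)$ near $u=0$ with $t(0)=0$ and a diffeomorphism $\Phi$ from a neighbourhood of $\gamma(0)$ onto an open subset of $\mathbf R^2$ such that $\Phi(\gamma(t(u)))=(u^2,u^3)$ for $u$ near $0$. Put $$\kappa_A=\frac{3[\dot\gamma,\ddot\gamma][\dot\gamma,\gamma^{(4)}]+12[\dot\gamma,\ddot\gamma][\ddot\gamma,\gamma^{(3)}]-5[\dot\gamma,\gamma^{(3)}]^2}{9[\dot\gamma,\ddot\gamma]^{8/3}}\quad(\text{where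 }[\dot\gamma,\ddot\gamma]\ne0),\qquad s_A(t)=\int_0^t\bigl|[\dot\gamma(u),\ddot\gamma(u)]^{1/3}\bigr|\,du,\qquad \tau=(s_A)^{3/5},$$ $$\mu_A=\frac{24[\ddot\gamma,\gamma^{(3)}][\ddot\gamma,\gamma^{(5)}]+60[\ddot\gamma,\gamma^{(3)}][\gamma^{(3)},\gamma^{(4)}]-35[\ddot\gamma,\gamma^{(4)}]^2}{[\ddot\gamma,\gamma^{(3)}]^{12/5}}\Big|_{t=0}.$$ **Theorem 3.8.** (i) Let $\gamma:(-\delta,\delta)\to M^2$ be a smooth curve with a $3/2$-cusp at $t=0$. Then $[\ddot\gamma(0),\gamma^{(3)}(0)]\neq0$, so $\mu_A$ is defined, and there is $\varepsilon\in(0,\delta]$ such that $[\dot\gamma(t),\ddot\gamma(t)]\ne0$ for $0<|t|<\varepsilon$. For every such $\varepsilon$, the function $\tau$ is $C^\infty$ on $(-\varepsilon,\varepsilon)$ with $\tau(0)=0$ and $d\tau/dt>0$, so that it is a coordinate of $\gamma$ there (the $3/5$-arclength parameter), and $f:=(s_A)^2\kappa_A$ extends from $0<|t|<\varepsilon$ to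 a $C^\infty$-function on $(-\varepsilon,\varepsilon)$, both as a function of $t$ and as a function of $\tau$, with $f(0)=4/25$ and $\dot f(0)=0$ (for the derivative in $t$ as well as in $\tau$). Moreover, $$\lim_{t\to0}\frac{(s_A)^2\kappa_A-4/25}{\tau^2}=\frac1{220}\sqrt[5]{\frac{20}{3}}\;\mu_A .$$ (ii) Conversely, let $f$ be a $C^\infty$-function on an interval $(-r,r)$, $r>0$, with $f(0)=4/25$ and $\dot f(0)=0$. Then there are $\varepsilon\in(0,r]$ and a smooth curve $\gamma:(-\varepsilon,\varepsilon)\to M^2$ with a $3/2$-cusp at $0$ such that $[\dot\gamma,\ddot\gamma]\neq0$ off $0$, the parameter of $\gamma$ is its $3/5$-arclength parameter $\tau$, and $(s_A)^2\kappa_A=f(\tau)$ for $0<|\tau|<\varepsilon$. -/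

import Mathlib

open Set Filter Topology
open scoped Manifold ContDiff

noncomputable section

namespace EquiAffineCusp

/-- The model plane. -/
abbrev Plane : Type := EuclideanSpace ℝ (Fin 2)

/-- The convention for fractional powers with coprime `m`, `n`: the usual power for `0 ≤ x`, and
`x ^ (m / n) = (-1) ^ (m n) |x| ^ (m / n)` for `x < 0`. -/
def fracPow (x : ℝ) (m n : ℕ) : ℝ :=
  if 0 ≤ x then x ^ ((m : ℝ) / n) else (-1) ^ (m * n) * |x| ^ ((m : ℝ) / n)

section Manifold

variable {M : Type*} [TopologicalSpace M] [ChartedSpace Plane M] [IsManifold (𝓡 2) ∞ M]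

/-- An affine connection on `M`: a covariant derivative on the tangent bundle (no condition on the
torsion). In Mathlib's argument order `D Y x v` is `(D_v Y)(x)`. -/
abbrev AffineConnection (M : Type*) [TopologicalSpace M] [ChartedSpace Plane M]
    [IsManifold (𝓡 2) ∞ M] :=
  CovariantDerivative (𝓡 2) Plane (TangentSpace (𝓡 2) : M → Type _)

/-- `Ω` is a smooth, nowhere vanishing 2-form on `M` which is parallel with respect to `D`:
`v (Ω(Y, Z)) = Ω(D_v Y, Z) + Ω(Y, D_v Z)`. The orientation of `M` is the one for which `Ω` is
positive. -/
structure IsParallelAreaForm (D : AffineConnection M)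
    (Ω : ∀ x : M, TangentSpace (𝓡 2) x →L[ℝ] TangentSpace (𝓡 2) x →L[ℝ] ℝ) : Prop where
  alternating : ∀ (x : M) (v : TangentSpace (𝓡 2) x), Ω x v v = 0
  nonvanishing : ∀ x : M, Ω x ≠ 0
  smooth : ContMDiff (𝓡 2) ((𝓡 2).prod 𝓘(ℝ, Plane →L[ℝ] Plane →L[ℝ] ℝ)) ∞
    (fun x : M ↦ Bundle.TotalSpace.mk' (Plane →L[ℝ] Plane →L[ℝ] ℝ)
      (E := fun x : M ↦ TangentSpace (𝓡 2) x →L[ℝ] TangentSpace (𝓡 2) x →L[ℝ] ℝ) x (Ω x))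
  parallel : ∀ (Y Z : ∀ x : M, TangentSpace (𝓡 2) x) (x : M),
    MDifferentiableAt (𝓡 2) ((𝓡 2).prod 𝓘(ℝ, Plane))
        (fun y ↦ (⟨y, Y y⟩ : TangentBundle (𝓡 2) M)) x →
    MDifferentiableAt (𝓡 2) ((𝓡 2).prod 𝓘(ℝ, Plane))
        (fun y ↦ (⟨y, Z y⟩ : TangentBundle (𝓡 2) M)) x → ∀ v : TangentSpace (𝓡 2) x,
      mvfderiv (𝓡 2) (fun y ↦ Ω y (Y y) (Z y)) x v
        = Ω x (D Y x v) (Z x) + Ω x (Y x) (D Z x v)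

/-- The velocity `γ̇(t) ∈ T_{γ(t)} M`. -/
def velocity (γ : ℝ → M) (t : ℝ) : TangentSpace (𝓡 2) (γ t) :=
  (mfderiv 𝓘(ℝ, ℝ) (𝓡 2) γ t (1 : ℝ) :)

/-- The covariant derivative `D_t V` of a vector field `V` along `γ`. Near `γ(t)`, let `e` be the
trivialization of `TM` by the coordinate frame of the chart at `γ(t)`; let `c(s)` be the components
of `V(s)` and, for a constant vector `c`, let `E_c` be the vector field with components `c`. Then
`D_t V = E_{c'(t)} + D_{γ̇(t)} E_{c(t)}`; this is the usual formula
`(c^k)' + Γ^k_{ij} (γ^i)' c^j`. -/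
def covDerivAlong (D : AffineConnection M) (γ : ℝ → M) (V : ∀ t, TangentSpace (𝓡 2) (γ t))
    (t : ℝ) : TangentSpace (𝓡 2) (γ t) :=
  let e := trivializationAt Plane (TangentSpace (𝓡 2) : M → Type _) (γ t)
  let c : ℝ → Plane := fun s ↦ e.continuousLinearMapAt ℝ (γ s) (V s)
  e.symmL ℝ (γ t) (deriv c t) + D (fun x ↦ e.symmL ℝ x (c t)) (γ t) (velocity γ t)

/-- `curveDeriv D γ k` is `γ^(k)`: `γ^(1) = γ̇` and `γ^(k+1) = D_t γ^(k)` for `k ≥ 1`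
(the index `0` is not used). -/
def curveDeriv (D : AffineConnection M) (γ : ℝ → M) : ℕ → ∀ t, TangentSpace (𝓡 2) (γ t)
  | 0 => fun _ ↦ 0
  | 1 => velocity γ
  | k + 2 => covDerivAlong D γ (curveDeriv D γ (k + 1))

/-- `[γ^(i)(t), γ^(j)(t)]`, where `[v, w] = Ω(v, w)`. -/
def bracket (D : AffineConnection M)
    (Ω : ∀ x : M, TangentSpace (𝓡 2) x →L[ℝ] TangentSpace (𝓡 2) x →L[ℝ] ℝ)
    (γ : ℝ → M) (i j : ℕ) (t : ℝ) : ℝ :=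
  Ω (γ t) (curveDeriv D γ i t) (curveDeriv D γ j t)

/-- `t = 0` is a 3/2-cusp of `γ`: for a coordinate change `σ` of the line near `0` with `σ 0 = 0`
and a local diffeomorphism `Φ` from a neighbourhood of `γ 0` to the plane,
`Φ (γ (σ s)) = (s ^ 2, s ^ 3)` near `s = 0`. -/
def IsThreeHalvesCusp (γ : ℝ → M) : Prop :=
  ∃ σ : ℝ → ℝ, (∃ r > 0, ContDiffOn ℝ ∞ σ (Ioo (-r) r)) ∧ σ 0 = 0 ∧ deriv σ 0 ≠ 0 ∧
    ∃ Φ ∈ IsManifold.maximalAtlas (𝓡 2) ∞ M, γ 0 ∈ Φ.source ∧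
      ∀ᶠ s in 𝓝 (0 : ℝ), γ (σ s) ∈ Φ.source ∧ Φ (γ (σ s)) = !₂[s ^ 2, s ^ 3]

variable (D : AffineConnection M)
  (Ω : ∀ x : M, TangentSpace (𝓡 2) x →L[ℝ] TangentSpace (𝓡 2) x →L[ℝ] ℝ) (γ : ℝ → M)

/-- The affine curvature function `κ_A`, meaningful where `[γ̇, γ̈] ≠ 0`. -/
def affineCurvature (t : ℝ) : ℝ :=
  (3 * bracket D Ω γ 1 2 t * bracket D Ω γ 1 4 t + 12 * bracket D Ω γ 1 2 t * bracket D Ω γ 2 3 t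
    - 5 * bracket D Ω γ 1 3 t ^ 2) / (9 * fracPow (bracket D Ω γ 1 2 t) 8 3)

/-- The affine arclength `s_A(t) = ∫_0^t |[γ̇, γ̈]^(1/3)| du`. -/
def affineArclength (t : ℝ) : ℝ :=
  ∫ u in (0 : ℝ)..t, |fracPow (bracket D Ω γ 1 2 u) 1 3|

/-- The 3/5-arclength `τ = (s_A)^(3/5)`. -/
def threeFifthsArclength (t : ℝ) : ℝ :=
  fracPow (affineArclength D Ω γ t) 3 5

/-- The normalized affine curvature `(s_A)² κ_A`, meaningful where `[γ̇, γ̈] ≠ 0`. -/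
def normalizedCurvature (t : ℝ) : ℝ :=
  affineArclength D Ω γ t ^ 2 * affineCurvature D Ω γ t

/-- The affine cuspidal curvature `μ_A` at `t = 0`. -/
def affineCuspidalCurvature : ℝ :=
  (24 * bracket D Ω γ 2 3 0 * bracket D Ω γ 2 5 0 + 60 * bracket D Ω γ 2 3 0 * bracket D Ω γ 3 4 0
    - 35 * bracket D Ω γ 2 4 0 ^ 2) / fracPow (bracket D Ω γ 2 3 0) 12 5

/-- There is no inflection point with `0 < |t| < ε`. -/
def NoInflection (ε : ℝ) : Prop :=
  ∀ t ∈ Ioo (-ε) ε, t ≠ 0 → bracket D Ω γ 1 2 t ≠ 0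

end Manifold

end EquiAffineCusp

end

/-! Part (i). Since `Ω` is parallel, the brackets A_ij = [γ^(i), γ^(j)] obey the Leibniz rule A_ij'
= A_{i+1,j} + A_{i,j+1}. They satisfy A_ii = 0, and at a cusp A_1j(0) = 0 because the velocity
vanishes. Apart from A_23(0) ≠ 0, everything in (i) follows from these rules alone, which is why
`BracketSystem` isolates them.

They give A_12 = t² g with g smooth and A_23(0) = 2 g(0) (`BracketSystem.exists_eq_sq_mul`). Every
quantity in question is unchanged under A ↦ -A, so g > 0 may be assumed. With k = g^(1/3) the
arclength element is |t|^(2/3) k dt, hence s_A = t |t|^(2/3) h with h smooth and positive and k =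
(5/3) h + t h'. Thus τ = t h^(3/5) is a smooth coordinate. The numerator of κ_A is t² Q with Q
smooth, and all fractional powers of |t| cancel in (s_A)² κ_A = h² Q / (9 k⁸). Comparing second
order Taylor polynomials (`jet2_normalizedCurvature`) gives the values 4/25 and 0 and a
t²-coefficient proportional to the numerator of μ_A; division by τ² = t² h^(6/5) gives the limit.

For A_23(0) ≠ 0, the velocity in a chart is θ V, where θ inverts the parameter change of the cusp
and V(0), V'(0) are independent (`exists_cusp_frame`). Then γ̈(0) = θ' V and γ^(3)(0) = 2 θ' V' +
θ'' V, so A_23(0) = 2 θ'² Ω(V, V') at 0.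

Part (ii). Write f = (4 - 9 t² q)/25 with q smooth and solve the differential equation γ̇ = t U, D_t
U = W, D_t W = q U (`exists_moving_frame`). The area Ω(U, W) is constant; normalized to 125/27 =
(5/3)³ it makes t the 3/5-arclength, and the brackets then give (s_A)² κ_A = f. To see a 3/2-cusp,
write the curve in coordinates as (t² a, t³ b) with a(0) > 0, b(0) ≠ 0. With s = t √a it becomes
(s², s³ (P(s²) + s Q(s²))), which a shear straightens to (s², s³) (`exists_shear_normal_form`). The
smoothness of P and Q is Whitney's theorem on even functions, proved here from Borel's lemma. -/

open Set Filter Topology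
open scoped Manifold ContDiff

noncomputable section

namespace EquiAffineCusp

/-! ### Hadamard's lemma and second order Taylor polynomials. -/

section SmoothFunctions

/-- `f` is a smooth function on the interval `(-δ, δ)`. -/
abbrev SmoothNear (δ : ℝ) (f : ℝ → ℝ) : Prop := ContDiffOn ℝ ∞ f (Ioo (-δ) δ)

lemma SmoothNear.deriv {δ : ℝ} {f : ℝ → ℝ} (hf : SmoothNear δ f) : SmoothNear δ (deriv f) :=
  ContDiffOn.deriv_of_isOpen hf isOpen_Ioo (by norm_num)

lemma SmoothNear.hasDerivAt {δ : ℝ} {f : ℝ → ℝ} (hf : SmoothNear δ f) {t : ℝ}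
    (ht : t ∈ Ioo (-δ) δ) : HasDerivAt f (_root_.deriv f t) t :=
  ((hf.contDiffAt (Ioo_mem_nhds ht.1 ht.2)).differentiableAt (by norm_num)).hasDerivAt

lemma mul_mem_Ioo_symm {δ u t : ℝ} (hu : u ∈ Icc (0 : ℝ) 1) (ht : t ∈ Ioo (-δ) δ) :
    u * t ∈ Ioo (-δ) δ := by
  rw [mem_Ioo, ← abs_lt] at ht ⊢
  rw [abs_mul, abs_of_nonneg hu.1]
  nlinarith [abs_nonneg t, hu.2]

lemma continuousOn_weight_mul {δ : ℝ} {w f : ℝ → ℝ} (hw : Continuous w)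
    (hf : ContinuousOn f (Ioo (-δ) δ)) {t : ℝ} (ht : t ∈ Ioo (-δ) δ) :
    ContinuousOn (fun u ↦ w u * f (u * t)) (Icc 0 1) :=
  hw.continuousOn.mul (hf.comp (by fun_prop) fun _ hu ↦ mul_mem_Ioo_symm hu ht)

/-- Differentiation under the integral sign. The weight is arbitrary because each derivative
contributes a factor u, so that the class of these integrals is closed under differentiation and
smoothness follows by induction. -/
lemma hasDerivAt_integral_weight {δ : ℝ} {w f : ℝ → ℝ} (hw : Continuous w) (hf : SmoothNear δ f)
    {t : ℝ} (ht : t ∈ Ioo (-δ) δ) :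
    HasDerivAt (fun s ↦ ∫ u in (0 : ℝ)..1, w u * f (u * s))
      (∫ u in (0 : ℝ)..1, (u * w u) * deriv f (u * t)) t := by
  have ht' : |t| < δ := abs_lt.2 ht
  -- A dominating function needs a bound on `deriv f`, which is available only on a compact
  -- subinterval.
  obtain ⟨a, hta, haδ⟩ := exists_between ht'
  have hsub : Icc (-a) a ⊆ Ioo (-δ) δ := fun x hx ↦ ⟨by linarith [hx.1], by linarith [hx.2]⟩
  obtain ⟨C, hC⟩ := (isCompact_Icc.image_of_continuousOn
    (hf.deriv.continuousOn.mono hsub)).isBounded.exists_norm_le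
  have hs : ∀ s ∈ Ioo (-a) a, s ∈ Ioo (-δ) δ := fun s hs ↦ hsub (Ioo_subset_Icc_self hs)
  have hint : ∀ {v g : ℝ → ℝ}, Continuous v → ContinuousOn g (Ioo (-δ) δ) → ∀ s ∈ Ioo (-δ) δ,
      IntervalIntegrable (fun u ↦ v u * g (u * s)) MeasureTheory.volume 0 1 := by
    intro v g hv hg s hs
    refine ContinuousOn.intervalIntegrable ?_
    rw [uIcc_of_le zero_le_one]
    exact continuousOn_weight_mul hv hg hs
  have hw' : Continuous fun u ↦ u * w u := continuous_id.mul hw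
  have hmem : ∀ u ∈ uIoc (0 : ℝ) 1, u ∈ Icc (0 : ℝ) 1 := by
    intro u hu
    rw [uIoc_of_le zero_le_one] at hu
    exact Ioc_subset_Icc_self hu
  refine (intervalIntegral.hasDerivAt_integral_of_dominated_loc_of_deriv_le
    (F' := fun s u ↦ (u * w u) * deriv f (u * s)) (bound := fun u ↦ |w u| * C) (s := Ioo (-a) a)
    (Ioo_mem_nhds (abs_lt.1 hta).1 (abs_lt.1 hta).2) ?_ (hint hw hf.continuousOn t ht) ?_ ?_
    ?_ ?_).2
  · filter_upwards [Ioo_mem_nhds ht.1 ht.2] with s hs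
    exact (intervalIntegrable_iff.1 (hint hw hf.continuousOn s hs)).aestronglyMeasurable
  · exact (intervalIntegrable_iff.1 (hint hw' hf.deriv.continuousOn t ht)).aestronglyMeasurable
  · refine Eventually.of_forall fun u hu s hs ↦ ?_
    have hu := hmem u hu
    have h1 : ‖deriv f (u * s)‖ ≤ C :=
      hC _ (mem_image_of_mem _ (Ioo_subset_Icc_self (mul_mem_Ioo_symm hu hs)))
    rw [norm_mul, norm_mul, Real.norm_eq_abs, Real.norm_eq_abs, abs_of_nonneg hu.1]
    refine mul_le_mul ?_ h1 (norm_nonneg _) (abs_nonneg _)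
    nlinarith [abs_nonneg (w u), hu.2]
  · exact (Continuous.mul (by fun_prop) continuous_const).intervalIntegrable _ _
  · refine Eventually.of_forall fun u hu s hs ↦ ?_
    have h := ((hf.hasDerivAt (mul_mem_Ioo_symm (hmem u hu) (hsub (Ioo_subset_Icc_self hs)))).comp s
      ((hasDerivAt_id s).const_mul u)).const_mul (w u)
    refine h.congr_deriv ?_
    simp; ring

lemma smoothNear_integral_weight {δ : ℝ} {w f : ℝ → ℝ} (hw : Continuous w)
    (hf : SmoothNear δ f) : SmoothNear δ (fun s ↦ ∫ u in (0 : ℝ)..1, w u * f (u * s)) := by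
  have key : ∀ (n : ℕ) (w f : ℝ → ℝ), Continuous w → SmoothNear δ f →
      ContDiffOn ℝ n (fun s ↦ ∫ u in (0 : ℝ)..1, w u * f (u * s)) (Ioo (-δ) δ) := by
    intro n
    induction n with
    | zero =>
      intro w f hw hf
      exact contDiffOn_zero.2 fun t ht ↦
        (hasDerivAt_integral_weight hw hf ht).continuousAt.continuousWithinAt
    | succ n ih =>
      intro w f hw hf
      rw [Nat.cast_add, Nat.cast_one, contDiffOn_succ_iff_deriv_of_isOpen isOpen_Ioo]
      refine ⟨fun t ht ↦ (hasDerivAt_integral_weight hw hf ht).differentiableAt.differentiableWithinAt,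
        by simp, ?_⟩
      exact (ih (fun u ↦ u * w u) (deriv f) (continuous_id.mul hw) hf.deriv).congr
        fun t ht ↦ (hasDerivAt_integral_weight hw hf ht).deriv
  exact contDiffOn_infty.2 fun n ↦ key n w f hw hf

/-- Hadamard's lemma. -/
lemma SmoothNear.exists_eq_mul {δ : ℝ} {f : ℝ → ℝ} (hf : SmoothNear δ f)
    (hf0 : f 0 = 0) :
    ∃ g, SmoothNear δ g ∧ (∀ t ∈ Ioo (-δ) δ, f t = t * g t) ∧ g 0 = _root_.deriv f 0 := by
  refine ⟨fun s ↦ ∫ u in (0 : ℝ)..1, 1 * _root_.deriv f (u * s),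
    smoothNear_integral_weight continuous_const hf.deriv, fun t ht ↦ ?_, by simp⟩
  have h : ∀ u ∈ uIcc (0 : ℝ) 1, HasDerivAt (fun u ↦ f (u * t)) (t * (1 * _root_.deriv f (u * t))) u := by
    intro u hu
    rw [uIcc_of_le zero_le_one] at hu
    refine ((hf.hasDerivAt (mul_mem_Ioo_symm hu ht)).comp u
      ((hasDerivAt_id u).mul_const t)).congr_deriv ?_
    simp; ring
  have h2 := intervalIntegral.integral_eq_sub_of_hasDerivAt h (by
    refine ContinuousOn.intervalIntegrable ?_
    rw [uIcc_of_le zero_le_one]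
    exact continuousOn_const.mul (continuousOn_weight_mul continuous_const
      hf.deriv.continuousOn ht))
  rw [intervalIntegral.integral_const_mul] at h2
  simp only [one_mul, zero_mul, hf0, sub_zero] at h2 ⊢
  exact h2.symm

/-- Uniqueness of the derivative along an equality of functions on `(-δ, δ)`. -/
lemma deriv_eq_of_eqOn {δ : ℝ} {f g : ℝ → ℝ} (h : ∀ t ∈ Ioo (-δ) δ, f t = g t) {t g' : ℝ}
    (ht : t ∈ Ioo (-δ) δ) (hg : HasDerivAt g g' t) : deriv f t = g' := by
  refine (hg.congr_of_eventuallyEq ?_).deriv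
  filter_upwards [Ioo_mem_nhds ht.1 ht.2] with s hs using h s hs

/-- `f` has the second order Taylor polynomial `a + b t + c t²` at the origin. -/
def Jet2 (f : ℝ → ℝ) (a b c : ℝ) : Prop :=
  ∃ r : ℝ → ℝ, Tendsto r (𝓝 0) (𝓝 0) ∧ ∀ᶠ t in 𝓝 0, f t = a + b * t + c * t ^ 2 + r t * t ^ 2

/-- Hadamard's lemma is applied twice; continuity of the second quotient gives the remainder. -/
lemma SmoothNear.jet2 {δ : ℝ} (hδ : 0 < δ) {f : ℝ → ℝ} (hf : SmoothNear δ f) :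
    Jet2 f (f 0) (_root_.deriv f 0) (_root_.deriv (_root_.deriv f) 0 / 2) := by
  have h0 : (0 : ℝ) ∈ Ioo (-δ) δ := ⟨by linarith, hδ⟩
  obtain ⟨g, hg, hfg, hg0⟩ := SmoothNear.exists_eq_mul
    (f := fun t ↦ f t - f 0) (hf.sub contDiffOn_const) (by simp)
  obtain ⟨k, hk, hgk, hk0⟩ := SmoothNear.exists_eq_mul
    (f := fun t ↦ g t - g 0) (hg.sub contDiffOn_const) (by simp)
  have h1 : ∀ t ∈ Ioo (-δ) δ, _root_.deriv f t = g t + t * _root_.deriv g t := by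
    intro t ht
    refine deriv_eq_of_eqOn (g := fun t ↦ t * g t + f 0)
      (fun s hs ↦ by linarith [hfg s hs]) ht ?_
    refine (((hasDerivAt_id t).mul (hg.hasDerivAt ht)).add_const (f 0)).congr_deriv ?_
    simp
  have h2 : _root_.deriv (_root_.deriv f) 0 = 2 * _root_.deriv g 0 := by
    refine deriv_eq_of_eqOn h1 h0 ?_
    refine ((hg.hasDerivAt h0).add ((hasDerivAt_id 0).mul (hg.deriv.hasDerivAt h0))).congr_deriv ?_
    simp; ring
  have hg0' : g 0 = _root_.deriv f 0 := by rw [h1 0 h0]; simp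
  have hk0' : k 0 = _root_.deriv g 0 := by
    rw [hk0]
    exact ((hg.hasDerivAt h0).sub_const (g 0)).deriv
  refine ⟨fun t ↦ k t - k 0, ?_, ?_⟩
  · have := (hk.continuousOn.continuousAt (Ioo_mem_nhds h0.1 h0.2)).tendsto.sub_const (k 0)
    simpa using this
  · filter_upwards [Ioo_mem_nhds h0.1 h0.2] with t ht
    have e1 := hfg t ht
    have e2 := hgk t ht
    rw [h2, ← hg0', ← hk0']
    linear_combination e1 + t * e2

lemma Jet2.mul {f g : ℝ → ℝ} {a b c a' b' c' : ℝ} (hf : Jet2 f a b c) (hg : Jet2 g a' b' c') :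
    Jet2 (fun t ↦ f t * g t) (a * a') (a * b' + b * a') (a * c' + b * b' + c * a') := by
  obtain ⟨r, hr, hf⟩ := hf
  obtain ⟨s, hs, hg⟩ := hg
  refine ⟨fun t ↦ r t * (a' + b' * t + c' * t ^ 2 + s t * t ^ 2) + (a + b * t + c * t ^ 2) * s t
    + t * (b * c' + c * b' + c * c' * t), ?_, ?_⟩
  · have h1 : Tendsto (fun t : ℝ ↦ t) (𝓝 0) (𝓝 0) := tendsto_id
    have := ((hr.mul ((((h1.const_mul b').const_add a').add ((h1.pow 2).const_mul c')).add
      (hs.mul (h1.pow 2)))).add ((((h1.const_mul b).const_add a).add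
      ((h1.pow 2).const_mul c)).mul hs)).add
      (h1.mul ((h1.const_mul (c * c')).const_add (b * c' + c * b')))
    simpa using this
  · filter_upwards [hf, hg] with t h1 h2
    rw [h1, h2]; ring

lemma Jet2.add {f g : ℝ → ℝ} {a b c a' b' c' : ℝ} (hf : Jet2 f a b c) (hg : Jet2 g a' b' c') :
    Jet2 (fun t ↦ f t + g t) (a + a') (b + b') (c + c') := by
  obtain ⟨r, hr, hf⟩ := hf
  obtain ⟨s, hs, hg⟩ := hg
  refine ⟨fun t ↦ r t + s t, by simpa using hr.add hs, ?_⟩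
  filter_upwards [hf, hg] with t h1 h2
  rw [h1, h2]; ring

lemma Jet2.const_mul {f : ℝ → ℝ} {a b c : ℝ} (hf : Jet2 f a b c) (k : ℝ) :
    Jet2 (fun t ↦ k * f t) (k * a) (k * b) (k * c) := by
  obtain ⟨r, hr, hf⟩ := hf
  refine ⟨fun t ↦ k * r t, by simpa using hr.const_mul k, ?_⟩
  filter_upwards [hf] with t h1
  rw [h1]; ring

lemma Jet2.id : Jet2 (fun t ↦ t) 0 1 0 := ⟨0, tendsto_const_nhds, by simp⟩

lemma Jet2.congr {f g : ℝ → ℝ} {a b c : ℝ} (hf : Jet2 f a b c) (h : ∀ᶠ t in 𝓝 0, g t = f t) :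
    Jet2 g a b c := by
  obtain ⟨r, hr, hf⟩ := hf
  refine ⟨r, hr, ?_⟩
  filter_upwards [hf, h] with t h1 h2
  rw [h2, h1]

/-- This turns an identity between smooth functions into identities between Taylor coefficients,
which is how the limit in the theorem is computed. -/
lemma Jet2.unique {f : ℝ → ℝ} {a b c a' b' c' : ℝ} (hf : Jet2 f a b c) (hf' : Jet2 f a' b' c') :
    a = a' ∧ b = b' ∧ c = c' := by
  obtain ⟨r, hr, h1⟩ := hf
  obtain ⟨s, hs, h2⟩ := hf'
  have ha : a = a' := by
    have e1 := h1.self_of_nhds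
    have e2 := h2.self_of_nhds
    simp at e1 e2
    linarith
  have hid : Tendsto (fun t : ℝ ↦ t) (𝓝[≠] 0) (𝓝 0) := tendsto_id.mono_left nhdsWithin_le_nhds
  have hr' := hr.mono_left (nhdsWithin_le_nhds (s := {0}ᶜ))
  have hs' := hs.mono_left (nhdsWithin_le_nhds (s := {0}ᶜ))
  have hne : ∀ᶠ t : ℝ in 𝓝[≠] 0, t ≠ 0 := self_mem_nhdsWithin
  have hb : b = b' := by
    have h3 := (((hid.const_mul c).add (hr'.mul hid)).const_add b)
    have h4 := (((hid.const_mul c').add (hs'.mul hid)).const_add b')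
    simp only [mul_zero, add_zero] at h3 h4
    refine tendsto_nhds_unique h3 (h4.congr' ?_)
    filter_upwards [h1.filter_mono nhdsWithin_le_nhds, h2.filter_mono nhdsWithin_le_nhds, hne]
      with t e1 e2 ht
    apply mul_right_cancel₀ ht
    linear_combination e1 - e2 + ha
  have h3 := hr'.const_add c
  have h4 := hs'.const_add c'
  simp only [add_zero] at h3 h4
  refine ⟨ha, hb, tendsto_nhds_unique h3 (h4.congr' ?_)⟩
  filter_upwards [h1.filter_mono nhdsWithin_le_nhds, h2.filter_mono nhdsWithin_le_nhds, hne]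
    with t e1 e2 ht
  apply mul_right_cancel₀ (pow_ne_zero 2 ht)
  linear_combination e1 - e2 + ha + t * hb

end SmoothFunctions

/-! ### Smooth functions of a new coordinate. -/

section InverseFunction

/-- The function is `N` composed with a set-theoretic inverse of `τ`. By injectivity on `I` that
inverse agrees near each image point with the smooth local inverse from the inverse function
theorem. -/
lemma exists_smooth_comp_eq {I : Set ℝ} (hI : IsOpen I) {τ N : ℝ → ℝ} (hτ : ContDiffOn ℝ ∞ τ I)
    (hinj : InjOn τ I) (hτ' : ∀ t ∈ I, deriv τ t ≠ 0) (hN : ContDiffOn ℝ ∞ N I) :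
    ∃ f : ℝ → ℝ, (∀ t ∈ I, ContDiffAt ℝ ∞ f (τ t)) ∧ ∀ t ∈ I, f (τ t) = N t := by
  refine ⟨fun y ↦ N (Function.invFunOn τ I y), fun t ht ↦ ?_, fun t ht ↦ ?_⟩
  · have hτt : ContDiffAt ℝ ∞ τ t := hτ.contDiffAt (hI.mem_nhds ht)
    have hd : HasFDerivAt τ
        ((ContinuousLinearEquiv.unitsEquivAut ℝ (Units.mk0 _ (hτ' t ht)) : ℝ ≃L[ℝ] ℝ) : ℝ →L[ℝ] ℝ)
        t := by
      have h := (hτt.differentiableAt (by norm_num)).hasDerivAt.hasFDerivAt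
      refine h.congr_fderiv ?_
      ext
      simp
    have hn : (∞ : ℕ∞ω) ≠ 0 := by norm_num
    set e := hτt.toOpenPartialHomeomorph τ hd hn with he
    have hsrc : t ∈ e.source := hτt.mem_toOpenPartialHomeomorph_source hd hn
    have hcoe : (e : ℝ → ℝ) = τ := hτt.toOpenPartialHomeomorph_coe hd hn
    have hinv : ContDiffAt ℝ ∞ e.symm (τ t) := hτt.to_localInverse hd hn
    have htgt : τ t ∈ e.target := by rw [← hcoe]; exact e.map_source hsrc
    have hsymm : e.symm (τ t) = t := by
      have := e.left_inv hsrc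
      rwa [hcoe] at this
    have hNt : ContDiffAt ℝ ∞ N (e.symm (τ t)) := by
      rw [hsymm]; exact hN.contDiffAt (hI.mem_nhds ht)
    refine (hNt.comp _ hinv).congr_of_eventuallyEq ?_
    have hmem : ∀ᶠ y in 𝓝 (τ t), e.symm y ∈ I :=
      hinv.continuousAt.preimage_mem_nhds (by rw [hsymm]; exact hI.mem_nhds ht)
    filter_upwards [hmem, e.open_target.mem_nhds htgt] with y hy hy'
    have hy2 : τ (e.symm y) = y := by rw [← hcoe]; exact e.right_inv hy'
    have hex : ∃ a ∈ I, τ a = y := ⟨_, hy, hy2⟩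
    have : Function.invFunOn τ I y = e.symm y :=
      hinj (Function.invFunOn_mem hex) hy ((Function.invFunOn_eq hex).trans hy2.symm)
    simp [this]
  · have hex : ∃ a ∈ I, τ a = τ t := ⟨t, ht, rfl⟩
    simp only
    rw [hinj (Function.invFunOn_mem hex) ht (Function.invFunOn_eq hex)]

end InverseFunction

/-! ### The primitive of a smooth multiple of |t|^(2/3). -/

section SignedPower

/-- `t ↦ t |t|^(2/3)` is a primitive of `(5/3) |t|^(2/3)`. -/
lemma hasDerivAt_mul_abs_rpow (t : ℝ) :
    HasDerivAt (fun t : ℝ ↦ t * |t| ^ (2 / 3 : ℝ)) (5 / 3 * |t| ^ (2 / 3 : ℝ)) t := by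
  rcases lt_trichotomy t 0 with ht | rfl | ht
  · have h1 := ((hasDerivAt_id t).neg.rpow_const (p := (5 / 3 : ℝ)) (Or.inl (by simpa using ht.ne))).neg
    have h2 : HasDerivAt (fun t : ℝ ↦ -((-t) ^ (5 / 3 : ℝ))) (5 / 3 * |t| ^ (2 / 3 : ℝ)) t := by
      refine h1.congr_deriv ?_
      rw [abs_of_neg ht]
      norm_num
    refine h2.congr_of_eventuallyEq ?_
    filter_upwards [Iio_mem_nhds ht] with s hs
    have hs' : 0 < -s := by simpa using hs
    rw [abs_of_neg hs, show (5 / 3 : ℝ) = 1 + 2 / 3 by norm_num, Real.rpow_add hs', Real.rpow_one]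
    ring
  · rw [hasDerivAt_iff_tendsto_slope_zero]
    have h : Tendsto (fun t : ℝ ↦ |t| ^ (2 / 3 : ℝ)) (𝓝[≠] 0) (𝓝 (5 / 3 * |0| ^ (2 / 3 : ℝ))) := by
      have hc : ContinuousAt (fun t : ℝ ↦ |t| ^ (2 / 3 : ℝ)) 0 :=
        (continuous_abs.continuousAt).rpow_const (Or.inr (by norm_num))
      have := hc.tendsto.mono_left (nhdsWithin_le_nhds (s := {0}ᶜ))
      simpa using this
    refine h.congr' ?_
    filter_upwards [self_mem_nhdsWithin] with s hs
    have hs : s ≠ 0 := hs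
    simp [hs]
  · have h1 := ((hasDerivAt_id t).rpow_const (p := (5 / 3 : ℝ)) (Or.inl (by simpa using ht.ne')))
    have h2 : HasDerivAt (fun t : ℝ ↦ t ^ (5 / 3 : ℝ)) (5 / 3 * |t| ^ (2 / 3 : ℝ)) t := by
      refine h1.congr_deriv ?_
      rw [abs_of_pos ht]
      norm_num
    refine h2.congr_of_eventuallyEq ?_
    filter_upwards [Ioi_mem_nhds ht] with s hs
    rw [abs_of_pos hs, show (5 / 3 : ℝ) = 1 + 2 / 3 by norm_num, Real.rpow_add hs, Real.rpow_one]

/-- The primitive `∫₀ᵗ |u|^(2/3) k(u) du` is `t |t|^(2/3) h(t)` for a smooth `h`. -/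
lemma exists_integral_abs_rpow_mul {ε : ℝ} {k : ℝ → ℝ} (hk : SmoothNear ε k)
    (hkpos : ∀ t ∈ Ioo (-ε) ε, 0 < k t) :
    ∃ h : ℝ → ℝ, SmoothNear ε h ∧ (∀ t ∈ Ioo (-ε) ε, 0 < h t) ∧
      (∀ t ∈ Ioo (-ε) ε, k t = 5 / 3 * h t + t * deriv h t) ∧
      ∀ t ∈ Ioo (-ε) ε, ∫ u in (0 : ℝ)..t, |u| ^ (2 / 3 : ℝ) * k u = t * |t| ^ (2 / 3 : ℝ) * h t := by
  have hw : Continuous fun u : ℝ ↦ |u| ^ (2 / 3 : ℝ) :=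
    continuous_abs.rpow_const fun _ ↦ Or.inr (by norm_num)
  set h : ℝ → ℝ := fun t ↦ ∫ u in (0 : ℝ)..1, |u| ^ (2 / 3 : ℝ) * k (u * t) with hdef
  have hh : SmoothNear ε h := smoothNear_integral_weight hw hk
  have hint : ∀ {v g : ℝ → ℝ}, Continuous v → ContinuousOn g (Ioo (-ε) ε) → ∀ s ∈ Ioo (-ε) ε,
      IntervalIntegrable (fun u ↦ v u * g (u * s)) MeasureTheory.volume 0 1 := by
    intro v g hv hg s hs
    refine ContinuousOn.intervalIntegrable ?_
    rw [uIcc_of_le zero_le_one]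
    exact continuousOn_weight_mul hv hg hs
  have hode : ∀ t ∈ Ioo (-ε) ε, k t = 5 / 3 * h t + t * deriv h t := by
    intro t ht
    -- Integrating this derivative over [0, 1] gives k = (5/3) h + t h'.
    have h1 : ∀ u ∈ uIcc (0 : ℝ) 1, HasDerivAt (fun u ↦ u * |u| ^ (2 / 3 : ℝ) * k (u * t))
        (5 / 3 * (|u| ^ (2 / 3 : ℝ) * k (u * t)) + t * (u * |u| ^ (2 / 3 : ℝ) * deriv k (u * t)))
        u := by
      intro u hu
      rw [uIcc_of_le zero_le_one] at hu
      refine ((hasDerivAt_mul_abs_rpow u).mul ((hk.hasDerivAt (mul_mem_Ioo_symm hu ht)).comp u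
        ((hasDerivAt_id u).mul_const t))).congr_deriv ?_
      simp; ring
    have i1 := (hint hw hk.continuousOn t ht).const_mul (5 / 3)
    have i2 := (hint (continuous_id.mul hw) hk.deriv.continuousOn t ht).const_mul t
    have h2 := intervalIntegral.integral_eq_sub_of_hasDerivAt h1 (i1.add i2)
    have h3 : deriv h t = ∫ u in (0 : ℝ)..1, u * |u| ^ (2 / 3 : ℝ) * deriv k (u * t) :=
      (hasDerivAt_integral_weight hw hk ht).deriv
    rw [h3, hdef]
    have h4 := intervalIntegral.integral_add i1 i2
    rw [intervalIntegral.integral_const_mul, intervalIntegral.integral_const_mul] at h4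
    simp only [abs_one, Real.one_rpow, mul_one, one_mul, zero_mul, sub_zero] at h2
    rw [← h2]
    exact h4
  refine ⟨h, hh, fun t ht ↦ ?_, hode, fun t ht ↦ ?_⟩
  · refine intervalIntegral.intervalIntegral_pos_of_pos_on (hint hw hk.continuousOn t ht) ?_
      zero_lt_one
    intro u hu
    exact mul_pos (Real.rpow_pos_of_pos (abs_pos.2 hu.1.ne') _)
      (hkpos _ (mul_mem_Ioo_symm (Ioo_subset_Icc_self hu) ht))
  · have hε : 0 < ε := by linarith [ht.1, ht.2]
    have hsub : uIcc 0 t ⊆ Ioo (-ε) ε :=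
      (ordConnected_Ioo.uIcc_subset ⟨by linarith, hε⟩ ht)
    have h1 : ∀ u ∈ uIcc 0 t, HasDerivAt (fun u ↦ u * |u| ^ (2 / 3 : ℝ) * h u)
        (|u| ^ (2 / 3 : ℝ) * k u) u := by
      intro u hu
      refine ((hasDerivAt_mul_abs_rpow u).mul (hh.hasDerivAt (hsub hu))).congr_deriv ?_
      rw [hode u (hsub hu)]; ring
    rw [intervalIntegral.integral_eq_sub_of_hasDerivAt h1
      ((hw.continuousOn.mul (hk.continuousOn.mono hsub)).intervalIntegrable)]
    simp

end SignedPower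

/-! ### Fractional powers with the sign convention of the statement. -/

section FracPow

lemma fracPow_eq_abs {m n : ℕ} (h : Even (m * n)) (x : ℝ) : fracPow x m n = |x| ^ ((m : ℝ) / n) := by
  unfold fracPow
  split_ifs with hx
  · rw [abs_of_nonneg hx]
  · rw [h.neg_one_pow, one_mul]

lemma abs_fracPow (x : ℝ) (m n : ℕ) : |fracPow x m n| = |x| ^ ((m : ℝ) / n) := by
  unfold fracPow
  split_ifs with hx
  · rw [abs_of_nonneg (Real.rpow_nonneg hx _), abs_of_nonneg hx]
  · rw [abs_mul, abs_pow, abs_neg, abs_one, one_pow, one_mul,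
      abs_of_nonneg (Real.rpow_nonneg (abs_nonneg _) _)]

lemma fracPow_neg_of_odd {m n : ℕ} (h : Odd (m * n)) {x : ℝ} (hx : 0 < x) :
    fracPow (-x) m n = -x ^ ((m : ℝ) / n) := by
  unfold fracPow
  rw [if_neg (by linarith), h.neg_one_pow, abs_neg, abs_of_pos hx]
  ring

/-- The factor t |t|^(2/3) is the odd power t^(5/3), and 3 · 5 is odd, so the power 3/5 recovers t
with its sign. -/
lemma fracPow_mul_abs_rpow {t h : ℝ} (hh : 0 < h) :
    fracPow (t * |t| ^ (2 / 3 : ℝ) * h) 3 5 = t * h ^ (3 / 5 : ℝ) := by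
  have key : ∀ t : ℝ, 0 < t →
      (t * |t| ^ (2 / 3 : ℝ) * h) ^ ((3 : ℕ) / (5 : ℕ) : ℝ) = t * h ^ (3 / 5 : ℝ) := by
    intro t ht
    have h1 : t * |t| ^ (2 / 3 : ℝ) = t ^ (5 / 3 : ℝ) := by
      rw [abs_of_pos ht, show (5 / 3 : ℝ) = 1 + 2 / 3 by norm_num, Real.rpow_add ht, Real.rpow_one]
    rw [h1, Real.mul_rpow (Real.rpow_nonneg ht.le _) hh.le, ← Real.rpow_mul ht.le]
    norm_num
  rcases lt_trichotomy t 0 with ht | rfl | ht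
  · have hpos : 0 < -t * |-t| ^ (2 / 3 : ℝ) * h :=
      mul_pos (mul_pos (by linarith) (Real.rpow_pos_of_pos (by simpa using ht.ne) _)) hh
    have h2 : t * |t| ^ (2 / 3 : ℝ) * h = -(-t * |-t| ^ (2 / 3 : ℝ) * h) := by
      rw [abs_neg]; ring
    rw [h2, fracPow_neg_of_odd (by decide) hpos, key (-t) (by linarith)]
    ring
  · simp [fracPow]
  · rw [fracPow, if_pos (mul_pos (mul_pos ht (Real.rpow_pos_of_pos (abs_pos.2 ht.ne') _)) hh).le,
      key t ht]

end FracPow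

/-! ### Abstract bracket systems at a cusp. -/

/-- The brackets `[γ^(i), γ^(j)]` of a curve with vanishing velocity at the origin, as an abstract
system of functions on `(-δ, δ)`. -/
structure BracketSystem (A : ℕ → ℕ → ℝ → ℝ) (δ : ℝ) : Prop where
  smooth : ∀ i j, SmoothNear δ (A (i + 1) (j + 1))
  hasDerivAt : ∀ i j, ∀ t ∈ Ioo (-δ) δ,
    HasDerivAt (A (i + 1) (j + 1)) (A (i + 2) (j + 1) t + A (i + 1) (j + 2) t) t
  self : ∀ i t, A i i t = 0
  zero : ∀ j, A 1 j 0 = 0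

section BracketSystem

variable (A : ℕ → ℕ → ℝ → ℝ)

/-- With `A := bracket D Ω γ`, this and the four definitions that follow unfold to the quantities of
the statement, so results on abstract systems transfer by definitional equality. -/
def sysCurvature (t : ℝ) : ℝ :=
  (3 * A 1 2 t * A 1 4 t + 12 * A 1 2 t * A 2 3 t - 5 * A 1 3 t ^ 2) / (9 * fracPow (A 1 2 t) 8 3)

def sysArclength (t : ℝ) : ℝ := ∫ u in (0 : ℝ)..t, |fracPow (A 1 2 u) 1 3|

def sysTau (t : ℝ) : ℝ := fracPow (sysArclength A t) 3 5

def sysNormalizedCurvature (t : ℝ) : ℝ := sysArclength A t ^ 2 * sysCurvature A t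

def sysCuspidalCurvature : ℝ :=
  (24 * A 2 3 0 * A 2 5 0 + 60 * A 2 3 0 * A 3 4 0 - 35 * A 2 4 0 ^ 2) / fracPow (A 2 3 0) 12 5

variable {A}

/-- The numerator is quadratic in `A`, and the power 8/3 is even because 8 · 3 is. Together with its
companions this reduces everything to A_23(0) > 0. -/
lemma sysCurvature_neg : sysCurvature (-A) = sysCurvature A := by
  ext t
  simp [sysCurvature, fracPow_eq_abs (show Even (8 * 3) by decide)]

lemma sysArclength_neg : sysArclength (-A) = sysArclength A := by
  ext t
  simp [sysArclength, abs_fracPow]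

lemma sysTau_neg : sysTau (-A) = sysTau A := by
  ext t
  rw [sysTau, sysTau, sysArclength_neg]

lemma sysNormalizedCurvature_neg : sysNormalizedCurvature (-A) = sysNormalizedCurvature A := by
  ext t
  rw [sysNormalizedCurvature, sysNormalizedCurvature, sysArclength_neg, sysCurvature_neg]

lemma sysCuspidalCurvature_neg : sysCuspidalCurvature (-A) = sysCuspidalCurvature A := by
  simp [sysCuspidalCurvature, fracPow_eq_abs (show Even (12 * 5) by decide)]

lemma BracketSystem.neg {δ : ℝ} (h : BracketSystem A δ) : BracketSystem (-A) δ where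
  smooth i j := (h.smooth i j).neg
  hasDerivAt i j t ht := by
    refine (h.hasDerivAt i j t ht).neg.congr_deriv ?_
    simp; ring
  self i t := by simp [h.self]
  zero j := by simp [h.zero]

lemma BracketSystem.mono {δ ε : ℝ} (h : BracketSystem A δ) (hε : ε ≤ δ) : BracketSystem A ε where
  smooth i j := (h.smooth i j).mono (Ioo_subset_Ioo (by linarith) hε)
  hasDerivAt i j t ht := h.hasDerivAt i j t (Ioo_subset_Ioo (by linarith) hε ht)
  self := h.self
  zero := h.zero

/-- `[γ', γ''] = t² g(t)` with `g` smooth, together with the Taylor coefficients of `g` and of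
`[γ'', γ''']` at the cusp. -/
lemma BracketSystem.exists_eq_sq_mul {δ : ℝ} (hδ : 0 < δ) (h : BracketSystem A δ) :
    ∃ g, SmoothNear δ g ∧ (∀ t ∈ Ioo (-δ) δ, A 1 2 t = t ^ 2 * g t) ∧
      (∀ t ∈ Ioo (-δ) δ, A 1 3 t = 2 * t * g t + t ^ 2 * deriv g t) ∧
      (∀ t ∈ Ioo (-δ) δ, A 2 3 t + A 1 4 t
        = 2 * g t + 4 * t * deriv g t + t ^ 2 * deriv (deriv g) t) ∧
      A 2 3 0 = 2 * g 0 ∧ deriv (A 2 3) 0 = 3 * deriv g 0 ∧ A 2 4 0 = 3 * deriv g 0 ∧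
      12 * deriv (deriv g) 0 = 3 * A 2 5 0 + 2 * A 3 4 0 ∧
      deriv (deriv (A 2 3)) 0 = A 3 4 0 + A 2 5 0 := by
  have h0 : (0 : ℝ) ∈ Ioo (-δ) δ := ⟨by linarith, hδ⟩
  have d12 : ∀ t ∈ Ioo (-δ) δ, HasDerivAt (A 1 2) (A 1 3 t) t := fun t ht ↦ by
    simpa [h.self] using h.hasDerivAt 0 1 t ht
  have d13 : ∀ t ∈ Ioo (-δ) δ, HasDerivAt (A 1 3) (A 2 3 t + A 1 4 t) t := fun t ht ↦ by
    simpa using h.hasDerivAt 0 2 t ht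
  have d23 : ∀ t ∈ Ioo (-δ) δ, HasDerivAt (A 2 3) (A 2 4 t) t := fun t ht ↦ by
    simpa [h.self] using h.hasDerivAt 1 2 t ht
  have d14 : ∀ t ∈ Ioo (-δ) δ, HasDerivAt (A 1 4) (A 2 4 t + A 1 5 t) t := fun t ht ↦ by
    simpa using h.hasDerivAt 0 3 t ht
  have d24 : ∀ t ∈ Ioo (-δ) δ, HasDerivAt (A 2 4) (A 3 4 t + A 2 5 t) t := fun t ht ↦ by
    simpa using h.hasDerivAt 1 3 t ht
  have d15 : ∀ t ∈ Ioo (-δ) δ, HasDerivAt (A 1 5) (A 2 5 t + A 1 6 t) t := fun t ht ↦ by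
    simpa using h.hasDerivAt 0 4 t ht
  obtain ⟨a, ha, ha1, ha0⟩ := (h.smooth 0 1).exists_eq_mul (h.zero 2)
  -- The derivative of A_12 is A_13, since A_22 = 0, and A_13 also vanishes at 0; hence a second
  -- factor t splits off.
  have ha0' : a 0 = 0 := by rw [ha0, (d12 0 h0).deriv, h.zero]
  obtain ⟨g, hg, hg1, -⟩ := ha.exists_eq_mul ha0'
  have e12 : ∀ t ∈ Ioo (-δ) δ, A 1 2 t = t ^ 2 * g t := fun t ht ↦ by
    have := ha1 t ht
    simp only [zero_add, one_add_one_eq_two] at this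
    rw [this, hg1 t ht]; ring
  have hgd := fun t ht ↦ hg.hasDerivAt (t := t) ht
  have hgd2 := fun t ht ↦ hg.deriv.hasDerivAt (t := t) ht
  have hgd3 := fun t ht ↦ hg.deriv.deriv.hasDerivAt (t := t) ht
  have hgd4 := fun t ht ↦ hg.deriv.deriv.deriv.hasDerivAt (t := t) ht
  have e13 : ∀ t ∈ Ioo (-δ) δ, A 1 3 t = 2 * t * g t + t ^ 2 * deriv g t := fun t ht ↦ by
    rw [← (d12 t ht).deriv]
    refine deriv_eq_of_eqOn e12 ht ?_
    refine ((hasDerivAt_pow 2 t).mul (hgd t ht)).congr_deriv ?_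
    simp
  have e14 : ∀ t ∈ Ioo (-δ) δ, A 2 3 t + A 1 4 t
      = 2 * g t + 4 * t * deriv g t + t ^ 2 * deriv (deriv g) t := fun t ht ↦ by
    rw [← (d13 t ht).deriv]
    refine deriv_eq_of_eqOn e13 ht ?_
    refine ((((hasDerivAt_id t).const_mul 2).mul (hgd t ht)).add
      ((hasDerivAt_pow 2 t).mul (hgd2 t ht))).congr_deriv ?_
    simp; ring
  have e15 : ∀ t ∈ Ioo (-δ) δ, A 2 4 t + (A 2 4 t + A 1 5 t)
      = 6 * deriv g t + 6 * t * deriv (deriv g) t + t ^ 2 * deriv (deriv (deriv g)) t :=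
    fun t ht ↦ by
    rw [← ((d23 t ht).add (d14 t ht)).deriv]
    refine deriv_eq_of_eqOn e14 ht ?_
    refine ((((hgd t ht).const_mul 2).add (((hasDerivAt_id t).const_mul 4).mul (hgd2 t ht))).add
      ((hasDerivAt_pow 2 t).mul (hgd3 t ht))).congr_deriv ?_
    simp; ring
  -- Fourth derivative of A_12 = t² g at the origin; A_16(0) = 0 then leaves the relation between
  -- g''(0), A_25(0) and A_34(0).
  have e16 : A 3 4 0 + A 2 5 0 + (A 3 4 0 + A 2 5 0 + (A 2 5 0 + A 1 6 0))
      = 12 * deriv (deriv g) 0 := by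
    rw [← ((d24 0 h0).add ((d24 0 h0).add (d15 0 h0))).deriv]
    refine deriv_eq_of_eqOn e15 h0 ?_
    refine ((((hgd2 0 h0).const_mul 6).add (((hasDerivAt_id 0).const_mul 6).mul (hgd3 0 h0))).add
      ((hasDerivAt_pow 2 0).mul (hgd4 0 h0))).congr_deriv ?_
    simp; ring
  have z14 := e14 0 h0
  have z15 := e15 0 h0
  rw [h.zero] at z14 z15 e16
  simp only [mul_zero, zero_mul, add_zero, zero_pow two_ne_zero] at z14 z15
  refine ⟨g, hg, e12, e13, e14, z14, ?_, by linarith, by linarith, ?_⟩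
  · rw [(d23 0 h0).deriv]; linarith
  · exact deriv_eq_of_eqOn (fun t ht ↦ (d23 t ht).deriv) h0 (d24 0 h0)

end BracketSystem

/-! ### The Taylor expansion of the normalized curvature. -/

section NormalForm

variable {A : ℕ → ℕ → ℝ → ℝ}

lemma abs_rpow_two_thirds_cube (t : ℝ) : (|t| ^ (2 / 3 : ℝ)) ^ 3 = t ^ 2 := by
  rw [← Real.rpow_natCast, ← Real.rpow_mul (abs_nonneg t), ← sq_abs, ← Real.rpow_natCast]
  norm_num

/-- The second order Taylor polynomial of the normalized affine curvature, in terms of that of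
`k = [γ', γ'']^(1/3) / t^(2/3)` and of the brackets at the cusp. -/
lemma jet2_normalizedCurvature {ε : ℝ} (hε : 0 < ε) {g k h ψ N : ℝ → ℝ} {a₂₅ a₃₄ : ℝ}
    (hg : SmoothNear ε g) (hk : SmoothNear ε k) (hh : SmoothNear ε h) (hψ : SmoothNear ε ψ)
    (hN : SmoothNear ε N) (hkg : ∀ t ∈ Ioo (-ε) ε, k t ^ 3 = g t) (hk0 : k 0 ≠ 0)
    (hode : ∀ t ∈ Ioo (-ε) ε, k t = 5 / 3 * h t + t * deriv h t)
    (hψ0 : ψ 0 = 2 * g 0) (hψ1 : deriv ψ 0 = 3 * deriv g 0)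
    (hg2 : 12 * deriv (deriv g) 0 = 3 * a₂₅ + 2 * a₃₄) (hψ2 : deriv (deriv ψ) 0 = a₃₄ + a₂₅)
    (hNeq : ∀ t ∈ Ioo (-ε) ε, 9 * k t ^ 8 * N t = h t ^ 2 * (-14 * g t ^ 2 + 9 * (g t * ψ t)
      - 8 * (t * (g t * deriv g t)) + t * (t * (3 * (g t * deriv (deriv g) t)
        - 5 * deriv g t ^ 2)))) :
    Jet2 N (4 / 25) 0 (3 / 4400 * (24 * (2 * g 0) * a₂₅ + 60 * (2 * g 0) * a₃₄
      - 35 * (3 * deriv g 0) ^ 2) / k 0 ^ 6) := by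
  have h0 : (0 : ℝ) ∈ Ioo (-ε) ε := ⟨by linarith, hε⟩
  have hnhds : Ioo (-ε) ε ∈ 𝓝 (0 : ℝ) := Ioo_mem_nhds h0.1 h0.2
  have jk := hk.jet2 hε
  have jg := hg.jet2 hε
  have jh := hh.jet2 hε
  have jψ := hψ.jet2 hε
  have jN := hN.jet2 hε
  have jg1 := hg.deriv.jet2 hε
  have jg2 := hg.deriv.deriv.jet2 hε
  -- Coefficients of g = k³, so that all unknowns can be expressed through those of k.
  obtain ⟨eg0, eg1, eg2⟩ := Jet2.unique jg ((jk.mul (jk.mul jk)).congr (by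
    filter_upwards [hnhds] with t ht
    rw [← hkg t ht]; ring))
  have eh0 : h 0 = 3 / 5 * k 0 := by rw [hode 0 h0]; ring
  -- Differentiating k = (5/3) h + t h' multiplies the n-th Taylor coefficient of h by 5/3 + n; this
  -- produces the factors 3/5, 3/8 and 3/11.
  have d1 : ∀ t ∈ Ioo (-ε) ε, deriv k t = 8 / 3 * deriv h t + t * deriv (deriv h) t := by
    intro t ht
    refine deriv_eq_of_eqOn hode ht ?_
    refine (((hh.hasDerivAt ht).const_mul (5 / 3)).add
      ((hasDerivAt_id t).mul (hh.deriv.hasDerivAt ht))).congr_deriv ?_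
    simp; ring
  have d2 : deriv (deriv k) 0 = 11 / 3 * deriv (deriv h) 0 := by
    refine deriv_eq_of_eqOn d1 h0 ?_
    refine (((hh.deriv.hasDerivAt h0).const_mul (8 / 3)).add
      ((hasDerivAt_id 0).mul (hh.deriv.deriv.hasDerivAt h0))).congr_deriv ?_
    simp; ring
  have eh1 : deriv h 0 = 3 / 8 * deriv k 0 := by rw [d1 0 h0]; ring
  have eh2 : deriv (deriv h) 0 = 3 / 11 * deriv (deriv k) 0 := by rw [d2]; ring
  have jk2 := jk.mul jk
  have jk4 := jk2.mul jk2
  have jk8 := jk4.mul jk4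
  have jL := ((jk8.mul jN).const_mul 9)
  have jQ := ((((jg.mul jg).const_mul (-14)).add ((jg.mul jψ).const_mul 9)).add
    ((Jet2.id.mul (jg.mul jg1)).const_mul (-8))).add
    (Jet2.id.mul (Jet2.id.mul (((jg.mul jg2).const_mul 3).add ((jg1.mul jg1).const_mul (-5)))))
  have jR := (jh.mul jh).mul jQ
  obtain ⟨e0, e1, e2⟩ := Jet2.unique jL (jR.congr (by
    filter_upwards [hnhds] with t ht
    linear_combination hNeq t ht))
  -- What remains is polynomial algebra in the coefficients, solved order by order for those of `N`.
  generalize k 0 = k0 at *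
  generalize deriv k 0 = k1 at *
  generalize deriv (deriv k) 0 = k2 at *
  generalize deriv (deriv g) 0 = g2 at *
  rw [eh0] at e0 e1 e2
  rw [eh1] at e1 e2
  rw [eh2] at e2
  rw [hψ0] at e0 e1 e2
  rw [hψ1] at e1 e2
  rw [hψ2] at e2
  rw [eg0] at e0 e1 e2
  rw [eg1] at e1 e2
  have n0 : N 0 = 4 / 25 := by
    have : 9 * k0 ^ 8 * N 0 = 9 * k0 ^ 8 * (4 / 25) := by linear_combination e0
    exact mul_left_cancel₀ (by positivity) this
  have n1 : deriv N 0 = 0 := by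
    rw [n0] at e1
    have : 9 * k0 ^ 8 * deriv N 0 = 9 * k0 ^ 8 * 0 := by linear_combination e1
    exact mul_left_cancel₀ (by positivity) this
  rw [n0, n1] at e2 jN
  have ea : a₃₄ = 3 / 2 * (4 * g2 - a₂₅) := by linear_combination -hg2 / 2
  have eg2' : g2 = 2 * (k0 * (k0 * (k2 / 2) + k1 * k1 + k2 / 2 * k0) + k1 * (k0 * k1 + k1 * k0)
      + k2 / 2 * (k0 * k0)) := by linear_combination 2 * eg2
  convert jN using 1
  rw [eg0, eg1]
  rw [ea, eg2'] at e2 ⊢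
  rw [div_eq_iff (pow_ne_zero 6 hk0)]
  refine mul_left_cancel₀ (show 9 * k0 ^ 2 ≠ 0 by positivity) ?_
  linear_combination (-1) * e2

end NormalForm

/-! ### Part (i) for abstract bracket systems. -/

section NormalForm

variable {A : ℕ → ℕ → ℝ → ℝ}

lemma pos_of_ne_zero_of_pos {ε : ℝ} {g : ℝ → ℝ} (hg : ContinuousOn g (Ioo (-ε) ε))
    (hne : ∀ t ∈ Ioo (-ε) ε, g t ≠ 0) (h0 : 0 < g 0) : ∀ t ∈ Ioo (-ε) ε, 0 < g t := by
  intro t ht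
  have hε : 0 < ε := by linarith [ht.1, ht.2]
  by_contra! hlt
  obtain ⟨s, hs, hs0⟩ := isPreconnected_Ioo.intermediate_value ht
    (show (0 : ℝ) ∈ Ioo (-ε) ε from ⟨by linarith, hε⟩) hg ⟨hlt, h0.le⟩
  exact hne s hs hs0

/-- The constant in the asymptotics of the normalized affine curvature. -/
lemma cuspidal_constant {k : ℝ} (hk : 0 < k) (m : ℝ) :
    3 / 4400 * m / k ^ 6 / (3 / 5 * k) ^ (6 / 5 : ℝ)
      = 1 / 220 * (20 / 3 : ℝ) ^ (1 / 5 : ℝ) * (m / (2 * k ^ 3) ^ (12 / 5 : ℝ)) := by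
  have h1 : (3 / 5 * k) ^ (6 / 5 : ℝ) = 3 / 5 * (3 / 5 : ℝ) ^ (1 / 5 : ℝ) * k ^ (6 / 5 : ℝ) := by
    rw [Real.mul_rpow (by norm_num) hk.le, show (6 / 5 : ℝ) = 1 + 1 / 5 by norm_num,
      Real.rpow_add (by norm_num), Real.rpow_one]
  have h2 : (2 * k ^ 3) ^ (12 / 5 : ℝ) = 4 * (4 : ℝ) ^ (1 / 5 : ℝ) * (k ^ 6 * k ^ (6 / 5 : ℝ)) := by
    rw [Real.mul_rpow (by norm_num) (by positivity), show (12 / 5 : ℝ) = 2 * (1 + 1 / 5) by norm_num,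
      Real.rpow_mul (by norm_num), Real.rpow_add (by norm_num), Real.rpow_one,
      ← Real.rpow_natCast k 3, ← Real.rpow_mul hk.le, ← Real.rpow_natCast k 6, ← Real.rpow_add hk]
    norm_num
  -- Source of the fifth root of 20/3: μ_A contributes 4^(1/5) through 2^(12/5), and τ² contributes
  -- (3/5)^(1/5) through h(0) = (3/5) k(0).
  have h3 : (4 : ℝ) ^ (1 / 5 : ℝ) = (20 / 3 : ℝ) ^ (1 / 5 : ℝ) * (3 / 5 : ℝ) ^ (1 / 5 : ℝ) := by
    rw [← Real.mul_rpow (by norm_num) (by norm_num)]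
    norm_num
  rw [h1, h2, h3]
  have p1 : 0 < (20 / 3 : ℝ) ^ (1 / 5 : ℝ) := Real.rpow_pos_of_pos (by norm_num) _
  have p2 : 0 < (3 / 5 : ℝ) ^ (1 / 5 : ℝ) := Real.rpow_pos_of_pos (by norm_num) _
  have p3 : 0 < k ^ (6 / 5 : ℝ) := Real.rpow_pos_of_pos hk _
  generalize (20 / 3 : ℝ) ^ (1 / 5 : ℝ) = x at *
  generalize (3 / 5 : ℝ) ^ (1 / 5 : ℝ) = y at *
  generalize k ^ (6 / 5 : ℝ) = z at *
  field_simp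
  ring

/-- Positivity of A_23(0) = 2 g(0), with no inflection off 0, makes g positive on the whole
interval; thus g^(1/3) is smooth there and the factorizations of s_A, τ and κ_A hold up to ε. -/
lemma BracketSystem.normal_form_of_pos {ε : ℝ} (hε : 0 < ε) (hA : BracketSystem A ε)
    (hpos : 0 < A 2 3 0) (hne : ∀ t ∈ Ioo (-ε) ε, t ≠ 0 → A 1 2 t ≠ 0) :
    sysTau A 0 = 0 ∧ SmoothNear ε (sysTau A) ∧ (∀ t ∈ Ioo (-ε) ε, 0 < deriv (sysTau A) t) ∧
    (∃ N, SmoothNear ε N ∧ (∀ t ∈ Ioo (-ε) ε, t ≠ 0 → N t = sysNormalizedCurvature A t) ∧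
      N 0 = 4 / 25 ∧ deriv N 0 = 0) ∧
    Tendsto (fun t ↦ (sysNormalizedCurvature A t - 4 / 25) / sysTau A t ^ 2) (𝓝[≠] 0)
      (𝓝 (1 / 220 * (20 / 3 : ℝ) ^ (1 / 5 : ℝ) * sysCuspidalCurvature A)) := by
  have h0 : (0 : ℝ) ∈ Ioo (-ε) ε := ⟨by linarith, hε⟩
  have hnhds : Ioo (-ε) ε ∈ 𝓝 (0 : ℝ) := Ioo_mem_nhds h0.1 h0.2
  obtain ⟨g, hg, e12, e13, e14, c0, c1, c1', c2, c2'⟩ := hA.exists_eq_sq_mul hε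
  have hg0 : 0 < g 0 := by linarith
  have hgpos : ∀ t ∈ Ioo (-ε) ε, 0 < g t := by
    refine pos_of_ne_zero_of_pos hg.continuousOn (fun t ht hgt ↦ ?_) hg0
    rcases eq_or_ne t 0 with rfl | ht0
    · exact hg0.ne' hgt
    · exact hne t ht ht0 (by rw [e12 t ht, hgt, mul_zero])
  set k : ℝ → ℝ := fun t ↦ g t ^ (1 / 3 : ℝ) with hkdef
  have hk : SmoothNear ε k := hg.rpow_const_of_ne fun t ht ↦ (hgpos t ht).ne'
  have hkpos : ∀ t ∈ Ioo (-ε) ε, 0 < k t := fun t ht ↦ Real.rpow_pos_of_pos (hgpos t ht) _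
  have hkg : ∀ t ∈ Ioo (-ε) ε, k t ^ 3 = g t := fun t ht ↦ by
    rw [hkdef, ← Real.rpow_natCast, ← Real.rpow_mul (hgpos t ht).le]
    norm_num
  obtain ⟨h, hh, hhpos, hode, hs⟩ := exists_integral_abs_rpow_mul hk hkpos
  have hcube : ∀ t ∈ Ioo (-ε) ε, |A 1 2 t| = (|t| ^ (2 / 3 : ℝ) * k t) ^ 3 := fun t ht ↦ by
    rw [mul_pow, abs_rpow_two_thirds_cube, hkg t ht, e12 t ht, abs_of_nonneg]
    exact mul_nonneg (sq_nonneg t) (hgpos t ht).le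
  have hak : ∀ t ∈ Ioo (-ε) ε, 0 ≤ |t| ^ (2 / 3 : ℝ) * k t := fun t ht ↦
    mul_nonneg (Real.rpow_nonneg (abs_nonneg t) _) (hkpos t ht).le
  have harc : ∀ t ∈ Ioo (-ε) ε, sysArclength A t = t * |t| ^ (2 / 3 : ℝ) * h t := by
    intro t ht
    rw [← hs t ht, sysArclength]
    refine intervalIntegral.integral_congr fun u hu ↦ ?_
    have hu' : u ∈ Ioo (-ε) ε := ordConnected_Ioo.uIcc_subset h0 ht hu
    rw [abs_fracPow, hcube u hu', ← Real.rpow_natCast, ← Real.rpow_mul (hak u hu')]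
    norm_num
  have htau : ∀ t ∈ Ioo (-ε) ε, sysTau A t = t * h t ^ (3 / 5 : ℝ) := fun t ht ↦ by
    rw [sysTau, harc t ht, fracPow_mul_abs_rpow (hhpos t ht)]
  have htausm : SmoothNear ε (sysTau A) :=
    (contDiffOn_id.mul (hh.rpow_const_of_ne fun t ht ↦ (hhpos t ht).ne')).congr htau
  have htau' : ∀ t ∈ Ioo (-ε) ε, deriv (sysTau A) t = 3 / 5 * h t ^ (-(2 / 5) : ℝ) * k t := by
    intro t ht
    refine deriv_eq_of_eqOn htau ht ?_
    refine ((hasDerivAt_id t).mul ((hh.hasDerivAt ht).rpow_const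
      (p := (3 / 5 : ℝ)) (Or.inl (hhpos t ht).ne'))).congr_deriv ?_
    rw [hode t ht, show (3 / 5 : ℝ) - 1 = -(2 / 5) by norm_num,
      show (3 / 5 : ℝ) = 1 + -(2 / 5) by norm_num, Real.rpow_add (hhpos t ht), Real.rpow_one]
    simp only [id]
    ring
  set ψ := A 2 3 with hψdef
  have hψ : SmoothNear ε ψ := hA.smooth 1 2
  -- The numerator of κ_A divided by t², once A_13 and A_14 are eliminated in favour of g and ψ =
  -- A_23.
  set Q : ℝ → ℝ := fun t ↦ -14 * g t ^ 2 + 9 * (g t * ψ t) - 8 * (t * (g t * deriv g t))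
    + t * (t * (3 * (g t * deriv (deriv g) t) - 5 * deriv g t ^ 2)) with hQdef
  have hQ : SmoothNear ε Q :=
    (((contDiffOn_const.mul (hg.pow 2)).add (contDiffOn_const.mul (hg.mul hψ))).sub
      (contDiffOn_const.mul (contDiffOn_id.mul (hg.mul hg.deriv)))).add
      (contDiffOn_id.mul (contDiffOn_id.mul ((contDiffOn_const.mul (hg.mul hg.deriv.deriv)).sub
        (contDiffOn_const.mul (hg.deriv.pow 2)))))
  -- The powers of |t| cancel: s_A² contributes 10/3 and the numerator 2, against 16/3 from the
  -- denominator.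
  set N : ℝ → ℝ := fun t ↦ h t ^ 2 * Q t / (9 * k t ^ 8) with hNdef
  have hk8 : ∀ t ∈ Ioo (-ε) ε, 9 * k t ^ 8 ≠ 0 := fun t ht ↦
    mul_ne_zero (by norm_num) (pow_ne_zero 8 (hkpos t ht).ne')
  have hN : SmoothNear ε N := ((hh.pow 2).mul hQ).div (contDiffOn_const.mul (hk.pow 8)) hk8
  have hNeq : ∀ t ∈ Ioo (-ε) ε, t ≠ 0 → N t = sysNormalizedCurvature A t := by
    intro t ht ht0
    have ha : 0 < |t| ^ (2 / 3 : ℝ) := Real.rpow_pos_of_pos (abs_pos.2 ht0) _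
    have hnum : 3 * A 1 2 t * A 1 4 t + 12 * A 1 2 t * A 2 3 t - 5 * A 1 3 t ^ 2 = t ^ 2 * Q t := by
      have e : A 1 4 t = 2 * g t + 4 * t * deriv g t + t ^ 2 * deriv (deriv g) t - A 2 3 t := by
        rw [← e14 t ht]; ring
      rw [e, e12 t ht, e13 t ht]
      simp only [hQdef, hψdef]
      ring
    have hden : fracPow (A 1 2 t) 8 3 = (|t| ^ (2 / 3 : ℝ) * k t) ^ 8 := by
      rw [fracPow_eq_abs (by decide), hcube t ht, ← Real.rpow_natCast, ← Real.rpow_mul (hak t ht),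
        ← Real.rpow_natCast]
      norm_num
    rw [sysNormalizedCurvature, sysCurvature, hnum, hden, harc t ht, hNdef]
    have ha3 := abs_rpow_two_thirds_cube t
    generalize |t| ^ (2 / 3 : ℝ) = a at *
    have hkt := (hkpos t ht).ne'
    simp only
    rw [← mul_div_assoc, div_eq_div_iff (hk8 t ht) (by positivity)]
    have ha6 : a ^ 6 = t ^ 4 := by
      calc a ^ 6 = (a ^ 3) ^ 2 := by ring
        _ = t ^ 4 := by rw [ha3]; ring
    linear_combination 9 * h t ^ 2 * Q t * k t ^ 8 * a ^ 2 * ha6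
  have hjet := jet2_normalizedCurvature hε hg hk hh hψ hN hkg (hkpos 0 h0).ne' hode c0 c1 c2 c2'
    fun t ht ↦ mul_div_cancel₀ _ (hk8 t ht)
  obtain ⟨n0, n1, n2⟩ := hjet.unique (hN.jet2 hε)
  refine ⟨by rw [htau 0 h0, zero_mul], htausm, fun t ht ↦ ?_, ⟨N, hN, hNeq, n0.symm, n1.symm⟩, ?_⟩
  · rw [htau' t ht]
    have := Real.rpow_pos_of_pos (hhpos t ht) (-(2 / 5) : ℝ)
    have := hkpos t ht
    positivity
  · obtain ⟨r, hr, hNr⟩ := hjet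
    have hcusp : sysCuspidalCurvature A = (24 * (2 * g 0) * A 2 5 0 + 60 * (2 * g 0) * A 3 4 0
        - 35 * (3 * deriv g 0) ^ 2) / (2 * k 0 ^ 3) ^ (12 / 5 : ℝ) := by
      rw [sysCuspidalCurvature, fracPow_eq_abs (by decide), ← hψdef, c0, c1', hkg 0 h0,
        abs_of_pos (by linarith)]
      norm_num
    rw [hcusp, ← cuspidal_constant (hkpos 0 h0)]
    have hh0 : h 0 = 3 / 5 * k 0 := by rw [hode 0 h0]; ring
    have hhc : Tendsto (fun t ↦ h t ^ (6 / 5 : ℝ)) (𝓝[≠] 0) (𝓝 ((3 / 5 * k 0) ^ (6 / 5 : ℝ))) := by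
      rw [← hh0]
      exact (((hh.continuousOn.continuousAt hnhds).rpow_const
        (Or.inl (hhpos 0 h0).ne')).tendsto).mono_left nhdsWithin_le_nhds
    have hlim := ((hr.mono_left (nhdsWithin_le_nhds (s := {0}ᶜ))).const_add
      (3 / 4400 * (24 * (2 * g 0) * A 2 5 0 + 60 * (2 * g 0) * A 3 4 0
        - 35 * (3 * deriv g 0) ^ 2) / k 0 ^ 6)).div hhc
      (Real.rpow_pos_of_pos (by linarith [hkpos 0 h0]) _).ne'
    rw [add_zero] at hlim
    refine hlim.congr' ?_
    filter_upwards [hNr.filter_mono nhdsWithin_le_nhds, self_mem_nhdsWithin,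
      nhdsWithin_le_nhds hnhds] with t e1 ht0 ht
    have ht0 : t ≠ 0 := ht0
    have hsq : (h t ^ (3 / 5 : ℝ)) ^ 2 = h t ^ (6 / 5 : ℝ) := by
      rw [← Real.rpow_natCast, ← Real.rpow_mul (hhpos t ht).le]
      norm_num
    simp only [Pi.div_apply]
    rw [← hNeq t ht ht0, htau t ht, e1]
    rw [mul_pow t, hsq]
    have := Real.rpow_pos_of_pos (hhpos t ht) (6 / 5 : ℝ)
    field_simp
    ring

/-- A curve with a cusp of this kind has no other inflection points nearby. -/
lemma BracketSystem.exists_noInflection {δ : ℝ} (hδ : 0 < δ) (hA : BracketSystem A δ)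
    (hne : A 2 3 0 ≠ 0) : ∃ ε ∈ Ioc 0 δ, ∀ t ∈ Ioo (-ε) ε, t ≠ 0 → A 1 2 t ≠ 0 := by
  obtain ⟨g, hg, e12, -, -, c0, -⟩ := hA.exists_eq_sq_mul hδ
  have hg0 : g 0 ≠ 0 := fun h ↦ hne (by rw [c0, h, mul_zero])
  have hnhds : Ioo (-δ) δ ∈ 𝓝 (0 : ℝ) := Ioo_mem_nhds (by linarith) hδ
  obtain ⟨ε, hε, hball⟩ := Metric.eventually_nhds_iff.1
    ((hg.continuousOn.continuousAt hnhds).eventually_ne hg0)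
  refine ⟨min ε δ, ⟨lt_min hε hδ, min_le_right _ _⟩, fun t ht ht0 ↦ ?_⟩
  have h1 : |t| < min ε δ := abs_lt.2 ht
  rw [e12 t (abs_lt.1 (h1.trans_le (min_le_right _ _)))]
  refine mul_ne_zero (pow_ne_zero 2 ht0) (hball ?_)
  simpa using h1.trans_le (min_le_left _ _)

/-- If A_23(0) < 0, the positive case is applied to `-A`. -/
lemma BracketSystem.normal_form {ε : ℝ} (hε : 0 < ε) (hA : BracketSystem A ε)
    (h23 : A 2 3 0 ≠ 0) (hne : ∀ t ∈ Ioo (-ε) ε, t ≠ 0 → A 1 2 t ≠ 0) :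
    sysTau A 0 = 0 ∧ SmoothNear ε (sysTau A) ∧ (∀ t ∈ Ioo (-ε) ε, 0 < deriv (sysTau A) t) ∧
    (∃ N, SmoothNear ε N ∧ (∀ t ∈ Ioo (-ε) ε, t ≠ 0 → N t = sysNormalizedCurvature A t) ∧
      N 0 = 4 / 25 ∧ deriv N 0 = 0) ∧
    Tendsto (fun t ↦ (sysNormalizedCurvature A t - 4 / 25) / sysTau A t ^ 2) (𝓝[≠] 0)
      (𝓝 (1 / 220 * (20 / 3 : ℝ) ^ (1 / 5 : ℝ) * sysCuspidalCurvature A)) := by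
  rcases h23.lt_or_gt with h | h
  · have := BracketSystem.normal_form_of_pos hε hA.neg (by simpa using h)
      (fun t ht ht0 ↦ by simpa using hne t ht ht0)
    simpa only [sysTau_neg, sysNormalizedCurvature_neg, sysCuspidalCurvature_neg] using this
  · exact hA.normal_form_of_pos hε h hne

/-- The normalized affine curvature as a function of the 3/5-arclength. -/
lemma BracketSystem.exists_smooth_function_of_tau {ε : ℝ} (hε : 0 < ε) (hA : BracketSystem A ε)
    (h23 : A 2 3 0 ≠ 0) (hne : ∀ t ∈ Ioo (-ε) ε, t ≠ 0 → A 1 2 t ≠ 0) :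
    ∃ f : ℝ → ℝ, ContDiffOn ℝ ∞ f (sysTau A '' Ioo (-ε) ε) ∧
      (∀ t ∈ Ioo (-ε) ε, t ≠ 0 → f (sysTau A t) = sysNormalizedCurvature A t) ∧
      f 0 = 4 / 25 ∧ deriv f 0 = 0 := by
  obtain ⟨hτ0, hτ, hτ', ⟨N, hN, hNeq, hN0, hN1⟩, -⟩ := hA.normal_form hε h23 hne
  have h0 : (0 : ℝ) ∈ Ioo (-ε) ε := ⟨by linarith, hε⟩
  have hmono : StrictMonoOn (sysTau A) (Ioo (-ε) ε) :=
    strictMonoOn_of_deriv_pos (convex_Ioo _ _) hτ.continuousOn (by simpa using hτ')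
  obtain ⟨f, hf, hfN⟩ := exists_smooth_comp_eq isOpen_Ioo hτ hmono.injOn
    (fun t ht ↦ (hτ' t ht).ne') hN
  have hf0 : DifferentiableAt ℝ f 0 := by
    have := (hf 0 h0).differentiableAt (by norm_num)
    rwa [hτ0] at this
  refine ⟨f, ?_, fun t ht ht0 ↦ by rw [hfN t ht, hNeq t ht ht0], ?_, ?_⟩
  · rintro _ ⟨t, ht, rfl⟩
    exact (hf t ht).contDiffWithinAt
  · rw [← hN0, ← hfN 0 h0, hτ0]
  · have h1 : HasDerivAt (f ∘ sysTau A) (deriv f 0 * deriv (sysTau A) 0) 0 := by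
      refine HasDerivAt.comp 0 ?_ (hτ.hasDerivAt h0)
      rw [hτ0]
      exact hf0.hasDerivAt
    have h2 := deriv_eq_of_eqOn (fun t ht ↦ (hfN t ht).symm) h0 h1
    rw [hN1] at h2
    exact (mul_eq_zero.1 h2.symm).resolve_right (hτ' 0 h0).ne'

end NormalForm

/-! ### Connection and vector fields in a coordinate frame. -/

section LocalCoordinates

variable {M : Type*} [TopologicalSpace M] [ChartedSpace Plane M] [IsManifold (𝓡 2) ∞ M]

/-- The trivialization of the tangent bundle by the coordinate frame of the chart at `x₀`. -/
abbrev coordFrame (x₀ : M) :=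
  trivializationAt Plane (TangentSpace (𝓡 2) : M → Type _) x₀

/-- The vector field with constant components `c` in the chart at `x₀`. -/
def constField (x₀ : M) (c : Plane) (x : M) : TangentSpace (𝓡 2) x :=
  (coordFrame x₀).symmL ℝ x c

/-- The components of the vector `v` in the chart at `x₀`. -/
def comps (x₀ x : M) : TangentSpace (𝓡 2) x →L[ℝ] Plane :=
  (coordFrame x₀).continuousLinearMapAt ℝ x

lemma comps_eq {x₀ x : M} (hx : x ∈ (chartAt Plane x₀).source) (v : TangentSpace (𝓡 2) x) :
    ((coordFrame x₀) ⟨x, v⟩).2 = comps x₀ x v := by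
  have hx' : x ∈ (coordFrame x₀).baseSet := by simpa using hx
  simp only [comps, Bundle.Trivialization.continuousLinearMapAt_apply,
    Bundle.Trivialization.coe_linearMapAt_of_mem _ hx']

lemma comps_constField {x₀ x : M} (hx : x ∈ (chartAt Plane x₀).source) (c : Plane) :
    comps x₀ x (constField x₀ c x) = c := by
  have hx' : x ∈ (coordFrame x₀).baseSet := by simpa using hx
  exact (coordFrame x₀).continuousLinearMapAt_symmL hx' c

lemma constField_comps {x₀ x : M} (hx : x ∈ (chartAt Plane x₀).source)
    (v : TangentSpace (𝓡 2) x) : constField x₀ (comps x₀ x v) x = v := by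
  have hx' : x ∈ (coordFrame x₀).baseSet := by simpa using hx
  exact (coordFrame x₀).symmL_continuousLinearMapAt hx' v

lemma constField_add (x₀ : M) (c d : Plane) (x : M) :
    constField x₀ (c + d) x = constField x₀ c x + constField x₀ d x :=
  map_add _ _ _

lemma constField_smul (x₀ : M) (a : ℝ) (c : Plane) (x : M) :
    constField x₀ (a • c) x = a • constField x₀ c x :=
  map_smul _ _ _

/-- The base map `b` is arbitrary so that one criterion covers vector fields on `M` (`b = id`) and
vector fields along curves. -/
lemma contMDiffAt_lift_iff {N : Type*} [TopologicalSpace N] {E H : Type*} [NormedAddCommGroup E]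
    [NormedSpace ℝ E] [TopologicalSpace H] {I : ModelWithCorners ℝ E H} [ChartedSpace H N]
    {n : ℕ∞ω} (hn : n ≤ ∞) {x₀ : M} {b : N → M} {V : ∀ s, TangentSpace (𝓡 2) (b s)} {t : N}
    (ht : b t ∈ (chartAt Plane x₀).source) :
    ContMDiffAt I ((𝓡 2).prod 𝓘(ℝ, Plane)) n (fun s ↦ (⟨b s, V s⟩ : TangentBundle (𝓡 2) M)) t ↔
      ContMDiffAt I (𝓡 2) n b t ∧
        ContMDiffAt I 𝓘(ℝ, Plane) n (fun s ↦ comps x₀ (b s) (V s)) t := by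
  have : ContMDiffVectorBundle n Plane (TangentSpace (𝓡 2) : M → Type _) (𝓡 2) :=
    ContMDiffVectorBundle.of_le hn
  rw [(coordFrame x₀).contMDiffAt_iff (by simpa using ht)]
  refine and_congr_right fun hb ↦ ?_
  refine EventuallyEq.contMDiffAt_iff ?_
  filter_upwards [hb.continuousAt.preimage_mem_nhds
    ((chartAt Plane x₀).open_source.mem_nhds ht)] with s hs
  exact comps_eq hs _

lemma mdifferentiableAt_lift_iff {N : Type*} [TopologicalSpace N] {E H : Type*}
    [NormedAddCommGroup E]
    [NormedSpace ℝ E] [TopologicalSpace H] {I : ModelWithCorners ℝ E H} [ChartedSpace H N]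
    {x₀ : M} {b : N → M} {V : ∀ s, TangentSpace (𝓡 2) (b s)} {t : N}
    (ht : b t ∈ (chartAt Plane x₀).source) :
    MDifferentiableAt I ((𝓡 2).prod 𝓘(ℝ, Plane)) (fun s ↦ (⟨b s, V s⟩ : TangentBundle (𝓡 2) M)) t ↔
      MDifferentiableAt I (𝓡 2) b t ∧
        MDifferentiableAt I 𝓘(ℝ, Plane) (fun s ↦ comps x₀ (b s) (V s)) t := by
  have : ContMDiffVectorBundle 1 Plane (TangentSpace (𝓡 2) : M → Type _) (𝓡 2) :=
    ContMDiffVectorBundle.of_le (n := ∞) (by norm_num)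
  have : IsManifold (𝓡 2) 1 M := IsManifold.of_le (n := ∞) (by norm_num)
  rw [(coordFrame x₀).mdifferentiableAt_totalSpace_iff _ _ (by simpa using ht)]
  refine and_congr_right fun hb ↦ ?_
  refine EventuallyEq.mdifferentiableAt_iff ?_
  filter_upwards [hb.continuousAt.preimage_mem_nhds
    ((chartAt Plane x₀).open_source.mem_nhds ht)] with s hs
  exact comps_eq hs _

lemma contMDiffAt_constField {x₀ x : M} (hx : x ∈ (chartAt Plane x₀).source) (c : Plane) :
    ContMDiffAt (𝓡 2) ((𝓡 2).prod 𝓘(ℝ, Plane)) ∞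
      (fun y ↦ (⟨y, constField x₀ c y⟩ : TangentBundle (𝓡 2) M)) x := by
  refine (contMDiffAt_lift_iff (b := id) le_rfl hx).2 ⟨contMDiffAt_id, ?_⟩
  refine (contMDiffAt_const (c := c)).congr_of_eventuallyEq ?_
  filter_upwards [(chartAt Plane x₀).open_source.mem_nhds hx] with y hy
  exact comps_constField hy c

lemma mdifferentiableAt_constField {x₀ x : M} (hx : x ∈ (chartAt Plane x₀).source) (c : Plane) :
    MDifferentiableAt (𝓡 2) ((𝓡 2).prod 𝓘(ℝ, Plane))
      (fun y ↦ (⟨y, constField x₀ c y⟩ : TangentBundle (𝓡 2) M)) x :=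
  (contMDiffAt_constField hx c).mdifferentiableAt (by norm_num)

variable (D : AffineConnection M)

/-- The connection form in the chart at `x₀`: the components of `D_v E_c`, where `v` has components
`v` and `E_c` is the field with constant components `c`. -/
def connForm (x₀ x : M) (v c : Plane) : Plane :=
  comps x₀ x (D (constField x₀ c) x (constField x₀ v x))

lemma connForm_add_right {x₀ x : M} (hx : x ∈ (chartAt Plane x₀).source) (v c d : Plane) :
    connForm D x₀ x v (c + d) = connForm D x₀ x v c + connForm D x₀ x v d := by
  have : constField x₀ (c + d) = constField x₀ c + constField x₀ d := by
    ext y : 1; exact constField_add x₀ c d y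
  simp only [connForm, this, (D.isCovariantDerivativeOnUniv).add
    (mdifferentiableAt_constField hx c) (mdifferentiableAt_constField hx d)]
  simp

lemma connForm_smul_right {x₀ x : M} (hx : x ∈ (chartAt Plane x₀).source) (a : ℝ) (v c : Plane) :
    connForm D x₀ x v (a • c) = a • connForm D x₀ x v c := by
  have : constField x₀ (a • c) = a • constField x₀ c := by
    ext y : 1; exact constField_smul x₀ a c y
  simp only [connForm, this, (D.isCovariantDerivativeOnUniv).smul_const a
    (mdifferentiableAt_constField hx c)]
  simp

lemma connForm_add_left (x₀ x : M) (v w c : Plane) :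
    connForm D x₀ x (v + w) c = connForm D x₀ x v c + connForm D x₀ x w c := by
  simp [connForm, constField_add]

lemma connForm_smul_left (x₀ x : M) (a : ℝ) (v c : Plane) :
    connForm D x₀ x (a • v) c = a • connForm D x₀ x v c := by
  simp [connForm, constField_smul]

end LocalCoordinates

lemma plane_eq_sum (c : Plane) :
    c = c 0 • EuclideanSpace.single (0 : Fin 2) (1 : ℝ)
      + c 1 • EuclideanSpace.single (1 : Fin 2) (1 : ℝ) := by
  ext i; fin_cases i <;> simp

section LocalCoordinates

variable {M : Type*} [TopologicalSpace M] [ChartedSpace Plane M] [IsManifold (𝓡 2) ∞ M]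

variable (D : AffineConnection M)

lemma connForm_eq_sum_right {x₀ x : M} (hx : x ∈ (chartAt Plane x₀).source) (v c : Plane) :
    connForm D x₀ x v c = c 0 • connForm D x₀ x v (EuclideanSpace.single 0 1)
      + c 1 • connForm D x₀ x v (EuclideanSpace.single 1 1) := by
  conv_lhs => rw [plane_eq_sum c]
  rw [connForm_add_right D hx, connForm_smul_right D hx, connForm_smul_right D hx]

lemma connForm_eq_sum_left (x₀ x : M) (v c : Plane) :
    connForm D x₀ x v c = v 0 • connForm D x₀ x (EuclideanSpace.single 0 1) c
      + v 1 • connForm D x₀ x (EuclideanSpace.single 1 1) c := by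
  conv_lhs => rw [plane_eq_sum v]
  rw [connForm_add_left, connForm_smul_left, connForm_smul_left]

/-- The covariant derivative of a section in the coordinate frame at `x₀`. -/
lemma comps_covDeriv {x₀ x : M} (hx : x ∈ (chartAt Plane x₀).source)
    {Y : ∀ x : M, TangentSpace (𝓡 2) x}
    (hY : MDifferentiableAt (𝓡 2) ((𝓡 2).prod 𝓘(ℝ, Plane))
      (fun y ↦ (⟨y, Y y⟩ : TangentBundle (𝓡 2) M)) x) (v : TangentSpace (𝓡 2) x) :
    comps x₀ x (D Y x v) = mvfderiv (𝓡 2) (fun y ↦ comps x₀ y (Y y)) x v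
      + connForm D x₀ x (comps x₀ x v) (comps x₀ x (Y x)) := by
  set F : M → Plane := fun y ↦ comps x₀ y (Y y) with hF
  have hFd : MDifferentiableAt (𝓡 2) 𝓘(ℝ, Plane) F x :=
    ((mdifferentiableAt_lift_iff (b := id) hx).1 hY).2
  have hFi : ∀ i, MDifferentiableAt (𝓡 2) 𝓘(ℝ, ℝ) (fun y ↦ F y i) x := fun i ↦
    ((EuclideanSpace.proj i : Plane →L[ℝ] ℝ).mdifferentiableAt).comp x hFd
  set b : Fin 2 → Plane := fun i ↦ EuclideanSpace.single i 1 with hb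
  have hE : ∀ i, MDifferentiableAt (𝓡 2) ((𝓡 2).prod 𝓘(ℝ, Plane))
      (fun y ↦ (⟨y, constField x₀ (b i) y⟩ : TangentBundle (𝓡 2) M)) x := fun i ↦
    mdifferentiableAt_constField hx (b i)
  have hS : ∀ i, MDifferentiableAt (𝓡 2) ((𝓡 2).prod 𝓘(ℝ, Plane))
      (fun y ↦ (⟨y, ((fun y ↦ F y i) • constField x₀ (b i)) y⟩ : TangentBundle (𝓡 2) M)) x :=
    fun i ↦ (hFi i).smul_section (hE i)
  -- A covariant derivative is local, so `Y` may be replaced by its expansion in the coordinate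
  -- frame, to which the Leibniz rule applies.
  have hYeq : ∀ᶠ y in 𝓝 x, Y y =
      ((fun y ↦ F y 0) • constField x₀ (b 0) + (fun y ↦ F y 1) • constField x₀ (b 1)) y := by
    filter_upwards [(chartAt Plane x₀).open_source.mem_nhds hx] with y hy
    rw [← constField_comps hy (Y y)]
    change constField x₀ (F y) y = F y 0 • constField x₀ (b 0) y + F y 1 • constField x₀ (b 1) y
    conv_lhs => rw [plane_eq_sum (F y)]
    rw [constField_add, constField_smul, constField_smul]
  have hadd := mdifferentiableAt_add_section (hS 0) (hS 1)
  rw [D.isCovariantDerivativeOnUniv.congr_of_eventuallyEq hY hadd univ_mem hYeq,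
    D.isCovariantDerivativeOnUniv.add (hS 0) (hS 1),
    D.isCovariantDerivativeOnUniv.leibniz (hE 0) (hFi 0),
    D.isCovariantDerivativeOnUniv.leibniz (hE 1) (hFi 1)]
  have hdF : mvfderiv (𝓡 2) F x v
      = mvfderiv (𝓡 2) (fun y ↦ F y 0) x v • b 0 + mvfderiv (𝓡 2) (fun y ↦ F y 1) x v • b 1 := by
    have : F = (fun y ↦ F y 0) • (fun _ ↦ b 0) + (fun y ↦ F y 1) • (fun _ ↦ b 1) := by
      ext1 y; exact plane_eq_sum (F y)
    conv_lhs => rw [this]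
    rw [mvfderiv_add ((hFi 0).smul mdifferentiableAt_const)
      ((hFi 1).smul mdifferentiableAt_const),
      mvfderiv_smul (hFi 0) mdifferentiableAt_const,
      mvfderiv_smul (hFi 1) mdifferentiableAt_const, mvfderiv_const, mvfderiv_const]
    simp
  rw [hdF, connForm_eq_sum_right D hx]
  simp only [connForm, constField_comps hx]
  simp only [add_apply, smul_apply, map_add, map_smul,
    ContinuousLinearMap.smulRight_apply, comps_constField hx]
  abel

omit [IsManifold (𝓡 2) ∞ M] in
lemma hasDerivAt_comp_curve {E : Type*} [NormedAddCommGroup E] [NormedSpace ℝ E] {F : M → E}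
    {γ : ℝ → M} {t : ℝ} (hF : MDifferentiableAt (𝓡 2) 𝓘(ℝ, E) F (γ t))
    (hγ : MDifferentiableAt 𝓘(ℝ, ℝ) (𝓡 2) γ t) :
    HasDerivAt (fun s ↦ F (γ s)) (mvfderiv (𝓡 2) F (γ t) (velocity γ t)) t := by
  have h : HasFDerivAt (F ∘ γ)
      ((mvfderiv (𝓡 2) F (γ t)).comp (mfderiv 𝓘(ℝ, ℝ) (𝓡 2) γ t) : ℝ →L[ℝ] E) t :=
    hasMFDerivAt_iff_hasFDerivAt.1 (hF.hasMFDerivAt.comp t hγ.hasMFDerivAt)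
  exact h.hasDerivAt

lemma comps_velocity {x₀ : M} {γ : ℝ → M} {t : ℝ} (ht : γ t ∈ (chartAt Plane x₀).source)
    (hγ : MDifferentiableAt 𝓘(ℝ, ℝ) (𝓡 2) γ t) :
    HasDerivAt (fun s ↦ chartAt Plane x₀ (γ s)) (comps x₀ (γ t) (velocity γ t)) t := by
  have : IsManifold (𝓡 2) 1 M := IsManifold.of_le (n := ∞) (by norm_num)
  have h := hasDerivAt_comp_curve (mdifferentiableAt_extChartAt (I := 𝓡 2) ht) hγ
  have h2 : comps x₀ (γ t) (velocity γ t)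
      = mvfderiv (𝓡 2) (extChartAt (𝓡 2) x₀) (γ t) (velocity γ t) := by
    rw [comps, TangentBundle.continuousLinearMapAt_trivializationAt ht]
    rfl
  rw [h2]
  simpa using h

/-- `covDerivAlong` uses the chart at `γ t`, which moves with `t`. In a fixed chart the frame of the
moving chart has variable components `S i`; their derivatives along `γ` are exactly the terms from
`comps_covDeriv`, so the usual formula holds in every chart. -/
lemma comps_covDerivAlong {x₀ : M} {γ : ℝ → M} {V : ∀ t, TangentSpace (𝓡 2) (γ t)} {t : ℝ}
    (ht : γ t ∈ (chartAt Plane x₀).source)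
    (hV : MDifferentiableAt 𝓘(ℝ, ℝ) ((𝓡 2).prod 𝓘(ℝ, Plane))
      (fun s ↦ (⟨γ s, V s⟩ : TangentBundle (𝓡 2) M)) t) :
    comps x₀ (γ t) (covDerivAlong D γ V t) = deriv (fun s ↦ comps x₀ (γ s) (V s)) t
      + connForm D x₀ (γ t) (comps x₀ (γ t) (velocity γ t)) (comps x₀ (γ t) (V t)) := by
  set x₁ := γ t with hx₁
  have ht₁ : γ t ∈ (chartAt Plane x₁).source := mem_chart_source _ _
  have hγ := ((mdifferentiableAt_lift_iff ht).1 hV).1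
  have hc₁ := ((mdifferentiableAt_lift_iff ht₁).1 hV).2
  set c₁ : ℝ → Plane := fun s ↦ comps x₁ (γ s) (V s) with hc₁def
  have hc₁' : DifferentiableAt ℝ c₁ t := mdifferentiableAt_iff_differentiableAt.1 hc₁
  have hc₁i : ∀ i : Fin 2, HasDerivAt (fun s ↦ c₁ s i) (deriv c₁ t i) t := fun i : Fin 2 ↦
    ((EuclideanSpace.proj i : Plane →L[ℝ] ℝ).hasFDerivAt.comp_hasDerivAt t
      hc₁'.hasDerivAt)
  set b : Fin 2 → Plane := fun i ↦ EuclideanSpace.single i 1 with hb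
  let S : Fin 2 → M → Plane := fun i y ↦ comps x₀ y (constField x₁ (b i) y)
  have hSd : ∀ i, MDifferentiableAt (𝓡 2) 𝓘(ℝ, Plane) (S i) (γ t) := fun i ↦
    ((mdifferentiableAt_lift_iff (b := id) ht).1 (mdifferentiableAt_constField ht₁ (b i))).2
  have hSγ := fun i ↦ hasDerivAt_comp_curve (hSd i) hγ
  have hexp : ∀ (c : Plane) (y : M), comps x₀ y (constField x₁ c y) = c 0 • S 0 y + c 1 • S 1 y := by
    intro c y
    conv_lhs => rw [plane_eq_sum c]
    rw [constField_add, constField_smul, constField_smul, map_add, map_smul, map_smul]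
  have hder : HasDerivAt (fun s ↦ comps x₀ (γ s) (V s))
      ((c₁ t 0 • mvfderiv (𝓡 2) (S 0) (γ t) (velocity γ t) + deriv c₁ t 0 • S 0 (γ t))
        + (c₁ t 1 • mvfderiv (𝓡 2) (S 1) (γ t) (velocity γ t) + deriv c₁ t 1 • S 1 (γ t))) t := by
    refine (((hc₁i 0).smul (hSγ 0)).add ((hc₁i 1).smul (hSγ 1))).congr_of_eventuallyEq ?_
    filter_upwards [hγ.continuousAt.preimage_mem_nhds
      ((chartAt Plane x₁).open_source.mem_nhds ht₁)] with s hs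
    rw [← constField_comps hs (V s), hexp]
    rfl
  have hdef : covDerivAlong D γ V t
      = constField x₁ (deriv c₁ t) (γ t) + D (constField x₁ (c₁ t)) (γ t) (velocity γ t) := rfl
  rw [hder.deriv, hdef, map_add, hexp,
    comps_covDeriv D ht (mdifferentiableAt_constField ht₁ (c₁ t))]
  have hV1 : constField x₁ (c₁ t) (γ t) = V t := constField_comps ht₁ (V t)
  rw [hV1]
  have hm : mvfderiv (𝓡 2) (fun y ↦ comps x₀ y (constField x₁ (c₁ t) y)) (γ t) (velocity γ t)
      = c₁ t 0 • mvfderiv (𝓡 2) (S 0) (γ t) (velocity γ t)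
        + c₁ t 1 • mvfderiv (𝓡 2) (S 1) (γ t) (velocity γ t) := by
    have : (fun y ↦ comps x₀ y (constField x₁ (c₁ t) y))
        = (fun _ : M ↦ (c₁ t 0 : ℝ)) • S 0 + (fun _ : M ↦ (c₁ t 1 : ℝ)) • S 1 := by
      ext1 y; exact hexp _ y
    rw [this, mvfderiv_add (mdifferentiableAt_const.smul (hSd 0))
      (mdifferentiableAt_const.smul (hSd 1)), mvfderiv_smul mdifferentiableAt_const (hSd 0),
      mvfderiv_smul mdifferentiableAt_const (hSd 1), mvfderiv_const, mvfderiv_const]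
    simp
  rw [hm]
  abel

/-- Smoothness of `D` is applied to global smooth sections, whereas a coordinate field is smooth
only on its chart. A bump function equal to 1 near the point globalizes the field, and locality of
`D` shows that its derivative there is unchanged. -/
lemma contMDiffOn_connForm [T2Space M]
    (hD : CovariantDerivative.ContMDiffCovariantDerivative D ∞) (x₀ : M) (v c : Plane) :
    ContMDiffOn (𝓡 2) 𝓘(ℝ, Plane) ∞ (fun x ↦ connForm D x₀ x v c)
      (chartAt Plane x₀).source := by
  intro x hx
  apply ContMDiffAt.contMDiffWithinAt
  obtain ⟨χ, -, hχ⟩ := (SmoothBumpFunction.nhds_basis_tsupport (I := 𝓡 2) x).mem_iff.1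
    ((chartAt Plane x₀).open_source.mem_nhds hx)
  have hY : ContMDiff (𝓡 2) ((𝓡 2).prod 𝓘(ℝ, Plane)) ∞
      (fun y ↦ (⟨y, ((χ : M → ℝ) • constField x₀ c) y⟩ : TangentBundle (𝓡 2) M)) := by
    refine ContMDiffOn.smul_section_of_tsupport (χ.contMDiff.contMDiffOn)
      (chartAt Plane x₀).open_source hχ fun y hy ↦ (contMDiffAt_constField hy c).contMDiffWithinAt
  have h1 := (hD.contMDiff.contMDiff (σ := (χ : M → ℝ) • constField x₀ c) hY.contMDiffOn).contMDiffAt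
    (univ_mem (f := 𝓝 x))
  have h2 := h1.clm_bundle_apply (contMDiffAt_constField hx v)
  have h3 := ((contMDiffAt_lift_iff (b := id) le_rfl hx).1 h2).2
  refine h3.congr_of_eventuallyEq ?_
  filter_upwards [χ.eventuallyEq_one.eventuallyEq_nhds,
    (chartAt Plane x₀).open_source.mem_nhds hx] with y hy hy'
  have h4 : D (constField x₀ c) y = D ((χ : M → ℝ) • constField x₀ c) y := by
    refine D.isCovariantDerivativeOnUniv.congr_of_eventuallyEq
      (mdifferentiableAt_constField hy' c) (hY.mdifferentiableAt (by norm_num)) univ_mem ?_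
    filter_upwards [hy] with z hz
    simp [hz]
  simp only [connForm, h4]
  rfl

end LocalCoordinates

/-! ### Coordinate expressions of the connection and the area form. -/

section LocalCoordinates

variable {M : Type*} [TopologicalSpace M] [ChartedSpace Plane M] [IsManifold (𝓡 2) ∞ M]

lemma contDiffOn_comp_chart_symm {E : Type*} [NormedAddCommGroup E] [NormedSpace ℝ E]
    {F : M → E} {x₀ : M} (hF : ContMDiffOn (𝓡 2) 𝓘(ℝ, E) ∞ F (chartAt Plane x₀).source) :
    ContDiffOn ℝ ∞ (fun p ↦ F ((chartAt Plane x₀).symm p)) (chartAt Plane x₀).target := by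
  rw [← contMDiffOn_iff_contDiffOn]
  exact hF.comp (contMDiffOn_chart_symm (I := 𝓡 2)) (chartAt Plane x₀).mapsTo_symm

/-- The connection form as a bilinear map depending on the coordinates. -/
def connBil (D : AffineConnection M) (x₀ : M) (p : Plane) : Plane →L[ℝ] Plane →L[ℝ] Plane :=
  ∑ i : Fin 2, ∑ j : Fin 2, (EuclideanSpace.proj i : Plane →L[ℝ] ℝ).smulRight
    ((EuclideanSpace.proj j : Plane →L[ℝ] ℝ).smulRight
      (connForm D x₀ ((chartAt Plane x₀).symm p) (EuclideanSpace.single i 1)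
        (EuclideanSpace.single j 1)))

/-- The area form as a bilinear form depending on the coordinates. -/
def areaBil (Ω : ∀ x : M, TangentSpace (𝓡 2) x →L[ℝ] TangentSpace (𝓡 2) x →L[ℝ] ℝ) (x₀ : M)
    (p : Plane) : Plane →L[ℝ] Plane →L[ℝ] ℝ :=
  ∑ i : Fin 2, ∑ j : Fin 2, (EuclideanSpace.proj i : Plane →L[ℝ] ℝ).smulRight
    ((EuclideanSpace.proj j : Plane →L[ℝ] ℝ).smulRight
      (Ω ((chartAt Plane x₀).symm p)
        (constField x₀ (EuclideanSpace.single i 1) ((chartAt Plane x₀).symm p))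
        (constField x₀ (EuclideanSpace.single j 1) ((chartAt Plane x₀).symm p))))

lemma contDiff_smulRight {E F : Type*} [NormedAddCommGroup E] [NormedSpace ℝ E]
    [NormedAddCommGroup F] [NormedSpace ℝ F] (f : E →L[ℝ] ℝ) {n : ℕ∞ω} :
    ContDiff ℝ n (fun v : F ↦ f.smulRight v) :=
  (ContinuousLinearMap.smulRightL ℝ E F f).contDiff

/-- Building `connBil` from values on basis vectors reduces smoothness to that of the finitely many
Christoffel coefficients. -/
lemma contDiffOn_connBil [T2Space M] {D : AffineConnection M}
    (hD : CovariantDerivative.ContMDiffCovariantDerivative D ∞) (x₀ : M) :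
    ContDiffOn ℝ ∞ (connBil D x₀) (chartAt Plane x₀).target := by
  refine ContDiffOn.sum fun i _ ↦ ContDiffOn.sum fun j _ ↦ ?_
  exact (contDiff_smulRight _).comp_contDiffOn ((contDiff_smulRight _).comp_contDiffOn
    (contDiffOn_comp_chart_symm (contMDiffOn_connForm D hD x₀ _ _)))

lemma connBil_apply (D : AffineConnection M) {x₀ x : M} (hx : x ∈ (chartAt Plane x₀).source)
    (v c : Plane) : connBil D x₀ (chartAt Plane x₀ x) v c = connForm D x₀ x v c := by
  rw [connForm_eq_sum_left, connForm_eq_sum_right D hx _ c, connForm_eq_sum_right D hx _ c]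
  simp [connBil, (chartAt Plane x₀).left_inv hx, Fin.sum_univ_two, smul_smul]

lemma contMDiffOn_area_constField {D : AffineConnection M}
    {Ω : ∀ x : M, TangentSpace (𝓡 2) x →L[ℝ] TangentSpace (𝓡 2) x →L[ℝ] ℝ}
    (hΩ : IsParallelAreaForm D Ω) (x₀ : M) (c d : Plane) :
    ContMDiffOn (𝓡 2) 𝓘(ℝ, ℝ) ∞ (fun x ↦ Ω x (constField x₀ c x) (constField x₀ d x))
      (chartAt Plane x₀).source := by
  intro x hx
  apply ContMDiffAt.contMDiffWithinAt
  have h := ContMDiffAt.clm_bundle_apply₂ (F₃ := ℝ) (E₃ := Bundle.Trivial M ℝ)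
    (hΩ.smooth.contMDiffAt (x := x)) (contMDiffAt_constField hx c) (contMDiffAt_constField hx d)
  exact (Bundle.contMDiffAt_totalSpace.1 h).2

lemma contDiffOn_areaBil {D : AffineConnection M}
    {Ω : ∀ x : M, TangentSpace (𝓡 2) x →L[ℝ] TangentSpace (𝓡 2) x →L[ℝ] ℝ}
    (hΩ : IsParallelAreaForm D Ω) (x₀ : M) :
    ContDiffOn ℝ ∞ (areaBil Ω x₀) (chartAt Plane x₀).target := by
  refine ContDiffOn.sum fun i _ ↦ ContDiffOn.sum fun j _ ↦ ?_
  exact (contDiff_smulRight _).comp_contDiffOn ((contDiff_smulRight _).comp_contDiffOn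
    (contDiffOn_comp_chart_symm (contMDiffOn_area_constField hΩ x₀ _ _)))

lemma areaBil_apply (Ω : ∀ x : M, TangentSpace (𝓡 2) x →L[ℝ] TangentSpace (𝓡 2) x →L[ℝ] ℝ)
    {x₀ x : M} (hx : x ∈ (chartAt Plane x₀).source) (c d : Plane) :
    areaBil Ω x₀ (chartAt Plane x₀ x) c d = Ω x (constField x₀ c x) (constField x₀ d x) := by
  have h : ∀ p, areaBil Ω x₀ p c d = Ω ((chartAt Plane x₀).symm p)
      (constField x₀ c ((chartAt Plane x₀).symm p))
      (constField x₀ d ((chartAt Plane x₀).symm p)) := by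
    intro p
    conv_rhs => rw [plane_eq_sum c, plane_eq_sum d]
    simp only [areaBil, constField_add, constField_smul]
    simp [Fin.sum_univ_two]
    ring
  rw [h, (chartAt Plane x₀).left_inv hx]

lemma area_eq_areaBil (Ω : ∀ x : M, TangentSpace (𝓡 2) x →L[ℝ] TangentSpace (𝓡 2) x →L[ℝ] ℝ)
    {x₀ x : M} (hx : x ∈ (chartAt Plane x₀).source) (v w : TangentSpace (𝓡 2) x) :
    Ω x v w = areaBil Ω x₀ (chartAt Plane x₀ x) (comps x₀ x v) (comps x₀ x w) := by
  rw [areaBil_apply Ω hx, constField_comps hx, constField_comps hx]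

lemma areaBil_self {D : AffineConnection M}
    {Ω : ∀ x : M, TangentSpace (𝓡 2) x →L[ℝ] TangentSpace (𝓡 2) x →L[ℝ] ℝ}
    (hΩ : IsParallelAreaForm D Ω) {x₀ x : M} (hx : x ∈ (chartAt Plane x₀).source) (c : Plane) :
    areaBil Ω x₀ (chartAt Plane x₀ x) c c = 0 := by
  rw [areaBil_apply Ω hx]
  exact hΩ.alternating x _

lemma areaBil_ne_zero {D : AffineConnection M}
    {Ω : ∀ x : M, TangentSpace (𝓡 2) x →L[ℝ] TangentSpace (𝓡 2) x →L[ℝ] ℝ}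
    (hΩ : IsParallelAreaForm D Ω) {x₀ x : M} (hx : x ∈ (chartAt Plane x₀).source) :
    areaBil Ω x₀ (chartAt Plane x₀ x) ≠ 0 := by
  intro h
  refine hΩ.nonvanishing x ?_
  ext v w
  rw [area_eq_areaBil Ω hx, h]
  rfl

/-- The derivative along a curve of the area form in coordinates; it expresses `D Ω = 0`. -/
lemma hasDerivAt_areaBil {D : AffineConnection M}
    {Ω : ∀ x : M, TangentSpace (𝓡 2) x →L[ℝ] TangentSpace (𝓡 2) x →L[ℝ] ℝ}
    (hΩ : IsParallelAreaForm D Ω) {x₀ : M} {γ : ℝ → M} {t : ℝ}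
    (ht : γ t ∈ (chartAt Plane x₀).source) (hγ : MDifferentiableAt 𝓘(ℝ, ℝ) (𝓡 2) γ t) :
    ∃ ω' : Plane →L[ℝ] Plane →L[ℝ] ℝ,
      HasDerivAt (fun s ↦ areaBil Ω x₀ (chartAt Plane x₀ (γ s))) ω' t ∧
      ∀ c d, ω' c d = areaBil Ω x₀ (chartAt Plane x₀ (γ t))
          (connForm D x₀ (γ t) (comps x₀ (γ t) (velocity γ t)) c) d
        + areaBil Ω x₀ (chartAt Plane x₀ (γ t)) c
          (connForm D x₀ (γ t) (comps x₀ (γ t) (velocity γ t)) d) := by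
  have hω : DifferentiableAt ℝ (areaBil Ω x₀) (chartAt Plane x₀ (γ t)) :=
    ((contDiffOn_areaBil hΩ x₀).contDiffAt ((chartAt Plane x₀).open_target.mem_nhds
      ((chartAt Plane x₀).map_source ht))).differentiableAt (by norm_num)
  have h := HasFDerivAt.comp_hasDerivAt (l := areaBil Ω x₀) t hω.hasFDerivAt
    (comps_velocity ht hγ)
  refine ⟨_, h, fun c d ↦ ?_⟩
  -- The derivative of Ω(E_c, E_d) along the curve is computed twice: from the coefficients of
  -- `areaBil`, and from parallelism of `Ω`.
  have h1 := (h.clm_apply (hasDerivAt_const t c)).clm_apply (hasDerivAt_const t d)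
  have h2 := hasDerivAt_comp_curve (((contMDiffOn_area_constField hΩ x₀ c d).contMDiffAt
    ((chartAt Plane x₀).open_source.mem_nhds ht)).mdifferentiableAt (by norm_num)) hγ
  have h3 := h2.congr_of_eventuallyEq
    (f₁ := fun s ↦ areaBil Ω x₀ (chartAt Plane x₀ (γ s)) c d) (by
      filter_upwards [hγ.continuousAt.preimage_mem_nhds
        ((chartAt Plane x₀).open_source.mem_nhds ht)] with s hs
      exact areaBil_apply Ω hs c d)
  have h4 := h1.unique h3
  rw [hΩ.parallel _ _ _ (mdifferentiableAt_constField ht c)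
    (mdifferentiableAt_constField ht d)] at h4
  rw [area_eq_areaBil Ω ht, area_eq_areaBil Ω ht, comps_constField ht, comps_constField ht] at h4
  simp only [connForm, constField_comps ht]
  rw [← h4]
  simp

end LocalCoordinates

/-! ### Smoothness and the Leibniz rule for brackets along a curve. -/

section Curves

variable {M : Type*} [TopologicalSpace M] [ChartedSpace Plane M] [IsManifold (𝓡 2) ∞ M]
  {D : AffineConnection M}
  {Ω : ∀ x : M, TangentSpace (𝓡 2) x →L[ℝ] TangentSpace (𝓡 2) x →L[ℝ] ℝ} {γ : ℝ → M}

/-- The vector field `V` along `γ` is smooth on `I`. -/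
def SmoothAlong (γ : ℝ → M) (V : ∀ t, TangentSpace (𝓡 2) (γ t)) (I : Set ℝ) : Prop :=
  ContMDiffOn 𝓘(ℝ, ℝ) ((𝓡 2).prod 𝓘(ℝ, Plane)) ∞ (fun s ↦ (⟨γ s, V s⟩ : TangentBundle (𝓡 2) M)) I

variable {I : Set ℝ}

lemma SmoothAlong.mdifferentiableAt {V : ∀ t, TangentSpace (𝓡 2) (γ t)} (hV : SmoothAlong γ V I)
    (hI : IsOpen I) {t : ℝ} (ht : t ∈ I) :
    MDifferentiableAt 𝓘(ℝ, ℝ) ((𝓡 2).prod 𝓘(ℝ, Plane))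
      (fun s ↦ (⟨γ s, V s⟩ : TangentBundle (𝓡 2) M)) t :=
  (ContMDiffOn.contMDiffAt hV (hI.mem_nhds ht)).mdifferentiableAt (by norm_num)

lemma SmoothAlong.contDiffAt_comps {V : ∀ t, TangentSpace (𝓡 2) (γ t)} (hV : SmoothAlong γ V I)
    (hI : IsOpen I) {t : ℝ} (ht : t ∈ I) {x₀ : M} (hx : γ t ∈ (chartAt Plane x₀).source) :
    ContDiffAt ℝ ∞ (fun s ↦ comps x₀ (γ s) (V s)) t :=
  contMDiffAt_iff_contDiffAt.1
    ((contMDiffAt_lift_iff le_rfl hx).1 (ContMDiffOn.contMDiffAt hV (hI.mem_nhds ht))).2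

omit [IsManifold (𝓡 2) ∞ M] in
lemma eventually_mem_chart (hI : IsOpen I) (hγ : ContMDiffOn 𝓘(ℝ, ℝ) (𝓡 2) ∞ γ I) {t : ℝ}
    (ht : t ∈ I) {x₀ : M} (hx : γ t ∈ (chartAt Plane x₀).source) :
    ∀ᶠ s in 𝓝 t, s ∈ I ∧ γ s ∈ (chartAt Plane x₀).source :=
  (hI.eventually_mem ht).and ((hγ.continuousOn.continuousAt (hI.mem_nhds ht)).preimage_mem_nhds
    ((chartAt Plane x₀).open_source.mem_nhds hx))

lemma contDiffAt_chart_comp (hI : IsOpen I) (hγ : ContMDiffOn 𝓘(ℝ, ℝ) (𝓡 2) ∞ γ I) {t : ℝ}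
    (ht : t ∈ I) {x₀ : M} (hx : γ t ∈ (chartAt Plane x₀).source) :
    ContDiffAt ℝ ∞ (fun s ↦ chartAt Plane x₀ (γ s)) t :=
  contMDiffAt_iff_contDiffAt.1 (ContMDiffAt.comp t
    ((contMDiffOn_chart (I := 𝓡 2)).contMDiffAt ((chartAt Plane x₀).open_source.mem_nhds hx))
    (hγ.contMDiffAt (hI.mem_nhds ht)))

omit [IsManifold (𝓡 2) ∞ M] in
lemma mdifferentiableAt_curve (hI : IsOpen I) (hγ : ContMDiffOn 𝓘(ℝ, ℝ) (𝓡 2) ∞ γ I) {t : ℝ}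
    (ht : t ∈ I) : MDifferentiableAt 𝓘(ℝ, ℝ) (𝓡 2) γ t :=
  (hγ.contMDiffAt (hI.mem_nhds ht)).mdifferentiableAt (by norm_num)

lemma contDiffAt_deriv {E : Type*} [NormedAddCommGroup E] [NormedSpace ℝ E] {f : ℝ → E}
    {t : ℝ} (hf : ContDiffAt ℝ ∞ f t) : ContDiffAt ℝ ∞ (deriv f) t := by
  have h := (hf.fderiv_right (m := ∞) (by norm_num)).clm_apply
    (contDiffAt_const (c := (1 : ℝ)))
  simpa using h

lemma smoothAlong_velocity (hI : IsOpen I) (hγ : ContMDiffOn 𝓘(ℝ, ℝ) (𝓡 2) ∞ γ I) :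
    SmoothAlong γ (velocity γ) I := by
  intro t ht
  apply ContMDiffAt.contMDiffWithinAt
  have hx : γ t ∈ (chartAt Plane (γ t)).source := mem_chart_source _ _
  refine (contMDiffAt_lift_iff le_rfl hx).2
    ⟨hγ.contMDiffAt (hI.mem_nhds ht), contMDiffAt_iff_contDiffAt.2 ?_⟩
  refine (contDiffAt_deriv (contDiffAt_chart_comp hI hγ ht hx)).congr_of_eventuallyEq ?_
  filter_upwards [eventually_mem_chart hI hγ ht hx] with s hs
  exact (comps_velocity hs.2 (mdifferentiableAt_curve hI hγ hs.1)).deriv.symm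

lemma smoothAlong_covDerivAlong [T2Space M]
    (hD : CovariantDerivative.ContMDiffCovariantDerivative D ∞) (hI : IsOpen I)
    (hγ : ContMDiffOn 𝓘(ℝ, ℝ) (𝓡 2) ∞ γ I) {V : ∀ t, TangentSpace (𝓡 2) (γ t)}
    (hV : SmoothAlong γ V I) : SmoothAlong γ (covDerivAlong D γ V) I := by
  intro t ht
  apply ContMDiffAt.contMDiffWithinAt
  have hx : γ t ∈ (chartAt Plane (γ t)).source := mem_chart_source _ _
  refine (contMDiffAt_lift_iff le_rfl hx).2
    ⟨hγ.contMDiffAt (hI.mem_nhds ht), contMDiffAt_iff_contDiffAt.2 ?_⟩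
  have hB : ContDiffAt ℝ ∞ (fun s ↦ connBil D (γ t) (chartAt Plane (γ t) (γ s))) t :=
    ContDiffAt.comp t (g := connBil D (γ t)) ((contDiffOn_connBil hD (γ t)).contDiffAt
      ((chartAt Plane (γ t)).open_target.mem_nhds ((chartAt Plane (γ t)).map_source hx)))
      (contDiffAt_chart_comp hI hγ ht hx)
  refine ((contDiffAt_deriv (hV.contDiffAt_comps hI ht hx)).add ((hB.clm_apply
    ((smoothAlong_velocity hI hγ).contDiffAt_comps hI ht hx)).clm_apply
    (hV.contDiffAt_comps hI ht hx))).congr_of_eventuallyEq ?_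
  filter_upwards [eventually_mem_chart hI hγ ht hx] with s hs
  rw [comps_covDerivAlong D hs.2 (hV.mdifferentiableAt hI hs.1), connBil_apply D hs.2]

lemma smoothAlong_curveDeriv [T2Space M]
    (hD : CovariantDerivative.ContMDiffCovariantDerivative D ∞) (hI : IsOpen I)
    (hγ : ContMDiffOn 𝓘(ℝ, ℝ) (𝓡 2) ∞ γ I) (k : ℕ) :
    SmoothAlong γ (curveDeriv D γ (k + 1)) I := by
  induction k with
  | zero => exact smoothAlong_velocity hI hγ
  | succ k ih => exact smoothAlong_covDerivAlong hD hI hγ ih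

lemma contDiffOn_area_along (hΩ : IsParallelAreaForm D Ω) (hI : IsOpen I)
    (hγ : ContMDiffOn 𝓘(ℝ, ℝ) (𝓡 2) ∞ γ I) {V W : ∀ t, TangentSpace (𝓡 2) (γ t)}
    (hV : SmoothAlong γ V I) (hW : SmoothAlong γ W I) :
    ContDiffOn ℝ ∞ (fun s ↦ Ω (γ s) (V s) (W s)) I := by
  intro t ht
  apply ContDiffAt.contDiffWithinAt
  have hx : γ t ∈ (chartAt Plane (γ t)).source := mem_chart_source _ _
  have hω : ContDiffAt ℝ ∞ (fun s ↦ areaBil Ω (γ t) (chartAt Plane (γ t) (γ s))) t :=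
    ContDiffAt.comp t (g := areaBil Ω (γ t)) ((contDiffOn_areaBil hΩ (γ t)).contDiffAt
      ((chartAt Plane (γ t)).open_target.mem_nhds ((chartAt Plane (γ t)).map_source hx)))
      (contDiffAt_chart_comp hI hγ ht hx)
  refine ((hω.clm_apply (hV.contDiffAt_comps hI ht hx)).clm_apply
    (hW.contDiffAt_comps hI ht hx)).congr_of_eventuallyEq ?_
  filter_upwards [eventually_mem_chart hI hγ ht hx] with s hs
  exact area_eq_areaBil Ω hs.2 _ _

/-- In coordinates the derivative of the area form supplies exactly the connection terms that
complete the ordinary derivatives of the components to covariant ones. -/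
lemma hasDerivAt_area_along (hΩ : IsParallelAreaForm D Ω) (hI : IsOpen I)
    (hγ : ContMDiffOn 𝓘(ℝ, ℝ) (𝓡 2) ∞ γ I) {V W : ∀ t, TangentSpace (𝓡 2) (γ t)}
    (hV : SmoothAlong γ V I) (hW : SmoothAlong γ W I) {t : ℝ} (ht : t ∈ I) :
    HasDerivAt (fun s ↦ Ω (γ s) (V s) (W s))
      (Ω (γ t) (covDerivAlong D γ V t) (W t) + Ω (γ t) (V t) (covDerivAlong D γ W t)) t := by
  have hx : γ t ∈ (chartAt Plane (γ t)).source := mem_chart_source _ _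
  obtain ⟨ω', h1, h2⟩ := hasDerivAt_areaBil hΩ hx (mdifferentiableAt_curve hI hγ ht)
  have h3 := ((h1.clm_apply ((hV.contDiffAt_comps hI ht hx).differentiableAt
    (by norm_num)).hasDerivAt).clm_apply ((hW.contDiffAt_comps hI ht hx).differentiableAt
    (by norm_num)).hasDerivAt).congr_of_eventuallyEq (f₁ := fun s ↦ Ω (γ s) (V s) (W s)) (by
      filter_upwards [eventually_mem_chart hI hγ ht hx] with s hs
      exact area_eq_areaBil Ω hs.2 _ _)
  refine h3.congr_deriv ?_
  rw [area_eq_areaBil Ω hx, area_eq_areaBil Ω hx (V t),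
    comps_covDerivAlong D hx (hV.mdifferentiableAt hI ht),
    comps_covDerivAlong D hx (hW.mdifferentiableAt hI ht)]
  simp only [add_apply, map_add, h2]
  ring

lemma contDiffOn_bracket [T2Space M]
    (hD : CovariantDerivative.ContMDiffCovariantDerivative D ∞) (hΩ : IsParallelAreaForm D Ω)
    (hI : IsOpen I) (hγ : ContMDiffOn 𝓘(ℝ, ℝ) (𝓡 2) ∞ γ I) (i j : ℕ) :
    ContDiffOn ℝ ∞ (bracket D Ω γ (i + 1) (j + 1)) I :=
  contDiffOn_area_along hΩ hI hγ (smoothAlong_curveDeriv hD hI hγ i)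
    (smoothAlong_curveDeriv hD hI hγ j)

lemma hasDerivAt_bracket [T2Space M]
    (hD : CovariantDerivative.ContMDiffCovariantDerivative D ∞) (hΩ : IsParallelAreaForm D Ω)
    (hI : IsOpen I) (hγ : ContMDiffOn 𝓘(ℝ, ℝ) (𝓡 2) ∞ γ I) (i j : ℕ) {t : ℝ} (ht : t ∈ I) :
    HasDerivAt (bracket D Ω γ (i + 1) (j + 1))
      (bracket D Ω γ (i + 2) (j + 1) t + bracket D Ω γ (i + 1) (j + 2) t) t :=
  hasDerivAt_area_along hΩ hI hγ (smoothAlong_curveDeriv hD hI hγ i)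
    (smoothAlong_curveDeriv hD hI hγ j) ht

end Curves

/-! ### Borel's lemma. -/

section Borel

/-- Borel's lemma: every sequence of Taylor coefficients is realized by a smooth function. -/
lemma exists_contDiff_of_taylor_coeffs (b : ℕ → ℝ) :
    ∃ B : ℝ → ℝ, ContDiff ℝ ∞ B ∧
      ∀ N, (fun x ↦ B x - ∑ n ∈ Finset.range N, b n * x ^ n) =O[𝓝 0] fun x ↦ x ^ N := by
  let χ : ContDiffBump (0 : ℝ) := ⟨1 / 2, 1, by norm_num, by norm_num⟩
  let ψ : ℕ → ℝ → ℝ := fun n y ↦ y ^ n * χ y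
  have hψ : ∀ n, ContDiff ℝ ∞ (ψ n) := fun n ↦ (contDiff_id.pow n).mul χ.contDiff
  have hψc : ∀ n, HasCompactSupport (ψ n) := fun n ↦ χ.hasCompactSupport.mul_left
  have hbd : ∀ n k, ∃ C, ∀ y, ‖iteratedFDeriv ℝ k (ψ n) y‖ ≤ C := fun n k ↦
    ((hψ n).continuous_iteratedFDeriv (m := k) (mod_cast le_top)).bounded_above_of_compact_support
      ((hψc n).iteratedFDeriv k)
  choose C hC using hbd
  set K : ℕ → ℝ := fun n ↦ ∑ k ∈ Finset.range (n + 1), |C n k| with hK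
  have hK0 : ∀ n, 0 ≤ K n := fun n ↦ Finset.sum_nonneg fun _ _ ↦ abs_nonneg _
  have hCK : ∀ n k, k ≤ n → ∀ y, ‖iteratedFDeriv ℝ k (ψ n) y‖ ≤ K n := fun n k hk y ↦
    ((hC n k y).trans (le_abs_self _)).trans (Finset.single_le_sum
      (f := fun k ↦ |C n k|) (fun _ _ ↦ abs_nonneg _) (Finset.mem_range.2 (by omega)))
  -- The n-th term of the series is b_n x^n χ(l_n x). Its derivatives of order below n scale at
  -- worst like 1/l_n, and this l_n is large enough to bound them by 2^(-n).
  set l : ℕ → ℝ := fun n ↦ 1 + 2 ^ n * |b n| * (1 + K n) with hl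
  have hl1 : ∀ n, 1 ≤ l n := fun n ↦ by
    have := hK0 n
    have : 0 ≤ 2 ^ n * |b n| * (1 + K n) := by positivity
    simp only [hl]; linarith
  have hlpos : ∀ n, 0 < l n := fun n ↦ by linarith [hl1 n]
  have hlb : ∀ n, |b n| * (l n)⁻¹ * (1 + K n) ≤ (1 / 2) ^ n := fun n ↦ by
    have h2 : (0 : ℝ) < 2 ^ n := by positivity
    have : |b n| * (1 + K n) * 2 ^ n ≤ l n := by simp only [hl]; linarith
    rw [one_div, inv_pow, mul_right_comm, ← div_eq_mul_inv, div_le_iff₀ (hlpos n),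
      inv_mul_eq_div, le_div_iff₀ h2]
    exact this
  let F : ℕ → ℝ → ℝ := fun n x ↦ (b n * ((l n)⁻¹) ^ n) • ψ n (l n • x)
  have hF : ∀ n x, F n x = b n * x ^ n * χ (l n * x) := fun n x ↦ by
    have := (hlpos n).ne'
    simp only [F, ψ, smul_eq_mul, mul_pow, inv_pow]
    field_simp
  have hFs : ∀ n, ContDiff ℝ ∞ (F n) := fun n ↦
    contDiff_const.smul (f := fun _ ↦ b n * ((l n)⁻¹) ^ n) (g := fun x ↦ ψ n (l n • x))
      ((hψ n).comp (contDiff_const_smul (l n)))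
  have hpow : ∀ n, ∀ k < n, ((l n)⁻¹) ^ n * l n ^ k ≤ (l n)⁻¹ := fun n k hk ↦ by
    have h1 : l n ^ k * l n ≤ l n ^ n := by
      rw [← pow_succ]; exact pow_le_pow_right₀ (hl1 n) hk
    have := hlpos n
    rw [inv_pow, inv_mul_eq_div, div_le_iff₀ (by positivity), inv_mul_eq_div, le_div_iff₀ this]
    exact h1
  have hbound : ∀ k n, k < n → ∀ x, ‖iteratedFDeriv ℝ k (F n) x‖ ≤ (1 / 2) ^ n := by
    intro k n hk x
    have h1 : ContDiff ℝ k (ψ n) := (hψ n).of_le (mod_cast le_top)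
    have e1 : iteratedFDeriv ℝ k (F n) x
        = (b n * ((l n)⁻¹) ^ n) • (l n ^ k • iteratedFDeriv ℝ k (ψ n) (l n • x)) := by
      have h2 : ContDiff ℝ k (fun x ↦ ψ n (l n • x)) := h1.comp (contDiff_const_smul (l n))
      rw [← congrFun (iteratedFDeriv_comp_const_smul (l n) h1) x]
      exact iteratedFDeriv_const_smul_apply' h2.contDiffAt
    have hn := hlpos n
    rw [e1, norm_smul, norm_smul, norm_mul, Real.norm_eq_abs, norm_pow, norm_inv, norm_pow,
      Real.norm_eq_abs, abs_of_pos hn]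
    calc |b n| * (l n)⁻¹ ^ n * (l n ^ k * ‖iteratedFDeriv ℝ k (ψ n) (l n • x)‖)
        = |b n| * ((l n)⁻¹ ^ n * l n ^ k) * ‖iteratedFDeriv ℝ k (ψ n) (l n • x)‖ := by ring
      _ ≤ |b n| * (l n)⁻¹ * (1 + K n) := by
          gcongr
          · exact hpow n k hk
          · linarith [hCK n k hk.le (l n • x)]
      _ ≤ _ := hlb n
  have htail : ∀ N n, N < n → ∀ x, |F n x| ≤ |x| ^ N * (1 / 2) ^ n := by
    intro N n hn x
    rw [hF]
    -- Outside the support of the bump the term is zero; inside, |x| ≤ 1/l_n, so one of the powers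
    -- of |x| beyond the N-th buys the geometric factor.
    by_cases hx : 1 ≤ |l n * x|
    · rw [χ.zero_of_le_dist (by simpa using hx)]
      simp only [mul_zero, abs_zero]; positivity
    · push Not at hx
      rw [abs_mul, abs_of_pos (hlpos n)] at hx
      have hx2 : |x| ≤ (l n)⁻¹ := by
        rw [← one_div, le_div_iff₀ (hlpos n)]; linarith
      have hx1 : |x| ≤ 1 := hx2.trans (inv_le_one_of_one_le₀ (hl1 n))
      have hx3 : |x| ^ n ≤ |x| ^ N * (l n)⁻¹ := by
        obtain ⟨m, rfl⟩ := Nat.exists_eq_add_of_lt hn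
        calc |x| ^ (N + m + 1) = |x| ^ N * |x| * |x| ^ m := by ring
          _ ≤ |x| ^ N * (l (N + m + 1))⁻¹ * 1 := by
              gcongr
              exact pow_le_one₀ (abs_nonneg x) hx1
          _ = _ := mul_one _
      rw [abs_mul, abs_mul, abs_pow, abs_of_nonneg χ.nonneg]
      calc |b n| * |x| ^ n * χ (l n * x) ≤ |b n| * (|x| ^ N * (l n)⁻¹) * 1 := by
            have h0 : 0 ≤ |x| ^ N * (l n)⁻¹ :=
              mul_nonneg (by positivity) (inv_nonneg.2 (hlpos n).le)
            exact mul_le_mul (by gcongr) χ.le_one χ.nonneg (mul_nonneg (abs_nonneg _) h0)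
        _ = |x| ^ N * (|b n| * (l n)⁻¹ * 1) := by ring
        _ ≤ |x| ^ N * (|b n| * (l n)⁻¹ * (1 + K n)) := by
            have := hlpos n
            gcongr
            linarith [hK0 n]
        _ ≤ _ := by gcongr; exact hlb n
  have hgeo : Summable fun n : ℕ ↦ (1 / 2 : ℝ) ^ n :=
    summable_geometric_of_lt_one (by norm_num) (by norm_num)
  have hsum : ∀ x, Summable fun n ↦ F n x := fun x ↦ by
    refine hgeo.of_norm_bounded_eventually_nat ?_
    filter_upwards [eventually_gt_atTop 0] with n hn
    simpa using htail 0 n hn x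
  refine ⟨fun x ↦ ∑' n, F n x, ?_, fun N ↦ ?_⟩
  · refine contDiff_tsum_of_eventually (N := ⊤) hFs (v := fun _ n ↦ (1 / 2 : ℝ) ^ n)
      (fun _ _ ↦ hgeo) fun k _ ↦ ?_
    rw [Nat.cofinite_eq_atTop]
    filter_upwards [eventually_gt_atTop k] with n hn using hbound k n hn
  · have hloc : ∀ᶠ x in 𝓝 (0 : ℝ), ∀ n ∈ Finset.range (N + 1), F n x = b n * x ^ n := by
      rw [Filter.eventually_all_finset]
      intro n _
      have hc : Tendsto (fun x ↦ l n * x) (𝓝 0) (𝓝 0) := by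
        have : Continuous fun x ↦ l n * x := by fun_prop
        simpa using this.tendsto 0
      filter_upwards [hc.eventually χ.eventuallyEq_one] with x hx
      rw [hF, hx]; simp
    refine Asymptotics.IsBigO.of_bound (|b N| + 2) ?_
    filter_upwards [hloc] with x hx
    have h1 := (hsum x).sum_add_tsum_nat_add (N + 1)
    rw [← h1, Finset.sum_congr rfl hx, Finset.sum_range_succ]
    have h2 : ‖∑' n, F (n + (N + 1)) x‖ ≤ ∑' n : ℕ, |x| ^ N * (1 / 2) ^ n := by
      refine tsum_of_norm_bounded (hgeo.mul_left _).hasSum fun n ↦ ?_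
      refine (htail N (n + (N + 1)) (by omega) x).trans ?_
      gcongr 1
      exact pow_le_pow_of_le_one (by norm_num) (by norm_num) (by omega)
    rw [tsum_mul_left, tsum_geometric_two] at h2
    rw [norm_pow, Real.norm_eq_abs]
    calc ‖∑ n ∈ Finset.range N, b n * x ^ n + b N * x ^ N + ∑' n, F (n + (N + 1)) x
          - ∑ n ∈ Finset.range N, b n * x ^ n‖
        = ‖b N * x ^ N + ∑' n, F (n + (N + 1)) x‖ := by congr 1; ring
      _ ≤ |b N| * |x| ^ N + |x| ^ N * 2 := by
          refine (norm_add_le _ _).trans ?_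
          gcongr
          simp
      _ = _ := by rw [Real.norm_eq_abs]; ring

end Borel

/-! ### Flat functions and Whitney's theorem on even functions. -/

section EvenFunctions

/-- `f` vanishes to infinite order at the origin. -/
def Flat (δ : ℝ) (f : ℝ → ℝ) : Prop :=
  ∀ N : ℕ, ∃ g, SmoothNear δ g ∧ ∀ t ∈ Ioo (-δ) δ, f t = t ^ N * g t

lemma SmoothNear.eq_zero_of_tendsto {δ : ℝ} {g : ℝ → ℝ} (hδ : 0 < δ)
    (hg : SmoothNear δ g) {a : ℝ} (h : Tendsto g (𝓝[≠] 0) (𝓝 a)) : g 0 = a :=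
  tendsto_nhds_unique ((hg.continuousOn.continuousAt
    (Ioo_mem_nhds (by linarith) hδ)).tendsto.mono_left nhdsWithin_le_nhds) h

lemma SmoothNear.eq_of_pow_mul_eq {δ : ℝ} {g h : ℝ → ℝ}
    (hg : SmoothNear δ g) (hh : SmoothNear δ h) {n : ℕ}
    (e : ∀ t ∈ Ioo (-δ) δ, t ^ n * g t = t ^ n * h t) {t : ℝ} (ht : t ∈ Ioo (-δ) δ) :
    g t = h t := by
  rcases eq_or_ne t 0 with rfl | h0
  · refine hg.eq_zero_of_tendsto ht.2 (((hh.continuousOn.continuousAt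
      (Ioo_mem_nhds ht.1 ht.2)).tendsto.mono_left nhdsWithin_le_nhds).congr' ?_)
    filter_upwards [nhdsWithin_le_nhds (Ioo_mem_nhds ht.1 ht.2), self_mem_nhdsWithin] with s hs hs'
    exact (mul_left_cancel₀ (pow_ne_zero n hs') (e s hs)).symm
  · exact mul_left_cancel₀ (pow_ne_zero n h0) (e t ht)

/-- Each estimate of order N + 1 forces the N-th quotient to vanish at 0, so Hadamard's lemma
divides once more. -/
lemma flat_of_isBigO {δ : ℝ} (hδ : 0 < δ) {f : ℝ → ℝ} (hf : SmoothNear δ f)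
    (h : ∀ N : ℕ, f =O[𝓝 0] fun t ↦ t ^ N) : Flat δ f := by
  intro N
  induction N with
  | zero => exact ⟨f, hf, fun t _ ↦ by simp⟩
  | succ N ih =>
    obtain ⟨g, hg, hfg⟩ := ih
    have h0 : (0 : ℝ) ∈ Ioo (-δ) δ := ⟨by linarith, hδ⟩
    obtain ⟨C, hC⟩ := (h (N + 1)).bound
    have hg0 : g 0 = 0 := by
      refine hg.eq_zero_of_tendsto hδ ?_
      have hlim : Tendsto (fun t : ℝ ↦ C * ‖t‖) (𝓝[≠] 0) (𝓝 0) := by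
        have : Continuous fun t : ℝ ↦ C * ‖t‖ := by fun_prop
        have := this.tendsto 0
        simp only [norm_zero, mul_zero] at this
        exact this.mono_left nhdsWithin_le_nhds
      refine squeeze_zero_norm' ?_ hlim
      filter_upwards [nhdsWithin_le_nhds hC, nhdsWithin_le_nhds (Ioo_mem_nhds h0.1 h0.2),
        self_mem_nhdsWithin] with t h1 h2 h3
      rw [hfg t h2, norm_mul, norm_pow, norm_pow, pow_succ] at h1
      have h4 : 0 < ‖t‖ ^ N := pow_pos (norm_pos_iff.2 h3) N
      refine le_of_mul_le_mul_left ?_ h4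
      linarith
    obtain ⟨k, hk, hgk, -⟩ := hg.exists_eq_mul hg0
    exact ⟨k, hk, fun t ht ↦ by rw [hfg t ht, hgk t ht]; ring⟩

/-- Since (E(√x))' = E'(√x) / (2√x), this keeps `sqrtExt` of flat functions closed under
differentiation, which drives the induction in `contDiffOn_sqrtExt`. -/
lemma Flat.exists_deriv_eq {δ : ℝ} {f : ℝ → ℝ}
    (h : Flat δ f) :
    ∃ g, SmoothNear δ g ∧ Flat δ g ∧ ∀ t ∈ Ioo (-δ) δ, deriv f t = 2 * t * g t := by
  have hflat : Flat δ (deriv f) := by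
    intro N
    obtain ⟨g, hg, hfg⟩ := h (N + 1)
    refine ⟨fun t ↦ (N + 1) * g t + t * deriv g t,
      (contDiffOn_const.mul hg).add (contDiffOn_id.mul hg.deriv), fun t ht ↦ ?_⟩
    refine deriv_eq_of_eqOn hfg ht ?_
    refine ((hasDerivAt_pow (N + 1) t).mul (hg.hasDerivAt ht)).congr_deriv ?_
    push_cast
    ring
  obtain ⟨g, hg, hfg⟩ := hflat 1
  refine ⟨fun t ↦ g t / 2, hg.div_const 2, fun N ↦ ?_, fun t ht ↦ by rw [hfg t ht]; ring⟩
  obtain ⟨k, hk, hfk⟩ := hflat (N + 1)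
  refine ⟨fun t ↦ k t / 2, hk.div_const 2, fun t ht ↦ ?_⟩
  have := hg.eq_of_pow_mul_eq (n := 1) (h := fun t ↦ t ^ N * k t)
    ((contDiffOn_id.pow N).mul hk) (fun t ht ↦ by rw [← hfg t ht, hfk t ht]; ring) ht
  simp only [this]; ring

/-- `E (√x)` for `x > 0`, extended by zero. -/
def sqrtExt (E : ℝ → ℝ) (x : ℝ) : ℝ := if 0 < x then E (√x) else 0

lemma sqrt_mem_Ioo {δ x : ℝ} (hδ : 0 < δ) (hx : x < δ ^ 2) : √x ∈ Ioo (-δ) δ :=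
  ⟨by linarith [Real.sqrt_nonneg x], (Real.sqrt_lt' hδ).2 hx⟩

lemma hasDerivAt_sqrtExt {δ : ℝ} (hδ : 0 < δ) {E g : ℝ → ℝ} (hE : SmoothNear δ E)
    (hfl : Flat δ E) (hg : ∀ t ∈ Ioo (-δ) δ, deriv E t = 2 * t * g t) {x : ℝ} (hx : x < δ ^ 2) :
    HasDerivAt (sqrtExt E) (sqrtExt g x) x := by
  rcases lt_trichotomy x 0 with h | rfl | h
  · rw [sqrtExt, if_neg h.not_gt]
    refine (hasDerivAt_const x (0 : ℝ)).congr_of_eventuallyEq ?_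
    filter_upwards [Iio_mem_nhds h] with y hy
    rw [sqrtExt, if_neg (not_lt.2 (le_of_lt hy))]
  · rw [sqrtExt, if_neg (lt_irrefl _)]
    -- Order four in t means order two in x = t², enough for the derivative at 0 to be zero.
    obtain ⟨k, hk, hEk⟩ := hfl 4
    have hk0 := hk.continuousOn.continuousAt (Ioo_mem_nhds (by linarith : -δ < 0) hδ)
    have hO : sqrtExt E =O[𝓝 0] fun x ↦ ‖x - 0‖ ^ 2 := by
      refine Asymptotics.IsBigO.of_bound (‖k 0‖ + 1) ?_
      have h1 : ∀ᶠ t in 𝓝 (0 : ℝ), ‖k t‖ < ‖k 0‖ + 1 :=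
        hk0.norm.eventually_lt_const (by linarith)
      have h2 : Tendsto Real.sqrt (𝓝 0) (𝓝 0) := by
        simpa using Real.continuous_sqrt.tendsto 0
      filter_upwards [h2.eventually h1, Iio_mem_nhds hx] with y hy hy2
      rw [sqrtExt]
      split_ifs with hy3
      · rw [hEk _ (sqrt_mem_Ioo hδ hy2), norm_mul, norm_pow, norm_pow, norm_norm, sub_zero,
          Real.norm_eq_abs √y, abs_of_nonneg (Real.sqrt_nonneg y), Real.norm_eq_abs y,
          abs_of_pos hy3]
        have : √y ^ 4 = y ^ 2 := by
          rw [show 4 = 2 * 2 from rfl, pow_mul, Real.sq_sqrt hy3.le]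
        rw [this, mul_comm]
        gcongr
      · simp only [norm_zero]; positivity
    have := (hO.hasFDerivAt one_lt_two).hasDerivAt
    simpa using this
  · rw [sqrtExt, if_pos h]
    have hm := sqrt_mem_Ioo hδ hx
    have h1 := (hE.hasDerivAt hm).comp x (Real.hasDerivAt_sqrt h.ne')
    rw [hg _ hm] at h1
    have h2 : HasDerivAt (E ∘ Real.sqrt) (g √x) x := by
      refine h1.congr_deriv ?_
      have := (Real.sqrt_pos.2 h).ne'
      field_simp
    refine h2.congr_of_eventuallyEq ?_
    filter_upwards [Ioi_mem_nhds h] with y hy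
    simp [sqrtExt, mem_Ioi.1 hy]

lemma contDiffOn_sqrtExt {δ : ℝ} (hδ : 0 < δ) {E : ℝ → ℝ} (hE : SmoothNear δ E)
    (hfl : Flat δ E) : ContDiffOn ℝ ∞ (sqrtExt E) (Iio (δ ^ 2)) := by
  have key : ∀ (n : ℕ) (E : ℝ → ℝ), SmoothNear δ E → Flat δ E →
      ContDiffOn ℝ n (sqrtExt E) (Iio (δ ^ 2)) := by
    intro n
    induction n with
    | zero =>
      intro E hE hfl
      obtain ⟨g, -, -, hEg⟩ := hfl.exists_deriv_eq
      exact contDiffOn_zero.2 fun x hx ↦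
        (hasDerivAt_sqrtExt hδ hE hfl hEg hx).continuousAt.continuousWithinAt
    | succ n ih =>
      intro E hE hfl
      obtain ⟨g, hg, hgfl, hEg⟩ := hfl.exists_deriv_eq
      rw [Nat.cast_add, Nat.cast_one, contDiffOn_succ_iff_deriv_of_isOpen isOpen_Iio]
      exact ⟨fun x hx ↦
        (hasDerivAt_sqrtExt hδ hE hfl hEg hx).differentiableAt.differentiableWithinAt, by simp,
        (ih g hg hgfl).congr fun x hx ↦ (hasDerivAt_sqrtExt hδ hE hfl hEg hx).deriv⟩
  exact contDiffOn_infty.2 fun n ↦ key n E hE hfl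

lemma SmoothNear.comp_neg {δ : ℝ} {f : ℝ → ℝ} (hf : SmoothNear δ f) :
    SmoothNear δ (fun t ↦ f (-t)) :=
  ContDiffOn.comp hf contDiffOn_id.neg fun t ht ↦ ⟨by linarith [ht.2], by linarith [ht.1]⟩

lemma neg_mem_Ioo_symm {δ t : ℝ} (ht : t ∈ Ioo (-δ) δ) : -t ∈ Ioo (-δ) δ :=
  ⟨by linarith [ht.2], by linarith [ht.1]⟩

/-- The first Hadamard quotient of f - f(0) is odd, so it vanishes at 0 and can be divided again. -/
lemma exists_even_eq_add_sq_mul {δ : ℝ} (hδ : 0 < δ) {f : ℝ → ℝ} (hf : SmoothNear δ f)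
    (heven : ∀ t ∈ Ioo (-δ) δ, f (-t) = f t) :
    ∃ g, SmoothNear δ g ∧ (∀ t ∈ Ioo (-δ) δ, g (-t) = g t) ∧
      ∀ t ∈ Ioo (-δ) δ, f t = f 0 + t ^ 2 * g t := by
  have h0 : (0 : ℝ) ∈ Ioo (-δ) δ := ⟨by linarith, hδ⟩
  obtain ⟨k, hk, hfk, -⟩ := SmoothNear.exists_eq_mul (f := fun t ↦ f t - f 0)
    (hf.sub contDiffOn_const) (by simp)
  have hodd : k 0 = -k (-0) :=
    hk.eq_of_pow_mul_eq (n := 1) hk.comp_neg.neg (fun t ht ↦ by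
      have h1 := hfk t ht
      have h2 := hfk (-t) (neg_mem_Ioo_symm ht)
      rw [heven t ht] at h2
      simp only [pow_one]
      linarith) h0
  have hk0 : k 0 = 0 := by rw [neg_zero] at hodd; linarith
  obtain ⟨g, hg, hkg, -⟩ := hk.exists_eq_mul hk0
  have hfg : ∀ t ∈ Ioo (-δ) δ, f t = f 0 + t ^ 2 * g t := fun t ht ↦ by
    have h1 := hfk t ht
    rw [hkg t ht] at h1
    linarith
  refine ⟨g, hg, fun t ht ↦ ?_, hfg⟩
  refine hg.comp_neg.eq_of_pow_mul_eq (n := 2) hg (fun t ht ↦ ?_) ht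
  have h1 := hfg t ht
  have h2 := hfg (-t) (neg_mem_Ioo_symm ht)
  rw [heven t ht, neg_sq] at h2
  linarith

/-- Whitney's theorem: a smooth even function is a smooth function of the square. -/
lemma exists_smooth_eq_comp_sq {δ : ℝ} (hδ : 0 < δ) {f : ℝ → ℝ} (hf : SmoothNear δ f)
    (heven : ∀ t ∈ Ioo (-δ) δ, f (-t) = f t) :
    ∃ F, ContDiffOn ℝ ∞ F (Iio (δ ^ 2)) ∧ ∀ t ∈ Ioo (-δ) δ, f t = F (t ^ 2) := by
  have h0 : (0 : ℝ) ∈ Ioo (-δ) δ := ⟨by linarith, hδ⟩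
  -- `T` is the operator f ↦ (f - f(0))/t² on even functions. The values at 0 of its iterates are
  -- the Taylor coefficients in t²; Borel's lemma realizes them by a smooth B, and f - B(t²) is then
  -- flat.
  choose! T hTs hTe hTf using fun (f : ℝ → ℝ)
    (hf : SmoothNear δ f ∧ ∀ t ∈ Ioo (-δ) δ, f (-t) = f t) ↦
      exists_even_eq_add_sq_mul hδ hf.1 hf.2
  let fs : ℕ → ℝ → ℝ := fun n ↦ T^[n] f
  have hsucc : ∀ n, fs (n + 1) = T (fs n) := fun n ↦ Function.iterate_succ_apply' T n f
  have hfs : ∀ n, SmoothNear δ (fs n) ∧ ∀ t ∈ Ioo (-δ) δ, fs n (-t) = fs n t := by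
    intro n
    induction n with
    | zero => exact ⟨hf, heven⟩
    | succ n ih => rw [hsucc]; exact ⟨hTs _ ih, hTe _ ih⟩
  have hexp : ∀ N, ∀ t ∈ Ioo (-δ) δ,
      f t = ∑ n ∈ Finset.range N, fs n 0 * (t ^ 2) ^ n + (t ^ 2) ^ N * fs N t := by
    intro N t ht
    induction N with
    | zero => simp [fs]
    | succ N ih =>
      rw [Finset.sum_range_succ, ih, hTf _ (hfs N) t ht, hsucc]
      ring
  obtain ⟨B, hB, hBO⟩ := exists_contDiff_of_taylor_coeffs fun n ↦ fs n 0
  have hE : SmoothNear δ fun t ↦ f t - B (t ^ 2) :=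
    hf.sub (hB.comp (contDiff_id.pow 2)).contDiffOn
  have hnhds : Ioo (-δ) δ ∈ 𝓝 (0 : ℝ) := Ioo_mem_nhds h0.1 h0.2
  have hsq : Tendsto (fun t : ℝ ↦ t ^ 2) (𝓝 0) (𝓝 0) := by
    simpa using (continuous_pow 2).tendsto (0 : ℝ)
  have hflat : Flat δ fun t ↦ f t - B (t ^ 2) := by
    refine flat_of_isBigO hδ hE fun N ↦ ?_
    have h1 : (fun t : ℝ ↦ (t ^ 2) ^ N) =O[𝓝 0] fun t : ℝ ↦ t ^ N := by
      have : Tendsto (fun t : ℝ ↦ t ^ N) (𝓝 0) (𝓝 (0 ^ N)) := (continuous_pow N).tendsto 0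
      have h2 := (this.isBigO_one ℝ).mul (Asymptotics.isBigO_refl (fun t : ℝ ↦ t ^ N) (𝓝 0))
      refine h2.congr (fun t ↦ by ring) fun t ↦ by simp
    have h2 := ((hfs N).1.continuousOn.continuousAt hnhds).tendsto.isBigO_one ℝ
    have h3 : (fun t ↦ (t ^ 2) ^ N * fs N t) =O[𝓝 0] fun t : ℝ ↦ t ^ N := by
      simpa using h1.mul h2
    have h4 := ((hBO N).comp_tendsto hsq).trans h1
    refine (h3.sub h4).congr' ?_ (Eventually.of_forall fun _ ↦ rfl)
    filter_upwards [hnhds] with t ht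
    simp only [Function.comp]
    rw [hexp N t ht]; ring
  refine ⟨fun x ↦ B x + sqrtExt (fun t ↦ f t - B (t ^ 2)) x,
    hB.contDiffOn.add (contDiffOn_sqrtExt hδ hE hflat), fun t ht ↦ ?_⟩
  rcases eq_or_ne t 0 with rfl | ht0
  · obtain ⟨g, -, hg⟩ := hflat 1
    have := hg 0 h0
    simp at this
    simp [sqrtExt]; linarith
  · have hpos : 0 < t ^ 2 := by positivity
    simp only [sqrtExt, if_pos hpos, Real.sqrt_sq_eq_abs, sq_abs]
    have : f |t| = f t := by
      rcases abs_choice t with h | h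
      · rw [h]
      · rw [h, heven t ht]
    rw [this]; ring

/-- The decomposition of a smooth function into its even and odd parts. -/
lemma SmoothNear.exists_eq_comp_sq_add_mul {δ : ℝ} (hδ : 0 < δ) {f : ℝ → ℝ}
    (hf : SmoothNear δ f) :
    ∃ P Q, ContDiffOn ℝ ∞ P (Iio (δ ^ 2)) ∧ ContDiffOn ℝ ∞ Q (Iio (δ ^ 2)) ∧
      ∀ t ∈ Ioo (-δ) δ, f t = P (t ^ 2) + t * Q (t ^ 2) := by
  obtain ⟨P, hP, hfP⟩ := exists_smooth_eq_comp_sq hδ (f := fun t ↦ (f t + f (-t)) / 2)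
    ((hf.add hf.comp_neg).div_const 2) fun t _ ↦ by rw [neg_neg]; ring
  obtain ⟨k, hk, hfk, -⟩ := SmoothNear.exists_eq_mul (f := fun t ↦ (f t - f (-t)) / 2)
    ((hf.sub hf.comp_neg).div_const 2) (by simp)
  obtain ⟨Q, hQ, hkQ⟩ := exists_smooth_eq_comp_sq hδ hk fun t ht ↦ by
    refine hk.comp_neg.eq_of_pow_mul_eq (n := 1) hk (fun t ht ↦ ?_) ht
    have h1 := hfk t ht
    have h2 := hfk (-t) (neg_mem_Ioo_symm ht)
    rw [neg_neg] at h2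
    simp only [pow_one]
    linarith
  refine ⟨P, Q, hP, hQ, fun t ht ↦ ?_⟩
  rw [← hkQ t ht, ← hfk t ht, ← hfP t ht]; ring

end EvenFunctions

/-! ### Reduction of (t² a, t³ b) to the standard cusp. -/

section CuspNormalForm

/-- If `y 0 = 0` and `y' = t u`, then `y = t² d` with `u = 2 d + t d'`. -/
lemma exists_eq_sq_mul_of_deriv_eq {δ : ℝ} (hδ : 0 < δ) {y u : ℝ → ℝ} (hy : SmoothNear δ y)
    (hu : SmoothNear δ u) (hy0 : y 0 = 0) (h : ∀ t ∈ Ioo (-δ) δ, deriv y t = t * u t) :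
    ∃ d, SmoothNear δ d ∧ (∀ t ∈ Ioo (-δ) δ, y t = t ^ 2 * d t) ∧
      ∀ t ∈ Ioo (-δ) δ, u t = 2 * d t + t * deriv d t := by
  have h0 : (0 : ℝ) ∈ Ioo (-δ) δ := ⟨by linarith, hδ⟩
  obtain ⟨c, hc, hyc, hc0⟩ := hy.exists_eq_mul hy0
  rw [h 0 h0, zero_mul] at hc0
  obtain ⟨d, hd, hcd, -⟩ := hc.exists_eq_mul hc0
  have hyd : ∀ t ∈ Ioo (-δ) δ, y t = t ^ 2 * d t := fun t ht ↦ by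
    rw [hyc t ht, hcd t ht]; ring
  refine ⟨d, hd, hyd, fun t ht ↦ ?_⟩
  refine hu.eq_of_pow_mul_eq (n := 1) (h := fun t ↦ 2 * d t + t * deriv d t)
    ((contDiffOn_const.mul hd).add (contDiffOn_id.mul hd.deriv)) (fun t ht ↦ ?_) ht
  rw [pow_one, ← h t ht]
  refine deriv_eq_of_eqOn hyd ht ?_
  refine ((hasDerivAt_pow 2 t).mul (hd.hasDerivAt ht)).congr_deriv ?_
  push_cast
  ring

/-- From u = 2 d + t d', u(0) = 0 gives d(0) = 0 and hence d = t b; differentiating at 0 gives u'(0)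
= 3 d'(0) = 3 b(0). -/
lemma exists_eq_cube_mul_of_deriv_eq {δ : ℝ} (hδ : 0 < δ) {y u : ℝ → ℝ} (hy : SmoothNear δ y)
    (hu : SmoothNear δ u) (hy0 : y 0 = 0) (h : ∀ t ∈ Ioo (-δ) δ, deriv y t = t * u t)
    (hu0 : u 0 = 0) :
    ∃ b, SmoothNear δ b ∧ (∀ t ∈ Ioo (-δ) δ, y t = t ^ 3 * b t) ∧ 3 * b 0 = deriv u 0 := by
  have h0 : (0 : ℝ) ∈ Ioo (-δ) δ := ⟨by linarith, hδ⟩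
  obtain ⟨d, hd, hyd, hud⟩ := exists_eq_sq_mul_of_deriv_eq hδ hy hu hy0 h
  have hd0 : d 0 = 0 := by have := hud 0 h0; rw [hu0] at this; linarith
  obtain ⟨b, hb, hdb, hb0⟩ := hd.exists_eq_mul hd0
  refine ⟨b, hb, fun t ht ↦ by rw [hyd t ht, hdb t ht]; ring, ?_⟩
  rw [hb0]
  refine (deriv_eq_of_eqOn hud h0 ?_).symm
  refine (((hd.hasDerivAt h0).const_mul 2).add
    ((hasDerivAt_id 0).mul (hd.deriv.hasDerivAt h0))).congr_deriv ?_
  simp; ring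

/-- The shear `(y₁, y₂) ↦ (y₁, (y₂ - g(y₁)) / p(y₁))` on the strip `y₁ ∈ J`. -/
def shear (J : Set ℝ) (hJ : IsOpen J) (p g : ℝ → ℝ) (hp : ContinuousOn p J)
    (hg : ContinuousOn g J) (hp0 : ∀ s ∈ J, p s ≠ 0) : OpenPartialHomeomorph Plane Plane where
  toFun y := !₂[y 0, (y 1 - g (y 0)) / p (y 0)]
  invFun q := !₂[q 0, q 1 * p (q 0) + g (q 0)]
  source := {y | y 0 ∈ J}
  target := {y | y 0 ∈ J}
  map_source' y hy := by simpa using hy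
  map_target' y hy := by simpa using hy
  left_inv' y hy := by
    have := hp0 _ hy
    ext i
    fin_cases i
    · simp
    · simp
      field_simp
      ring
  right_inv' y hy := by
    have := hp0 _ hy
    ext i
    fin_cases i
    · simp
    · simp
      field_simp
  open_source := hJ.preimage (by fun_prop)
  open_target := hJ.preimage (by fun_prop)
  continuousOn_toFun := by
    have h0 : ContinuousOn (fun y : Plane ↦ y 0) {y | y 0 ∈ J} := by fun_prop
    have hg' : ContinuousOn (fun y : Plane ↦ g (y 0)) {y | y 0 ∈ J} := hg.comp h0 fun _ h ↦ h
    have hp' : ContinuousOn (fun y : Plane ↦ p (y 0)) {y | y 0 ∈ J} := hp.comp h0 fun _ h ↦ h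
    have h1 : ContinuousOn (fun y : Plane ↦ (y 1 - g (y 0)) / p (y 0)) {y | y 0 ∈ J} :=
      ContinuousOn.div (ContinuousOn.sub (by fun_prop) hg') hp' fun y hy ↦ hp0 _ hy
    refine (PiLp.continuous_toLp 2 _).comp_continuousOn (continuousOn_pi.2 fun i ↦ ?_)
    fin_cases i
    · exact h0
    · exact h1
  continuousOn_invFun := by
    have h0 : ContinuousOn (fun y : Plane ↦ y 0) {y | y 0 ∈ J} := by fun_prop
    have hg' : ContinuousOn (fun y : Plane ↦ g (y 0)) {y | y 0 ∈ J} := hg.comp h0 fun _ h ↦ h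
    have hp' : ContinuousOn (fun y : Plane ↦ p (y 0)) {y | y 0 ∈ J} := hp.comp h0 fun _ h ↦ h
    have h1 : ContinuousOn (fun y : Plane ↦ y 1 * p (y 0) + g (y 0)) {y | y 0 ∈ J} :=
      ContinuousOn.add (ContinuousOn.mul (by fun_prop) hp') hg'
    refine (PiLp.continuous_toLp 2 _).comp_continuousOn (continuousOn_pi.2 fun i ↦ ?_)
    fin_cases i
    · exact h0
    · exact h1

section Shear

variable {J : Set ℝ} (hJ : IsOpen J) {p g : ℝ → ℝ} (hp : ContDiffOn ℝ ∞ p J)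
  (hg : ContDiffOn ℝ ∞ g J) (hp0 : ∀ s ∈ J, p s ≠ 0)

include hp hg in
lemma contDiffOn_shear :
    ContDiffOn ℝ ∞ (shear J hJ p g hp.continuousOn hg.continuousOn hp0) {y | y 0 ∈ J} := by
  have h0 : ContDiffOn ℝ ∞ (fun y : Plane ↦ y 0) {y | y 0 ∈ J} := by fun_prop
  have hg' : ContDiffOn ℝ ∞ (fun y : Plane ↦ g (y 0)) {y | y 0 ∈ J} := hg.comp h0 fun _ h ↦ h
  have hp' : ContDiffOn ℝ ∞ (fun y : Plane ↦ p (y 0)) {y | y 0 ∈ J} := hp.comp h0 fun _ h ↦ h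
  have h1 : ContDiffOn ℝ ∞ (fun y : Plane ↦ (y 1 - g (y 0)) / p (y 0)) {y | y 0 ∈ J} :=
    ContDiffOn.div (ContDiffOn.sub (by fun_prop) hg') hp' fun y hy ↦ hp0 _ hy
  rw [contDiffOn_piLp]
  intro i
  fin_cases i
  · exact h0
  · exact h1

include hp hg in
lemma contDiffOn_shear_symm :
    ContDiffOn ℝ ∞ (shear J hJ p g hp.continuousOn hg.continuousOn hp0).symm {y | y 0 ∈ J} := by
  have h0 : ContDiffOn ℝ ∞ (fun y : Plane ↦ y 0) {y | y 0 ∈ J} := by fun_prop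
  have hg' : ContDiffOn ℝ ∞ (fun y : Plane ↦ g (y 0)) {y | y 0 ∈ J} := hg.comp h0 fun _ h ↦ h
  have hp' : ContDiffOn ℝ ∞ (fun y : Plane ↦ p (y 0)) {y | y 0 ∈ J} := hp.comp h0 fun _ h ↦ h
  have h1 : ContDiffOn ℝ ∞ (fun y : Plane ↦ y 1 * p (y 0) + g (y 0)) {y | y 0 ∈ J} :=
    ContDiffOn.add (ContDiffOn.mul (by fun_prop) hp') hg'
  rw [contDiffOn_piLp]
  intro i
  fin_cases i
  · exact h0
  · exact h1

end Shear

/-- The inverse of a coordinate change of the line at the origin. -/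
lemma exists_inverse_near_zero {δ : ℝ} (hδ : 0 < δ) {r : ℝ → ℝ} (hr : SmoothNear δ r)
    (hr0 : r 0 = 0) (hr' : 0 < deriv r 0) :
    ∃ η > 0, ∃ σ, SmoothNear η σ ∧ σ 0 = 0 ∧ deriv σ 0 ≠ 0 ∧
      ∀ s ∈ Ioo (-η) η, σ s ∈ Ioo (-δ) δ ∧ r (σ s) = s := by
  have h0 : (0 : ℝ) ∈ Ioo (-δ) δ := ⟨by linarith, hδ⟩
  have hpos : ∀ᶠ t in 𝓝 (0 : ℝ), 0 < deriv r t :=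
    (hr.deriv.continuousOn.continuousAt (Ioo_mem_nhds h0.1 h0.2)).eventually (lt_mem_nhds hr')
  obtain ⟨e, he, hesub⟩ := Metric.mem_nhds_iff.1
    (Filter.inter_mem hpos (Ioo_mem_nhds h0.1 h0.2))
  rw [Real.ball_eq_Ioo, zero_sub, zero_add] at hesub
  have h0e : (0 : ℝ) ∈ Ioo (-e) e := ⟨by linarith, he⟩
  have hre : SmoothNear e r := hr.mono fun t ht ↦ (hesub ht).2
  have hinj : InjOn r (Ioo (-e) e) := by
    refine (strictMonoOn_of_deriv_pos (convex_Ioo _ _) hre.continuousOn fun t ht ↦ ?_).injOn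
    rw [interior_Ioo] at ht
    exact (hesub ht).1
  obtain ⟨σ, hσs, hσ⟩ := exists_smooth_comp_eq isOpen_Ioo hre hinj
    (fun t ht ↦ (hesub ht).1.ne') contDiffOn_id
  have hstrict : HasStrictDerivAt r (deriv r 0) 0 :=
    (hr.contDiffAt (Ioo_mem_nhds h0.1 h0.2)).hasStrictDerivAt (by norm_num)
  have himg : r '' Ioo (-e) e ∈ 𝓝 (0 : ℝ) := by
    have := hstrict.map_nhds_eq hr'.ne'
    rw [hr0] at this
    rw [← this]
    exact image_mem_map (Ioo_mem_nhds h0e.1 h0e.2)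
  obtain ⟨η, hη, hηsub⟩ := Metric.mem_nhds_iff.1 himg
  rw [Real.ball_eq_Ioo, zero_sub, zero_add] at hηsub
  have hσr : ∀ s ∈ Ioo (-η) η, σ s ∈ Ioo (-e) e ∧ r (σ s) = s := by
    intro s hs
    obtain ⟨t, ht, rfl⟩ := hηsub hs
    rw [hσ t ht]
    exact ⟨ht, rfl⟩
  have h0η : (0 : ℝ) ∈ Ioo (-η) η := ⟨by linarith, hη⟩
  have hσsm : SmoothNear η σ := by
    intro s hs
    obtain ⟨t, ht, rfl⟩ := hηsub hs
    exact (hσs t ht).contDiffWithinAt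
  have hσ0 : σ 0 = 0 := by have := hσ 0 h0e; rwa [hr0] at this
  refine ⟨η, hη, σ, hσsm, hσ0, fun hz ↦ ?_, fun s hs ↦ ⟨(hesub (hσr s hs).1).2, (hσr s hs).2⟩⟩
  have h1 : HasDerivAt r (deriv r 0) (σ 0) := by rw [hσ0]; exact hr.hasDerivAt h0
  have h2 := h1.comp 0 (hσsm.hasDerivAt h0η)
  rw [hz, mul_zero] at h2
  have h3 : HasDerivAt (r ∘ σ) 1 0 := by
    refine (hasDerivAt_id (0 : ℝ)).congr_of_eventuallyEq ?_
    filter_upwards [Ioo_mem_nhds h0η.1 h0η.2] with s hs using (hσr s hs).2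
  exact zero_ne_one (h2.unique h3)

/-- The parameter s = t √(a t) makes the first coordinate s². The second becomes s³ (P(s²) + s
Q(s²)); its part s⁴ Q(s²) is a function of the first coordinate, so a shear removes it and division
by P(s²) leaves s³. -/
lemma exists_shear_normal_form {δ : ℝ} (hδ : 0 < δ) {a b : ℝ → ℝ} (ha : SmoothNear δ a)
    (hb : SmoothNear δ b) (ha0 : 0 < a 0) (hb0 : b 0 ≠ 0) :
    ∃ σ : ℝ → ℝ, (∃ r > 0, ContDiffOn ℝ ∞ σ (Ioo (-r) r)) ∧ σ 0 = 0 ∧ deriv σ 0 ≠ 0 ∧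
      (∀ᶠ s in 𝓝 0, σ s ∈ Ioo (-δ) δ) ∧
      ∃ Ψ : OpenPartialHomeomorph Plane Plane, ContDiffOn ℝ ∞ Ψ Ψ.source ∧
        ContDiffOn ℝ ∞ Ψ.symm Ψ.target ∧ 0 ∈ Ψ.source ∧
        ∀ᶠ s in 𝓝 (0 : ℝ), !₂[σ s ^ 2 * a (σ s), σ s ^ 3 * b (σ s)] ∈ Ψ.source ∧
          Ψ !₂[σ s ^ 2 * a (σ s), σ s ^ 3 * b (σ s)] = !₂[s ^ 2, s ^ 3] := by
  have h0 : (0 : ℝ) ∈ Ioo (-δ) δ := ⟨by linarith, hδ⟩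
  have hpos : ∀ᶠ t in 𝓝 (0 : ℝ), 0 < a t :=
    (ha.continuousOn.continuousAt (Ioo_mem_nhds h0.1 h0.2)).eventually (lt_mem_nhds ha0)
  obtain ⟨e, he, hesub⟩ := Metric.mem_nhds_iff.1
    (Filter.inter_mem hpos (Ioo_mem_nhds h0.1 h0.2))
  rw [Real.ball_eq_Ioo, zero_sub, zero_add] at hesub
  have h0e : (0 : ℝ) ∈ Ioo (-e) e := ⟨by linarith, he⟩
  have hsq : SmoothNear e fun t ↦ √(a t) :=
    (ha.mono fun t ht ↦ (hesub ht).2).sqrt fun t ht ↦ (hesub ht).1.ne'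
  have hr : SmoothNear e fun t ↦ t * √(a t) := contDiffOn_id.mul hsq
  have hr' : deriv (fun t ↦ t * √(a t)) 0 = √(a 0) := by
    refine HasDerivAt.deriv ?_
    refine ((hasDerivAt_id (0 : ℝ)).mul (hsq.hasDerivAt h0e)).congr_deriv ?_
    simp
  obtain ⟨η, hη, σ, hσ, hσ0, hσ', hσr⟩ := exists_inverse_near_zero he hr (by simp)
    (by rw [hr']; exact Real.sqrt_pos.2 ha0)
  have h0η : (0 : ℝ) ∈ Ioo (-η) η := ⟨by linarith, hη⟩
  -- With σ = s ρ the second coordinate is s³ ρ³ b(σ).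
  obtain ⟨ρ, hρ, hσρ, hρ0⟩ := hσ.exists_eq_mul hσ0
  have hβ : SmoothNear η fun s ↦ ρ s ^ 3 * b (σ s) :=
    (hρ.pow 3).mul (hb.comp hσ fun s hs ↦ (hesub (hσr s hs).1).2)
  obtain ⟨P, Q, hP, hQ, hPQ⟩ := hβ.exists_eq_comp_sq_add_mul hη
  have hP0 : P 0 ≠ 0 := by
    have := hPQ 0 h0η
    simp only [hσ0, zero_mul, add_zero, ne_eq, OfNat.ofNat_ne_zero, not_false_eq_true,
      zero_pow] at this
    rw [← this, hρ0]
    positivity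
  have hη2 : (0 : ℝ) < η ^ 2 := by positivity
  -- An open neighbourhood of 0: `P` and `Q` are smooth for negative arguments too, so the shear is
  -- a diffeomorphism on both sides of the cusp.
  set J : Set ℝ := {x | x ∈ Iio (η ^ 2) ∧ P x ≠ 0} with hJdef
  have hJ : IsOpen J := by
    have := hP.continuousOn.isOpen_inter_preimage isOpen_Iio isOpen_compl_singleton (t := {0}ᶜ)
    exact this
  have hPJ : ContDiffOn ℝ ∞ P J := hP.mono fun x hx ↦ hx.1
  have hgJ : ContDiffOn ℝ ∞ (fun x ↦ x ^ 2 * Q x) J :=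
    (contDiffOn_id.pow 2).mul (hQ.mono fun x hx ↦ hx.1)
  have h0J : (0 : ℝ) ∈ J := ⟨hη2, hP0⟩
  have hJ0 : J ∈ 𝓝 (0 : ℝ) := hJ.mem_nhds h0J
  refine ⟨σ, ⟨η, hη, hσ⟩, hσ0, hσ', ?_, shear J hJ P (fun x ↦ x ^ 2 * Q x) hPJ.continuousOn
    hgJ.continuousOn fun x hx ↦ hx.2, contDiffOn_shear hJ hPJ hgJ _,
    contDiffOn_shear_symm hJ hPJ hgJ _, by simpa [shear] using h0J, ?_⟩
  · filter_upwards [Ioo_mem_nhds h0η.1 h0η.2] with s hs using (hesub (hσr s hs).1).2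
  · have hlim : Tendsto (fun s : ℝ ↦ s ^ 2) (𝓝 0) (𝓝 0) := by
      simpa using (continuous_pow 2).tendsto (0 : ℝ)
    filter_upwards [Ioo_mem_nhds h0η.1 h0η.2, hlim.eventually hJ0] with s hs hsJ
    have e1 : σ s ^ 2 * a (σ s) = s ^ 2 := by
      have h1 := (hσr s hs).2
      have h2 := (hesub (hσr s hs).1).1
      calc σ s ^ 2 * a (σ s) = (σ s * √(a (σ s))) ^ 2 := by rw [mul_pow, Real.sq_sqrt h2.le]
        _ = s ^ 2 := by rw [h1]
    have e2 : σ s ^ 3 * b (σ s) = s ^ 3 * (P (s ^ 2) + s * Q (s ^ 2)) := by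
      rw [← hPQ s hs, hσρ s hs]; ring
    rw [e1, e2]
    refine ⟨show !₂[s ^ 2, _] 0 ∈ J from hsJ, ?_⟩
    have h3 := hsJ.2
    ext i
    fin_cases i
    · simp [shear]
    · simp [shear]
      field_simp
      ring

variable {M : Type*} [TopologicalSpace M] [ChartedSpace Plane M] [IsManifold (𝓡 2) ∞ M]

/-- A criterion for `3/2`-cusps in terms of affine coordinates adapted to the curve. -/
lemma isThreeHalvesCusp_of_chart {γ : ℝ → M} {x₀ : M} {δ : ℝ} (hδ : 0 < δ) {a b : ℝ → ℝ}
    (ha : SmoothNear δ a) (hb : SmoothNear δ b) (ha0 : 0 < a 0) (hb0 : b 0 ≠ 0)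
    (hsrc : ∀ t ∈ Ioo (-δ) δ, γ t ∈ (chartAt Plane x₀).source) (L : Plane ≃L[ℝ] Plane) (p : Plane)
    (h : ∀ t ∈ Ioo (-δ) δ, L (chartAt Plane x₀ (γ t) - p) = !₂[t ^ 2 * a t, t ^ 3 * b t]) :
    IsThreeHalvesCusp γ := by
  have h0 : (0 : ℝ) ∈ Ioo (-δ) δ := ⟨by linarith, hδ⟩
  obtain ⟨σ, hσ, hσ0, hσ', hσδ, Ψ, hΨ, hΨ', h0Ψ, hΨσ⟩ :=
    exists_shear_normal_form hδ ha hb ha0 hb0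
  let H : Plane ≃ₜ Plane := (Homeomorph.subRight p).trans L.toHomeomorph
  have hH : ∀ y, H y = L (y - p) := fun y ↦ rfl
  have hHs : ContDiff ℝ ∞ H := L.contDiff.comp (contDiff_id.sub contDiff_const)
  have hHs' : ContDiff ℝ ∞ H.symm :=
    (L.symm.contDiff.add contDiff_const : ContDiff ℝ ∞ fun y ↦ L.symm y + p)
  -- The chart, followed by the affine map y ↦ L (y - p) and the shear.
  let Φ := (chartAt Plane x₀).trans (H.toOpenPartialHomeomorph.trans Ψ)
  have hΦsrc : ∀ x, x ∈ Φ.source ↔ x ∈ (chartAt Plane x₀).source ∧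
      L (chartAt Plane x₀ x - p) ∈ Ψ.source := fun x ↦ by
    simp [Φ, hH]
  have hΦ : ∀ x, Φ x = Ψ (L (chartAt Plane x₀ x - p)) := fun x ↦ rfl
  refine ⟨σ, hσ, hσ0, hσ', Φ, Φ.mem_maximalAtlas_of_contMDiffOn ?_ ?_, ?_, ?_⟩
  · have h1 : ContMDiffOn (𝓡 2) (𝓡 2) ∞ (fun x ↦ H (chartAt Plane x₀ x)) Φ.source :=
      hHs.contMDiff.comp_contMDiffOn ((contMDiffOn_chart (x := x₀)).mono fun x hx ↦
        ((hΦsrc x).1 hx).1)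
    exact hΨ.contMDiffOn.comp h1 fun x hx ↦ ((hΦsrc x).1 hx).2
  · have h1 : ContMDiffOn (𝓡 2) (𝓡 2) ∞ (fun y ↦ H.symm (Ψ.symm y)) Φ.target :=
      hHs'.contMDiff.comp_contMDiffOn (hΨ'.contMDiffOn.mono fun y hy ↦ by
        simp only [Φ, OpenPartialHomeomorph.trans_target, mem_inter_iff] at hy
        exact hy.1.1)
    exact (contMDiffOn_chart_symm (x := x₀)).comp h1 fun y hy ↦ by
      simp only [Φ, OpenPartialHomeomorph.trans_target, mem_inter_iff] at hy
      exact hy.2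
  · rw [hΦsrc, h 0 h0]
    have e : (!₂[0 ^ 2 * a 0, 0 ^ 3 * b 0] : Plane) = 0 := by
      ext i
      fin_cases i <;> simp
    rw [e]
    exact ⟨hsrc 0 h0, h0Ψ⟩
  · filter_upwards [hσδ, hΨσ] with s hs hs2
    rw [hΦsrc, hΦ, h _ hs]
    exact ⟨⟨hsrc _ hs, hs2.1⟩, hs2.2⟩

end CuspNormalForm

/-! ### The velocity at a cusp and the nonvanishing of [γ̈, γ^(3)]. -/

section CuspFrame

lemma plane_mk_eq (a b : ℝ) : (!₂[a, b] : Plane)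
    = a • EuclideanSpace.single (0 : Fin 2) (1 : ℝ) + b • EuclideanSpace.single (1 : Fin 2) (1 : ℝ) := by
  ext i
  fin_cases i <;> simp

/-- A nonzero alternating form does not vanish on the image of a basis. -/
lemma alternating_apply_ne_zero {β : Plane →L[ℝ] Plane →L[ℝ] ℝ} (halt : ∀ c, β c c = 0)
    (hβ : β ≠ 0) {K : Plane →L[ℝ] Plane} (hK : Function.Surjective K) :
    β (K (EuclideanSpace.single 0 1)) (K (EuclideanSpace.single 1 1)) ≠ 0 := by
  intro h
  have hswap : β (K (EuclideanSpace.single 1 1)) (K (EuclideanSpace.single 0 1)) = 0 := by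
    have := halt (K (EuclideanSpace.single 0 1) + K (EuclideanSpace.single 1 1))
    simp only [map_add, add_apply, halt, h] at this
    linarith
  refine hβ ?_
  ext a b
  obtain ⟨a, rfl⟩ := hK a
  obtain ⟨b, rfl⟩ := hK b
  rw [plane_eq_sum a, plane_eq_sum b]
  simp [halt, h, hswap]

/-- An orientation-reversing σ is handled by inverting -σ and reflecting the argument. -/
lemma exists_local_inverse {r : ℝ} (hr : 0 < r) {σ : ℝ → ℝ} (hσ : SmoothNear r σ)
    (hσ0 : σ 0 = 0) (hσ' : deriv σ 0 ≠ 0) :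
    ∃ η > 0, ∃ θ, SmoothNear η θ ∧ θ 0 = 0 ∧ deriv θ 0 ≠ 0 ∧
      ∀ t ∈ Ioo (-η) η, σ (θ t) = t := by
  rcases hσ'.lt_or_gt with h | h
  · obtain ⟨η, hη, θ, hθ, hθ0, hθ', h1⟩ := exists_inverse_near_zero hr (r := fun t ↦ -σ t) hσ.neg
      (by simp [hσ0]) (by rw [deriv.fun_neg]; linarith)
    refine ⟨η, hη, fun t ↦ θ (-t), hθ.comp_neg, by simpa using hθ0, ?_, fun t ht ↦ ?_⟩
    · rw [deriv_comp_neg]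
      simpa using hθ'
    · have := (h1 (-t) (neg_mem_Ioo_symm ht)).2
      linarith
  · obtain ⟨η, hη, θ, hθ, hθ0, hθ', h1⟩ := exists_inverse_near_zero hr hσ hσ0 h
    exact ⟨η, hη, θ, hθ, hθ0, hθ', fun t ht ↦ (h1 t ht).2⟩

/-- The velocity of the image of a standard cusp under a local diffeomorphism. -/
lemma exists_cusp_frame {F G : Plane → Plane} (hF : ContDiffAt ℝ ∞ F 0)
    (hG : DifferentiableAt ℝ G (F 0)) (hFG : ∀ᶠ y in 𝓝 (F 0), F (G y) = y) (hG0 : G (F 0) = 0)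
    {θ : ℝ → ℝ} (hθ : ContDiffAt ℝ ∞ θ 0) (hθ0 : θ 0 = 0) (hθ' : deriv θ 0 ≠ 0) :
    ∃ V : ℝ → Plane, ContDiffAt ℝ ∞ V 0 ∧
      (∀ᶠ t in 𝓝 0, deriv (fun s ↦ F !₂[θ s ^ 2, θ s ^ 3]) t = θ t • V t) ∧
      ∀ β : Plane →L[ℝ] Plane →L[ℝ] ℝ, (∀ c, β c c = 0) → β ≠ 0 → β (V 0) (deriv V 0) ≠ 0 := by
  set e0 : Plane := EuclideanSpace.single 0 1 with he0
  set e1 : Plane := EuclideanSpace.single 1 1 with he1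
  set z : ℝ → Plane := fun s ↦ θ s ^ 2 • e0 + θ s ^ 3 • e1 with hz
  have hzeq : ∀ s, !₂[θ s ^ 2, θ s ^ 3] = z s := fun s ↦ plane_mk_eq _ _
  have hz0 : z 0 = 0 := by simp [hz, hθ0]
  set w : ℝ → Plane := fun s ↦ (2 * deriv θ s) • e0 + (3 * (θ s * deriv θ s)) • e1 with hw
  have hdθ := contDiffAt_deriv hθ
  have hzs : ContDiffAt ℝ ∞ z 0 :=
    ((hθ.pow 2).smul contDiffAt_const).add ((hθ.pow 3).smul contDiffAt_const)
  have hws : ContDiffAt ℝ ∞ w 0 :=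
    ((contDiffAt_const.mul hdθ).smul contDiffAt_const).add
      ((contDiffAt_const.mul (hθ.mul hdθ)).smul contDiffAt_const)
  have hF' : ContDiffAt ℝ ∞ (fderiv ℝ F) 0 := hF.fderiv_right (by norm_num)
  have hKs : ContDiffAt ℝ ∞ (fun t ↦ fderiv ℝ F (z t)) 0 :=
    ContDiffAt.comp 0 (g := fderiv ℝ F) (by rwa [hz0]) hzs
  have hdiff : ∀ᶠ t in 𝓝 (0 : ℝ), DifferentiableAt ℝ θ t := by
    filter_upwards [(hθ.of_le (m := 1) (by norm_num)).eventually (by norm_num)] with t ht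
    exact ht.differentiableAt (by norm_num)
  have hzd : ∀ t, DifferentiableAt ℝ θ t → HasDerivAt z (θ t • w t) t := by
    intro t ht
    refine (((ht.hasDerivAt.pow 2).smul_const e0).add
      ((ht.hasDerivAt.pow 3).smul_const e1)).congr_deriv ?_
    simp only [hw, smul_add, smul_smul]
    congr 2 <;> (push_cast; ring)
  have hFd : ∀ᶠ t in 𝓝 (0 : ℝ), DifferentiableAt ℝ F (z t) := by
    have h1 : ∀ᶠ y in 𝓝 (0 : Plane), DifferentiableAt ℝ F y := by
      filter_upwards [(hF.of_le (m := 1) (by norm_num)).eventually (by norm_num)] with t ht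
      exact ht.differentiableAt (by norm_num)
    rw [← hz0] at h1
    exact hzs.continuousAt.eventually h1
  refine ⟨fun t ↦ fderiv ℝ F (z t) (w t), hKs.clm_apply hws, ?_, fun β halt hβ ↦ ?_⟩
  · filter_upwards [hdiff, hFd] with t h1 h2
    simp only [hzeq]
    rw [← map_smul]
    exact (h2.hasFDerivAt.comp_hasDerivAt t (hzd t h1)).deriv
  · have hK0 : HasDerivAt (fun t ↦ fderiv ℝ F (z t)) 0 0 := by
      have h1 : DifferentiableAt ℝ (fderiv ℝ F) (z 0) := by
        rw [hz0]; exact hF'.differentiableAt (by norm_num)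
      refine (h1.hasFDerivAt.comp_hasDerivAt 0 (hzd 0 hdiff.self_of_nhds)).congr_deriv ?_
      rw [hθ0, zero_smul, map_zero]
    have hθd := hdiff.self_of_nhds.hasDerivAt
    have hdθd := (hdθ.differentiableAt (by norm_num)).hasDerivAt
    have hw0 : HasDerivAt w ((2 * deriv (deriv θ) 0) • e0 + (3 * deriv θ 0 ^ 2) • e1) 0 := by
      refine (((hdθd.const_mul 2).smul_const e0).add
        (((hθd.mul hdθd).const_mul 3).smul_const e1)).congr_deriv ?_
      rw [hθ0]
      congr 2
      ring
    rw [(hK0.clm_apply hw0).deriv]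
    have hsurj : Function.Surjective (fderiv ℝ F 0) := by
      have h1 : HasFDerivAt F (fderiv ℝ F 0) (G (F 0)) := by
        rw [hG0]; exact (hF.differentiableAt (by norm_num)).hasFDerivAt
      have h2 := h1.comp (F 0) hG.hasFDerivAt
      have h3 : HasFDerivAt (F ∘ G) (ContinuousLinearMap.id ℝ Plane) (F 0) :=
        (hasFDerivAt_id (F 0)).congr_of_eventuallyEq hFG
      intro y
      refine ⟨fderiv ℝ G (F 0) y, ?_⟩
      have := congrArg (fun L : Plane →L[ℝ] Plane ↦ L y) (h2.unique h3)
      simpa using this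
    have hne := alternating_apply_ne_zero halt hβ hsurj
    -- The e0 component of w'(0) is killed by alternation, since w(0) is a multiple of e0.
    have hval : β (fderiv ℝ F (z 0) (w 0)) ((0 : Plane →L[ℝ] Plane) (w 0) + fderiv ℝ F (z 0)
        ((2 * deriv (deriv θ) 0) • e0 + (3 * deriv θ 0 ^ 2) • e1))
        = 6 * deriv θ 0 ^ 3 * β (fderiv ℝ F 0 e0) (fderiv ℝ F 0 e1) := by
      simp only [hw, hz0, hθ0, zero_apply, zero_add, zero_mul, mul_zero, zero_smul, add_zero,
        map_add, map_smul, map_zero, smul_apply, smul_eq_mul, halt]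
      ring
    rw [hval]
    exact mul_ne_zero (mul_ne_zero (by norm_num) (pow_ne_zero 3 hθ')) hne

variable {M : Type*} [TopologicalSpace M] [ChartedSpace Plane M] [IsManifold (𝓡 2) ∞ M]

/-- In the chart at `γ 0`, the curve is the standard cusp in the parameter θ = σ⁻¹, carried by the
transition map from `Φ`. -/
lemma IsThreeHalvesCusp.exists_frame {γ : ℝ → M} (h : IsThreeHalvesCusp γ) :
    ∃ (θ : ℝ → ℝ) (V : ℝ → Plane), ContDiffAt ℝ ∞ θ 0 ∧ θ 0 = 0 ∧ deriv θ 0 ≠ 0 ∧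
      ContDiffAt ℝ ∞ V 0 ∧
      (∀ᶠ t in 𝓝 0, deriv (fun s ↦ chartAt Plane (γ 0) (γ s)) t = θ t • V t) ∧
      ∀ β : Plane →L[ℝ] Plane →L[ℝ] ℝ, (∀ c, β c c = 0) → β ≠ 0 → β (V 0) (deriv V 0) ≠ 0 := by
  obtain ⟨σ, ⟨r, hr, hσ⟩, hσ0, hσ', Φ, hΦ, h0Φ, hev⟩ := h
  obtain ⟨η, hη, θ, hθ, hθ0, hθ', hσθ⟩ := exists_local_inverse hr hσ hσ0 hσ'
  have hnhds : Ioo (-η) η ∈ 𝓝 (0 : ℝ) := Ioo_mem_nhds (by linarith) hη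
  have hθs : ContDiffAt ℝ ∞ θ 0 := hθ.contDiffAt hnhds
  have hθlim : Tendsto θ (𝓝 0) (𝓝 0) := by
    have := hθs.continuousAt.tendsto
    rwa [hθ0] at this
  set e := chartAt Plane (γ 0) with he
  have h0e : γ 0 ∈ e.source := mem_chart_source _ _
  have hcusp : ∀ᶠ t in 𝓝 (0 : ℝ), γ t ∈ Φ.source ∧ Φ (γ t) = !₂[θ t ^ 2, θ t ^ 3] := by
    filter_upwards [hθlim.eventually hev, hnhds] with t h1 h2
    rwa [hσθ t h2] at h1
  have hΦ0 : Φ (γ 0) = 0 := by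
    rw [hcusp.self_of_nhds.2, hθ0]
    ext i
    fin_cases i <;> simp
  have hΦs : Φ.symm 0 = γ 0 := by rw [← hΦ0, Φ.left_inv h0Φ]
  have h0t : (0 : Plane) ∈ Φ.target := by rw [← hΦ0]; exact Φ.map_source h0Φ
  have hF : ContDiffAt ℝ ∞ (fun q ↦ e (Φ.symm q)) 0 := by
    rw [← contMDiffAt_iff_contDiffAt]
    refine ContMDiffAt.comp (0 : Plane) (I' := 𝓡 2) (g := e) ?_
      (contMDiffAt_symm_of_mem_maximalAtlas hΦ h0t)
    rw [hΦs]
    exact contMDiffAt_of_mem_maximalAtlas (IsManifold.chart_mem_maximalAtlas _) h0e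
  have hG : ContDiffAt ℝ ∞ (fun p ↦ Φ (e.symm p)) (e (γ 0)) := by
    rw [← contMDiffAt_iff_contDiffAt]
    refine ContMDiffAt.comp (e (γ 0)) (I' := 𝓡 2) (g := Φ) ?_
      (contMDiffAt_symm_of_mem_maximalAtlas (IsManifold.chart_mem_maximalAtlas _)
        (e.map_source h0e))
    rw [e.left_inv h0e]
    exact contMDiffAt_of_mem_maximalAtlas hΦ h0Φ
  have hF0 : e (Φ.symm 0) = e (γ 0) := by rw [hΦs]
  obtain ⟨V, hV, hder, hβ⟩ := exists_cusp_frame hF (G := fun p ↦ Φ (e.symm p))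
    (by rw [hF0]; exact hG.differentiableAt (by norm_num)) (by
      rw [hF0]
      have hc : ContinuousAt e.symm (e (γ 0)) := e.continuousAt_symm (e.map_source h0e)
      filter_upwards [e.open_target.mem_nhds (e.map_source h0e), hc.preimage_mem_nhds
        (Φ.open_source.mem_nhds (by rwa [e.left_inv h0e]))] with y h1 h2
      rw [Φ.left_inv h2, e.right_inv h1]) (by rw [hF0, e.left_inv h0e, hΦ0]) hθs hθ0 hθ'
  refine ⟨θ, V, hθs, hθ0, hθ', hV, ?_, hβ⟩
  filter_upwards [hder, hcusp.eventually_nhds] with t h1 h2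
  rw [← h1]
  refine Filter.EventuallyEq.deriv_eq ?_
  filter_upwards [h2] with s hs
  rw [← hs.2, Φ.left_inv hs.1]

variable {D : AffineConnection M}
  {Ω : ∀ x : M, TangentSpace (𝓡 2) x →L[ℝ] TangentSpace (𝓡 2) x →L[ℝ] ℝ} {γ : ℝ → M}

lemma IsThreeHalvesCusp.velocity_eq_zero {δ : ℝ} (hδ : 0 < δ)
    (hγ : ContMDiffOn 𝓘(ℝ, ℝ) (𝓡 2) ∞ γ (Ioo (-δ) δ)) (h : IsThreeHalvesCusp γ) :
    velocity γ 0 = 0 := by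
  obtain ⟨θ, V, -, hθ0, -, -, hder, -⟩ := h.exists_frame
  have hx : γ 0 ∈ (chartAt Plane (γ 0)).source := mem_chart_source _ _
  have h1 := comps_velocity hx (mdifferentiableAt_curve isOpen_Ioo hγ (t := 0) ⟨by linarith, hδ⟩)
  have h2 := hder.self_of_nhds
  rw [h1.deriv, hθ0, zero_smul] at h2
  rw [← constField_comps hx (velocity γ 0), h2]
  simpa using constField_smul (γ 0) 0 0 (γ 0)

/-- The connection enters γ̈ only through θ² B(V, V), and γ^(3)(0) only through this term and the
zero velocity. As θ(0) = 0, it contributes nothing at 0 and the bracket is 2 θ'² Ω(V, V'). -/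
lemma IsThreeHalvesCusp.bracket_ne_zero [T2Space M]
    (hD : CovariantDerivative.ContMDiffCovariantDerivative D ∞) (hΩ : IsParallelAreaForm D Ω)
    {δ : ℝ} (hδ : 0 < δ) (hγ : ContMDiffOn 𝓘(ℝ, ℝ) (𝓡 2) ∞ γ (Ioo (-δ) δ))
    (h : IsThreeHalvesCusp γ) : bracket D Ω γ 2 3 0 ≠ 0 := by
  obtain ⟨θ, V, hθ, hθ0, hθ', hV, hder, hβ⟩ := h.exists_frame
  have h0 : (0 : ℝ) ∈ Ioo (-δ) δ := ⟨by linarith, hδ⟩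
  set x₀ := γ 0 with hx₀
  have hx : γ 0 ∈ (chartAt Plane x₀).source := mem_chart_source _ _
  have hnear := eventually_mem_chart isOpen_Ioo hγ h0 hx
  set c1 : ℝ → Plane := fun t ↦ comps x₀ (γ t) (curveDeriv D γ 1 t) with hc1
  have e1 : c1 =ᶠ[𝓝 0] fun t ↦ θ t • V t := by
    filter_upwards [hnear, hder] with t h1 h2
    rw [← h2]
    exact (comps_velocity h1.2 (mdifferentiableAt_curve isOpen_Ioo hγ h1.1)).deriv.symm
  have hev1 : ∀ {E : Type} [NormedAddCommGroup E] [NormedSpace ℝ E] {f : ℝ → E},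
      ContDiffAt ℝ ∞ f 0 → ∀ᶠ t in 𝓝 (0 : ℝ), DifferentiableAt ℝ f t := by
    intro E _ _ f hf
    filter_upwards [(hf.of_le (m := 1) (by norm_num)).eventually (by norm_num)] with t ht
    exact ht.differentiableAt (by norm_num)
  set B : ℝ → Plane →L[ℝ] Plane →L[ℝ] Plane :=
    fun t ↦ connBil D x₀ (chartAt Plane x₀ (γ t)) with hB
  have hBs : ContDiffAt ℝ ∞ B 0 :=
    ContDiffAt.comp 0 (g := connBil D x₀) ((contDiffOn_connBil hD x₀).contDiffAt
      ((chartAt Plane x₀).open_target.mem_nhds ((chartAt Plane x₀).map_source hx)))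
      (contDiffAt_chart_comp isOpen_Ioo hγ h0 hx)
  have e2 : (fun t ↦ comps x₀ (γ t) (curveDeriv D γ 2 t)) =ᶠ[𝓝 0] fun t ↦
      (θ t • deriv V t + deriv θ t • V t) + θ t ^ 2 • B t (V t) (V t) := by
    filter_upwards [hnear, e1.eventuallyEq_nhds, hev1 hθ, hev1 hV] with t h1 h2 h3 h4
    have h5 := comps_covDerivAlong D h1.2
      ((smoothAlong_curveDeriv hD isOpen_Ioo hγ 0).mdifferentiableAt isOpen_Ioo h1.1)
    have h6 : comps x₀ (γ t) (velocity γ t) = θ t • V t := h2.self_of_nhds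
    have h7 : comps x₀ (γ t) (curveDeriv D γ 1 t) = θ t • V t := h2.self_of_nhds
    change comps x₀ (γ t) (covDerivAlong D γ (curveDeriv D γ 1) t) = _
    rw [h5, h6, h7, ← connBil_apply D h1.2]
    change deriv c1 t + _ = _
    have h8 : deriv (fun t ↦ θ t • V t) t = θ t • deriv V t + deriv θ t • V t :=
      (h3.hasDerivAt.smul h4.hasDerivAt).deriv
    rw [h2.deriv_eq, h8]
    simp only [map_smul, smul_apply, smul_smul, hB, pow_two]
  have hθd := (hev1 hθ).self_of_nhds.hasDerivAt
  have hVd := (hev1 hV).self_of_nhds.hasDerivAt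
  have hθ2 := (hev1 (contDiffAt_deriv hθ)).self_of_nhds.hasDerivAt
  have hV2 := (hev1 (contDiffAt_deriv hV)).self_of_nhds.hasDerivAt
  have hBV := (hev1 ((hBs.clm_apply hV).clm_apply hV)).self_of_nhds.hasDerivAt
  have e2' : comps x₀ (γ 0) (curveDeriv D γ 2 0)
      = (θ 0 • deriv V 0 + deriv θ 0 • V 0) + θ 0 ^ 2 • B 0 (V 0) (V 0) := e2.self_of_nhds
  have e3 : comps x₀ (γ 0) (curveDeriv D γ 3 0)
      = (2 * deriv θ 0) • deriv V 0 + deriv (deriv θ) 0 • V 0 := by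
    have h5 := comps_covDerivAlong D hx
      ((smoothAlong_curveDeriv hD isOpen_Ioo hγ 1).mdifferentiableAt isOpen_Ioo h0)
    change comps x₀ (γ 0) (covDerivAlong D γ (curveDeriv D γ 2) 0) = _
    have h6 : comps x₀ (γ 0) (velocity γ 0) = 0 := by
      rw [h.velocity_eq_zero hδ hγ, map_zero]
    rw [h5, h6, ← connBil_apply D hx, map_zero, zero_apply, add_zero, e2.deriv_eq]
    refine HasDerivAt.deriv ?_
    refine (((hθd.smul hV2).add (hθ2.smul hVd)).add ((hθd.pow 2).smul hBV)).congr_deriv ?_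
    simp only [Pi.pow_apply, hθ0, two_mul, add_smul]
    simp
    abel
  have hval : bracket D Ω γ 2 3 0
      = 2 * deriv θ 0 ^ 2 * areaBil Ω x₀ (chartAt Plane x₀ (γ 0)) (V 0) (deriv V 0) := by
    rw [bracket, area_eq_areaBil Ω hx, e3, e2', hθ0]
    simp only [zero_smul, zero_add, ne_eq, OfNat.ofNat_ne_zero, not_false_eq_true, zero_pow,
      add_zero, map_add, map_smul, smul_apply, smul_eq_mul, areaBil_self hΩ hx]
    ring
  rw [hval]
  exact mul_ne_zero (mul_ne_zero two_ne_zero (pow_ne_zero 2 hθ'))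
    (hβ _ (areaBil_self hΩ hx) (areaBil_ne_zero hΩ hx))

lemma bracketSystem_of_velocity_eq_zero [T2Space M]
    (hD : CovariantDerivative.ContMDiffCovariantDerivative D ∞) (hΩ : IsParallelAreaForm D Ω)
    {δ : ℝ} (hγ : ContMDiffOn 𝓘(ℝ, ℝ) (𝓡 2) ∞ γ (Ioo (-δ) δ)) (h : velocity γ 0 = 0) :
    BracketSystem (bracket D Ω γ) δ where
  smooth i j := contDiffOn_bracket hD hΩ isOpen_Ioo hγ i j
  hasDerivAt i j _ ht := hasDerivAt_bracket hD hΩ isOpen_Ioo hγ i j ht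
  self _ _ := hΩ.alternating _ _
  zero j := by
    change Ω (γ 0) (velocity γ 0) _ = 0
    rw [h, map_zero]; rfl

end CuspFrame

/-! ### Differential equations for the curve with prescribed curvature. -/

section Solutions

/-- Local solutions of a smooth autonomous differential equation are smooth. -/
lemma exists_smooth_solution {E : Type*} [NormedAddCommGroup E] [NormedSpace ℝ E] [CompleteSpace E]
    {F : E → E} {S : Set E} (hS : IsOpen S) (hF : ContDiffOn ℝ ∞ F S) {y₀ : E} (hy₀ : y₀ ∈ S) :
    ∃ ε > 0, ∃ α : ℝ → E, α 0 = y₀ ∧ ContDiffOn ℝ ∞ α (Ioo (-ε) ε) ∧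
      ∀ t ∈ Ioo (-ε) ε, α t ∈ S ∧ HasDerivAt α (F (α t)) t := by
  obtain ⟨α, hα0, ε, hε, hα⟩ :=
    ((hF.contDiffAt (hS.mem_nhds hy₀)).of_le (m := 1)
      (by norm_num)).exists_forall_mem_closedBall_exists_eq_forall_mem_Ioo_hasDerivAt₀ 0
  rw [zero_sub, zero_add] at hα
  have h0 : (0 : ℝ) ∈ Ioo (-ε) ε := ⟨by linarith, hε⟩
  have hmem : ∀ᶠ t in 𝓝 (0 : ℝ), α t ∈ S :=
    (hα 0 h0).continuousAt.preimage_mem_nhds (by rw [hα0]; exact hS.mem_nhds hy₀)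
  obtain ⟨e, he, hsub⟩ := Metric.mem_nhds_iff.1
    (Filter.inter_mem hmem (Ioo_mem_nhds h0.1 h0.2))
  rw [Real.ball_eq_Ioo, zero_sub, zero_add] at hsub
  have hd : ∀ t ∈ Ioo (-e) e, HasDerivAt α (F (α t)) t := fun t ht ↦ hα t (hsub ht).2
  refine ⟨e, he, α, hα0, contDiffOn_infty.2 fun n ↦ ?_, fun t ht ↦ ⟨(hsub ht).1, hd t ht⟩⟩
  -- If α is of class C^n, so is α' = F ∘ α.
  induction n with
  | zero => exact contDiffOn_zero.2 fun t ht ↦ (hd t ht).continuousAt.continuousWithinAt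
  | succ n ih =>
    rw [Nat.cast_add, Nat.cast_one, contDiffOn_succ_iff_deriv_of_isOpen isOpen_Ioo]
    refine ⟨fun t ht ↦ (hd t ht).differentiableAt.differentiableWithinAt, by simp, ?_⟩
    exact ((hF.of_le (m := (n : ℕ∞ω)) (by exact_mod_cast le_top)).comp ih
      fun t ht ↦ (hsub ht).1).congr fun t ht ↦ (hd t ht).deriv

/-- The differential equation of a curve whose velocity is `t U`, with `D_t U = W` and
`D_t W = q U`. -/
lemma exists_moving_frame {r : ℝ} (hr : 0 < r) {T : Set Plane} (hT : IsOpen T)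
    {B : Plane → Plane →L[ℝ] Plane →L[ℝ] Plane} (hB : ContDiffOn ℝ ∞ B T) {q : ℝ → ℝ}
    (hq : SmoothNear r q) {x₀ U₀ W₀ : Plane} (hx₀ : x₀ ∈ T) :
    ∃ ε ∈ Ioc 0 r, ∃ x U W : ℝ → Plane, x 0 = x₀ ∧ U 0 = U₀ ∧ W 0 = W₀ ∧
      ContDiffOn ℝ ∞ x (Ioo (-ε) ε) ∧ ContDiffOn ℝ ∞ U (Ioo (-ε) ε) ∧
      ContDiffOn ℝ ∞ W (Ioo (-ε) ε) ∧ ∀ t ∈ Ioo (-ε) ε, x t ∈ T ∧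
        HasDerivAt x (t • U t) t ∧ HasDerivAt U (W t - t • B (x t) (U t) (U t)) t ∧
        HasDerivAt W (q t • U t - t • B (x t) (U t) (W t)) t := by
  let S : Set (ℝ × Plane × Plane × Plane) := {y | y.1 ∈ Ioo (-r) r ∧ y.2.1 ∈ T}
  have hS : IsOpen S :=
    (isOpen_Ioo.preimage continuous_fst).inter (hT.preimage (by fun_prop))
  -- Time is the first component, which makes the system autonomous; `htime` recovers it.
  let F : ℝ × Plane × Plane × Plane → ℝ × Plane × Plane × Plane := fun y ↦
    (1, y.1 • y.2.2.1, y.2.2.2 - y.1 • B y.2.1 y.2.2.1 y.2.2.1,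
      q y.1 • y.2.2.1 - y.1 • B y.2.1 y.2.2.1 y.2.2.2)
  have h1 : ContDiffOn ℝ ∞ (fun y : ℝ × Plane × Plane × Plane ↦ y.1) S := by fun_prop
  have h2 : ContDiffOn ℝ ∞ (fun y : ℝ × Plane × Plane × Plane ↦ y.2.1) S := by fun_prop
  have h3 : ContDiffOn ℝ ∞ (fun y : ℝ × Plane × Plane × Plane ↦ y.2.2.1) S := by fun_prop
  have h4 : ContDiffOn ℝ ∞ (fun y : ℝ × Plane × Plane × Plane ↦ y.2.2.2) S := by fun_prop
  have hBS : ContDiffOn ℝ ∞ (fun y : ℝ × Plane × Plane × Plane ↦ B y.2.1) S :=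
    hB.comp h2 fun y hy ↦ hy.2
  have hqS : ContDiffOn ℝ ∞ (fun y : ℝ × Plane × Plane × Plane ↦ q y.1) S :=
    ContDiffOn.comp hq h1 fun y hy ↦ hy.1
  have hF : ContDiffOn ℝ ∞ F S :=
    contDiffOn_const.prodMk ((h1.smul h3).prodMk
      ((h4.sub (h1.smul ((hBS.clm_apply h3).clm_apply h3))).prodMk
        ((hqS.smul h3).sub (h1.smul ((hBS.clm_apply h3).clm_apply h4)))))
  obtain ⟨ε, hε, α, hα0, hαs, hα⟩ := exists_smooth_solution hS hF
    (y₀ := (0, x₀, U₀, W₀)) ⟨⟨by simpa using hr, hr⟩, hx₀⟩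
  have h0 : (0 : ℝ) ∈ Ioo (-ε) ε := ⟨by linarith, hε⟩
  have htime : ∀ t ∈ Ioo (-ε) ε, (α t).1 = t := by
    have hd : ∀ t ∈ Ioo (-ε) ε, HasDerivAt (fun t ↦ (α t).1) 1 t := fun t ht ↦ (hα t ht).2.fst
    exact isOpen_Ioo.eqOn_of_deriv_eq (x := 0) (g := id) isPreconnected_Ioo
      (fun t ht ↦ (hd t ht).differentiableAt.differentiableWithinAt) differentiableOn_id
      (fun t ht ↦ by rw [(hd t ht).deriv, deriv_id]) h0 (by simp [hα0])
  refine ⟨min ε r, ⟨lt_min hε hr, min_le_right _ _⟩, fun t ↦ (α t).2.1, fun t ↦ (α t).2.2.1,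
    fun t ↦ (α t).2.2.2, by simp [hα0], by simp [hα0], by simp [hα0], ?_⟩
  have hsub : Ioo (-min ε r) (min ε r) ⊆ Ioo (-ε) ε :=
    Ioo_subset_Ioo (neg_le_neg (min_le_left _ _)) (min_le_left _ _)
  have hαs' := hαs.mono hsub
  refine ⟨hαs'.snd.fst, hαs'.snd.snd.fst, hαs'.snd.snd.snd, fun t ht ↦ ?_⟩
  obtain ⟨h5, h6⟩ := hα t (hsub ht)
  have h7 := htime t (hsub ht)
  have h8 : F (α t) = (1, t • (α t).2.2.1, (α t).2.2.2 - t • B (α t).2.1 (α t).2.2.1 (α t).2.2.1,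
      q t • (α t).2.2.1 - t • B (α t).2.1 (α t).2.2.1 (α t).2.2.2) := by
    simp only [F, h7]
  rw [h8] at h6
  exact ⟨h5.2, h6.snd.fst, h6.snd.snd.fst, h6.snd.snd.snd⟩

end Solutions

/-! ### Arclength and curvature of the model brackets. -/

section ModelSystem

/-- As 125/27 = (5/3)³, the arclength density is (5/3) |t|^(2/3), the derivative of t |t|^(2/3). -/
lemma sysArclength_of_eq {A : ℕ → ℕ → ℝ → ℝ} {ε : ℝ}
    (h12 : ∀ t ∈ Ioo (-ε) ε, A 1 2 t = 125 / 27 * t ^ 2) {t : ℝ} (ht : t ∈ Ioo (-ε) ε) :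
    sysArclength A t = t * |t| ^ (2 / 3 : ℝ) := by
  have h0 : (0 : ℝ) ∈ Ioo (-ε) ε := ⟨by linarith [ht.1, ht.2], by linarith [ht.1, ht.2]⟩
  have hsub : uIcc 0 t ⊆ Ioo (-ε) ε := (ordConnected_Ioo).uIcc_subset h0 ht
  have e : ∀ u ∈ uIcc 0 t, |fracPow (A 1 2 u) 1 3| = 5 / 3 * |u| ^ (2 / 3 : ℝ) := by
    intro u hu
    have h1 : (125 / 27 : ℝ) * u ^ 2 = (5 / 3 * |u| ^ (2 / 3 : ℝ)) ^ 3 := by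
      rw [mul_pow, abs_rpow_two_thirds_cube]; norm_num
    have h2 : 0 ≤ 5 / 3 * |u| ^ (2 / 3 : ℝ) := by positivity
    rw [abs_fracPow, h12 u (hsub hu), h1, abs_of_nonneg (by positivity), ← Real.rpow_natCast,
      ← Real.rpow_mul h2]
    norm_num
  rw [sysArclength, intervalIntegral.integral_congr e,
    intervalIntegral.integral_eq_sub_of_hasDerivAt fun u _ ↦ hasDerivAt_mul_abs_rpow u]
  · simp
  · refine Continuous.intervalIntegrable ?_ _ _
    exact continuous_const.mul (continuous_abs.rpow_const fun _ ↦ Or.inr (by norm_num))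

lemma sysTau_of_eq {A : ℕ → ℕ → ℝ → ℝ} {ε : ℝ}
    (h12 : ∀ t ∈ Ioo (-ε) ε, A 1 2 t = 125 / 27 * t ^ 2) {t : ℝ} (ht : t ∈ Ioo (-ε) ε) :
    sysTau A t = t := by
  have := fracPow_mul_abs_rpow (t := t) one_pos
  rw [sysTau, sysArclength_of_eq h12 ht]
  simpa using this

/-- The numerator of κ_A reduces to (125/27)² t² (4 - 9 t² q), which explains how q is extracted
from f. -/
lemma sysNormalizedCurvature_of_eq {A : ℕ → ℕ → ℝ → ℝ} {ε : ℝ}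
    (h12 : ∀ t ∈ Ioo (-ε) ε, A 1 2 t = 125 / 27 * t ^ 2) {t q : ℝ} (ht : t ∈ Ioo (-ε) ε)
    (ht0 : t ≠ 0) (h13 : A 1 3 t = 125 / 27 * (2 * t)) (h14 : A 1 4 t = 125 / 27 * (t ^ 2 * q))
    (h23 : A 2 3 t = 125 / 27 * (2 - t ^ 2 * q)) :
    sysNormalizedCurvature A t = (4 - 9 * t ^ 2 * q) / 25 := by
  set u : ℝ := |t| ^ (2 / 3 : ℝ) with hu
  have hu0 : 0 < u := Real.rpow_pos_of_pos (abs_pos.2 ht0) _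
  have hu3 : u ^ 3 = t ^ 2 := abs_rpow_two_thirds_cube t
  have h1 : A 1 2 t = (5 / 3 * u) ^ 3 := by rw [h12 t ht, mul_pow, hu3]; norm_num
  have h2 : fracPow (A 1 2 t) 8 3 = (5 / 3 * u) ^ 8 := by
    have h3 : 0 ≤ 5 / 3 * u := by positivity
    rw [fracPow_eq_abs (show Even (8 * 3) by decide), h1, abs_of_nonneg (by positivity),
      ← Real.rpow_natCast, ← Real.rpow_natCast, ← Real.rpow_mul h3]
    norm_num
  rw [sysNormalizedCurvature, sysArclength_of_eq h12 ht, sysCurvature, h2, h12 t ht, h13, h14, h23,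
    ← hu, ← mul_div_assoc, div_eq_iff (by positivity)]
  linear_combination (-(125 / 27) ^ 2 * u ^ 2 * (4 - 9 * t ^ 2 * q) * (u ^ 3 + t ^ 2)) * hu3

end ModelSystem

/-! ### Part (ii): existence of the curve. -/

section Existence

variable {M : Type*} [TopologicalSpace M] [ChartedSpace Plane M] [IsManifold (𝓡 2) ∞ M]
  {D : AffineConnection M}
  {Ω : ∀ x : M, TangentSpace (𝓡 2) x →L[ℝ] TangentSpace (𝓡 2) x →L[ℝ] ℝ}

/-- `f = (4 - 9 t² q) / 25` with `q` smooth. -/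
lemma exists_eq_four_sub {r : ℝ} {f : ℝ → ℝ} (hf : SmoothNear r f)
    (hf0 : f 0 = 4 / 25) (hf' : deriv f 0 = 0) :
    ∃ q, SmoothNear r q ∧ ∀ t ∈ Ioo (-r) r, f t = (4 - 9 * t ^ 2 * q t) / 25 := by
  obtain ⟨g, hg, hfg, hg0⟩ := SmoothNear.exists_eq_mul (f := fun t ↦ f t - 4 / 25)
    (hf.sub contDiffOn_const) (by simp [hf0])
  rw [deriv_sub_const, hf'] at hg0
  obtain ⟨k, hk, hgk, -⟩ := hg.exists_eq_mul hg0
  refine ⟨fun t ↦ -(25 / 9) * k t, contDiffOn_const.mul hk, fun t ht ↦ ?_⟩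
  have h1 := hfg t ht
  rw [hgk t ht] at h1
  linear_combination h1

/-- The covariant derivative of `a U + b W` along a curve with velocity `t U`, if `D_t U = W` and
`D_t W = q U`. -/
lemma comps_covDerivAlong_frame {x₀ : M} {γ : ℝ → M} {I : Set ℝ} (hI : IsOpen I)
    {x U W : ℝ → Plane} {q : ℝ → ℝ}
    (hsrc : ∀ t ∈ I, γ t ∈ (chartAt Plane x₀).source)
    (hvel : ∀ t ∈ I, comps x₀ (γ t) (velocity γ t) = t • U t)
    (hx : ∀ t ∈ I, chartAt Plane x₀ (γ t) = x t)
    (hU : ∀ t ∈ I, HasDerivAt U (W t - t • connBil D x₀ (x t) (U t) (U t)) t)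
    (hW : ∀ t ∈ I, HasDerivAt W (q t • U t - t • connBil D x₀ (x t) (U t) (W t)) t)
    {V : ∀ t, TangentSpace (𝓡 2) (γ t)} (hV : SmoothAlong γ V I) {a b : ℝ → ℝ}
    (hab : ∀ t ∈ I, comps x₀ (γ t) (V t) = a t • U t + b t • W t) {t a' b' : ℝ} (ht : t ∈ I)
    (ha : HasDerivAt a a' t) (hb : HasDerivAt b b' t) :
    comps x₀ (γ t) (covDerivAlong D γ V t) = (a' + b t * q t) • U t + (a t + b') • W t := by
  have h1 : deriv (fun s ↦ comps x₀ (γ s) (V s)) t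
      = (a t • (W t - t • connBil D x₀ (x t) (U t) (U t)) + a' • U t)
        + (b t • (q t • U t - t • connBil D x₀ (x t) (U t) (W t)) + b' • W t) := by
    refine HasDerivAt.deriv ?_
    refine ((ha.smul (hU t ht)).add (hb.smul (hW t ht))).congr_of_eventuallyEq ?_
    filter_upwards [hI.mem_nhds ht] with s hs using hab s hs
  rw [comps_covDerivAlong D (hsrc t ht) (hV.mdifferentiableAt hI ht), h1,
    ← connBil_apply D (hsrc t ht), hvel t ht, hab t ht, hx t ht]
  simp only [map_smul, map_add, smul_apply, smul_sub, smul_smul, add_smul]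
  rw [mul_comm (b t) t, mul_comm (a t) t]
  abel

/-- In the frame U, W with γ̇ = t U, D_t U = W, D_t W = q U, each γ^(i) has explicit coefficients,
so every bracket needed is a known function times the constant area of (U, W). -/
lemma exists_cusp_of_normalizedCurvature [T2Space M] [Nonempty M]
    (hD : CovariantDerivative.ContMDiffCovariantDerivative D ∞) (hΩ : IsParallelAreaForm D Ω)
    {r : ℝ} (hr : 0 < r) {f : ℝ → ℝ} (hf : SmoothNear r f) (hf0 : f 0 = 4 / 25)
    (hf' : deriv f 0 = 0) :
    ∃ ε ∈ Ioc 0 r, ∃ γ : ℝ → M,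
      ContMDiffOn 𝓘(ℝ, ℝ) (𝓡 2) ∞ γ (Ioo (-ε) ε) ∧ IsThreeHalvesCusp γ ∧
      NoInflection D Ω γ ε ∧
      (∀ t ∈ Ioo (-ε) ε, threeFifthsArclength D Ω γ t = t) ∧
      (∀ t ∈ Ioo (-ε) ε, t ≠ 0 → normalizedCurvature D Ω γ t = f t) := by
  obtain ⟨q, hq, hfq⟩ := exists_eq_four_sub hf hf0 hf'
  obtain ⟨x₀⟩ := ‹Nonempty M›
  set e := chartAt Plane x₀ with he
  have hx₀ : x₀ ∈ e.source := mem_chart_source _ _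
  set e0 : Plane := EuclideanSpace.single 0 1 with he0
  set e1 : Plane := EuclideanSpace.single 1 1 with he1
  set m : ℝ := areaBil Ω x₀ (e x₀) e0 e1 with hm
  have hm0 : m ≠ 0 := alternating_apply_ne_zero (areaBil_self hΩ hx₀) (areaBil_ne_zero hΩ hx₀)
    (K := ContinuousLinearMap.id ℝ Plane) Function.surjective_id
  -- Dividing by `m`, of either sign, gives (U, W) initial area 125/27.
  obtain ⟨ε, hε, x, U, W, hx0, hU0, hW0, hxs, hUs, hWs, hxUW⟩ :=
    exists_moving_frame hr e.open_target (contDiffOn_connBil hD x₀) hq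
      (U₀ := e0) (W₀ := (125 / 27 / m) • e1) (e.map_source hx₀)
  have h0 : (0 : ℝ) ∈ Ioo (-ε) ε := ⟨by linarith [hε.1], hε.1⟩
  have hqε : SmoothNear ε q := hq.mono (Ioo_subset_Ioo (by linarith [hε.2]) hε.2)
  set γ : ℝ → M := fun t ↦ e.symm (x t) with hγdef
  have hsrc : ∀ t ∈ Ioo (-ε) ε, γ t ∈ e.source := fun t ht ↦ e.map_target (hxUW t ht).1
  have hchart : ∀ t ∈ Ioo (-ε) ε, e (γ t) = x t := fun t ht ↦ e.right_inv (hxUW t ht).1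
  have hγ : ContMDiffOn 𝓘(ℝ, ℝ) (𝓡 2) ∞ γ (Ioo (-ε) ε) :=
    (contMDiffOn_chart_symm (I := 𝓡 2)).comp hxs.contMDiffOn fun t ht ↦ (hxUW t ht).1
  have hvel : ∀ t ∈ Ioo (-ε) ε, comps x₀ (γ t) (velocity γ t) = t • U t := by
    intro t ht
    have h1 := comps_velocity (hsrc t ht) (mdifferentiableAt_curve isOpen_Ioo hγ ht)
    refine h1.unique ((hxUW t ht).2.1.congr_of_eventuallyEq ?_)
    filter_upwards [Ioo_mem_nhds ht.1 ht.2] with s hs using hchart s hs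
  have hstep := fun {V : ∀ t, TangentSpace (𝓡 2) (γ t)} (hV : SmoothAlong γ V (Ioo (-ε) ε))
    {a b : ℝ → ℝ} (hab : ∀ t ∈ Ioo (-ε) ε, comps x₀ (γ t) (V t) = a t • U t + b t • W t)
    {t a' b' : ℝ} ↦ comps_covDerivAlong_frame (D := D) isOpen_Ioo hsrc hvel hchart
      (fun t ht ↦ (hxUW t ht).2.2.1) (fun t ht ↦ (hxUW t ht).2.2.2) hV hab (t := t) (a' := a')
      (b' := b')
  have hsm := fun k ↦ smoothAlong_curveDeriv hD isOpen_Ioo hγ k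
  have c1 : ∀ t ∈ Ioo (-ε) ε, comps x₀ (γ t) (curveDeriv D γ 1 t)
      = t • U t + (0 : ℝ) • W t := fun t ht ↦ by
    rw [zero_smul, add_zero]; exact hvel t ht
  have c2 : ∀ t ∈ Ioo (-ε) ε, comps x₀ (γ t) (curveDeriv D γ 2 t)
      = (1 : ℝ) • U t + t • W t := fun t ht ↦ by
    have := hstep (hsm 0) c1 ht (hasDerivAt_id t) (hasDerivAt_const t 0)
    rwa [zero_mul, add_zero, add_zero] at this
  have c3 : ∀ t ∈ Ioo (-ε) ε, comps x₀ (γ t) (curveDeriv D γ 3 t)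
      = (t * q t) • U t + (2 : ℝ) • W t := fun t ht ↦ by
    have := hstep (hsm 1) c2 ht (hasDerivAt_const t 1) (hasDerivAt_id t)
    rw [zero_add, one_add_one_eq_two (R := ℝ)] at this
    exact this
  have c4 : ∀ t ∈ Ioo (-ε) ε, comps x₀ (γ t) (curveDeriv D γ 4 t)
      = (3 * q t + t * deriv q t) • U t + (t * q t) • W t := fun t ht ↦ by
    have := hstep (hsm 2) c3 ht ((hasDerivAt_id t).mul (hqε.hasDerivAt ht)) (hasDerivAt_const t 2)
    rw [add_zero] at this
    rw [show 3 * q t + t * deriv q t = 1 * q t + id t * deriv q t + 2 * q t by simp only [id]; ring]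
    exact this
  set g : ℝ → ℝ := fun t ↦ areaBil Ω x₀ (x t) (U t) (W t) with hgdef
  have hgs : SmoothNear ε g :=
    ((((contDiffOn_areaBil hΩ x₀).comp hxs fun t ht ↦ (hxUW t ht).1)).clm_apply hUs).clm_apply hWs
  have hbr : ∀ t ∈ Ioo (-ε) ε, ∀ {i j : ℕ} {a b c d : ℝ},
      comps x₀ (γ t) (curveDeriv D γ i t) = a • U t + b • W t →
      comps x₀ (γ t) (curveDeriv D γ j t) = c • U t + d • W t →
      bracket D Ω γ i j t = (a * d - b * c) * g t := by
    intro t ht i j a b c d h1 h2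
    have halt : ∀ c, areaBil Ω x₀ (e (γ t)) c c = 0 := areaBil_self hΩ (hsrc t ht)
    have hswap : areaBil Ω x₀ (e (γ t)) (W t) (U t) = -areaBil Ω x₀ (e (γ t)) (U t) (W t) := by
      have := halt (U t + W t)
      simp only [map_add, add_apply, halt] at this
      linarith
    rw [bracket, area_eq_areaBil Ω (hsrc t ht), h1, h2, ← he]
    simp only [map_add, map_smul, add_apply, smul_apply, smul_eq_mul, halt, hswap, hgdef,
      ← hchart t ht]
    ring
  have b12 : ∀ t ∈ Ioo (-ε) ε, bracket D Ω γ 1 2 t = t ^ 2 * g t := fun t ht ↦ by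
    rw [hbr t ht (c1 t ht) (c2 t ht)]; ring
  have b13 : ∀ t ∈ Ioo (-ε) ε, bracket D Ω γ 1 3 t = 2 * t * g t := fun t ht ↦ by
    rw [hbr t ht (c1 t ht) (c3 t ht)]; ring
  -- The area of (U, W) is constant: comparing A_12' = A_13 = 2 t g with the derivative of A_12 = t²
  -- g leaves t² g' = 0.
  have hg' : ∀ t ∈ Ioo (-ε) ε, deriv g t = 0 := by
    intro t ht
    refine hgs.deriv.eq_of_pow_mul_eq (n := 2) (h := fun _ ↦ 0) contDiffOn_const
      (fun t ht ↦ ?_) ht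
    have h1 := hasDerivAt_bracket hD hΩ isOpen_Ioo hγ 0 1 ht
    rw [show bracket D Ω γ (0 + 2) (1 + 1) t = 0 from hΩ.alternating _ _, zero_add,
      show bracket D Ω γ (0 + 1) (1 + 2) t = 2 * t * g t from b13 t ht] at h1
    have h2 : deriv (bracket D Ω γ 1 2) t = _ :=
      deriv_eq_of_eqOn b12 ht ((hasDerivAt_pow 2 t).mul (hgs.hasDerivAt ht))
    have h3 := h1.deriv.symm.trans h2
    push_cast at h3
    simp only [pow_one] at h3
    linarith
  have hg : ∀ t ∈ Ioo (-ε) ε, g t = 125 / 27 := by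
    intro t ht
    have h1 : g 0 = 125 / 27 := by
      simp only [hgdef, hx0, hU0, hW0, map_smul, smul_eq_mul]
      rw [← hm]
      field_simp
    rw [← h1]
    exact isOpen_Ioo.is_const_of_deriv_eq_zero isPreconnected_Ioo
      (hgs.differentiableOn (by norm_num)) hg' ht h0
  have h12 : ∀ t ∈ Ioo (-ε) ε, bracket D Ω γ 1 2 t = 125 / 27 * t ^ 2 := fun t ht ↦ by
    rw [b12 t ht, hg t ht]; ring
  refine ⟨ε, hε, γ, hγ, ?_, fun t ht ht0 ↦ ?_, fun t ht ↦ sysTau_of_eq h12 ht,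
    fun t ht ht0 ↦ ?_⟩
  · have hcoord : ∀ i : Fin 2, SmoothNear ε (fun t ↦ x t i - x 0 i) ∧ SmoothNear ε (fun t ↦ U t i) ∧
        ∀ t ∈ Ioo (-ε) ε, deriv (fun t ↦ x t i - x 0 i) t = t * U t i := by
      intro i
      refine ⟨((contDiffOn_piLp 2).1 hxs i).sub contDiffOn_const, (contDiffOn_piLp 2).1 hUs i,
        fun t ht ↦ ?_⟩
      have := ((EuclideanSpace.proj i : Plane →L[ℝ] ℝ).hasFDerivAt.comp_hasDerivAt t
        (hxUW t ht).2.1).sub_const (x 0 i)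
      exact this.deriv
    obtain ⟨a, ha, hxa, hUa⟩ := exists_eq_sq_mul_of_deriv_eq hε.1 (hcoord 0).1 (hcoord 0).2.1
      (sub_self _) (hcoord 0).2.2
    obtain ⟨b, hb, hxb, hUb⟩ := exists_eq_cube_mul_of_deriv_eq hε.1 (hcoord 1).1 (hcoord 1).2.1
      (sub_self _) (hcoord 1).2.2 (by rw [hU0]; simp [he0])
    have ha0 : 0 < a 0 := by
      have := hUa 0 h0
      rw [hU0, he0] at this
      simp at this
      linarith
    have hb0 : b 0 ≠ 0 := by
      have h1 : HasDerivAt (fun t ↦ U t 1) (125 / 27 / m) 0 := by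
        refine ((EuclideanSpace.proj (1 : Fin 2) : Plane →L[ℝ] ℝ).hasFDerivAt.comp_hasDerivAt 0
          (hxUW 0 h0).2.2.1).congr_deriv ?_
        simp [hW0, he1]
      rw [h1.deriv] at hUb
      intro hb0
      rw [hb0, mul_zero] at hUb
      have : (125 / 27 / m : ℝ) ≠ 0 := by positivity
      exact this hUb.symm
    -- No linear change is needed: U(0) = e0 and W(0) parallel to e1 already give the coordinates
    -- (t² a, t³ b).
    refine isThreeHalvesCusp_of_chart hε.1 ha hb ha0 hb0 hsrc (ContinuousLinearEquiv.refl ℝ Plane)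
      (x 0) fun t ht ↦ ?_
    rw [← hxa t ht, ← hxb t ht, ← he, hchart t ht]
    ext i
    fin_cases i <;> simp
  · rw [h12 t ht]
    positivity
  · have h23 : bracket D Ω γ 2 3 t = 125 / 27 * (2 - t ^ 2 * q t) := by
      rw [hbr t ht (c2 t ht) (c3 t ht), hg t ht]; ring
    have h14 : bracket D Ω γ 1 4 t = 125 / 27 * (t ^ 2 * q t) := by
      rw [hbr t ht (c1 t ht) (c4 t ht), hg t ht]; ring
    have h13 : bracket D Ω γ 1 3 t = 125 / 27 * (2 * t) := by
      rw [b13 t ht, hg t ht]; ring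
    rw [hfq t (Ioo_subset_Ioo (by linarith [hε.2]) hε.2 ht)]
    exact sysNormalizedCurvature_of_eq h12 ht ht0 h13 h14 h23

end Existence

end EquiAffineCusp

end

/-! ### The theorem. -/

open EquiAffineCusp in
theorem theorem3p8 {M : Type*} [TopologicalSpace M] [T2Space M] [Nonempty M]
    [ChartedSpace Plane M] [IsManifold (𝓡 2) ∞ M]
    (D : AffineConnection M) (hD : CovariantDerivative.ContMDiffCovariantDerivative D ∞)
    (Ω : ∀ x : M, TangentSpace (𝓡 2) x →L[ℝ] TangentSpace (𝓡 2) x →L[ℝ] ℝ)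
    (hΩ : IsParallelAreaForm D Ω) :
    (∀ (δ : ℝ) (γ : ℝ → M), 0 < δ → ContMDiffOn 𝓘(ℝ, ℝ) (𝓡 2) ∞ γ (Ioo (-δ) δ) →
      IsThreeHalvesCusp γ →
      bracket D Ω γ 2 3 0 ≠ 0 ∧
      (∃ ε ∈ Ioc 0 δ, NoInflection D Ω γ ε) ∧
      (∀ ε ∈ Ioc 0 δ, NoInflection D Ω γ ε →
        -- the 3/5-arclength is a coordinate with the origin at the cusp
        threeFifthsArclength D Ω γ 0 = 0 ∧
        ContDiffOn ℝ ∞ (threeFifthsArclength D Ω γ) (Ioo (-ε) ε) ∧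
        (∀ t ∈ Ioo (-ε) ε, 0 < deriv (threeFifthsArclength D Ω γ) t) ∧
        -- the normalized affine curvature is smooth, as a function of `t`
        (∃ f : ℝ → ℝ, ContDiffOn ℝ ∞ f (Ioo (-ε) ε) ∧
          (∀ t ∈ Ioo (-ε) ε, t ≠ 0 → f t = normalizedCurvature D Ω γ t) ∧
          f 0 = 4 / 25 ∧ deriv f 0 = 0) ∧
        -- and as a function of the 3/5-arclength
        (∃ f : ℝ → ℝ, ContDiffOn ℝ ∞ f (threeFifthsArclength D Ω γ '' Ioo (-ε) ε) ∧
          (∀ t ∈ Ioo (-ε) ε, t ≠ 0 →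
            f (threeFifthsArclength D Ω γ t) = normalizedCurvature D Ω γ t) ∧
          f 0 = 4 / 25 ∧ deriv f 0 = 0)) ∧
      Tendsto
        (fun t ↦ (normalizedCurvature D Ω γ t - 4 / 25) / threeFifthsArclength D Ω γ t ^ 2)
        (𝓝[≠] 0) (𝓝 (1 / 220 * (20 / 3 : ℝ) ^ (1 / 5 : ℝ) * affineCuspidalCurvature D Ω γ))) ∧
    (∀ (r : ℝ) (f : ℝ → ℝ), 0 < r → ContDiffOn ℝ ∞ f (Ioo (-r) r) →
      f 0 = 4 / 25 → deriv f 0 = 0 →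
      ∃ ε ∈ Ioc 0 r, ∃ γ : ℝ → M,
        ContMDiffOn 𝓘(ℝ, ℝ) (𝓡 2) ∞ γ (Ioo (-ε) ε) ∧ IsThreeHalvesCusp γ ∧
        NoInflection D Ω γ ε ∧
        (∀ t ∈ Ioo (-ε) ε, threeFifthsArclength D Ω γ t = t) ∧
        (∀ t ∈ Ioo (-ε) ε, t ≠ 0 → normalizedCurvature D Ω γ t = f t)) := by
  refine ⟨fun δ γ hδ hγ hc ↦ ?_, fun r f hr hf hf0 hf' ↦
    exists_cusp_of_normalizedCurvature hD hΩ hr hf hf0 hf'⟩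
  have h23 := hc.bracket_ne_zero hD hΩ hδ hγ
  have hA := bracketSystem_of_velocity_eq_zero hD hΩ hγ (hc.velocity_eq_zero hδ hγ)
  obtain ⟨ε, hε, hne⟩ := hA.exists_noInflection hδ h23
  refine ⟨h23, ⟨ε, hε, hne⟩, fun e he hne' ↦ ?_,
    ((hA.mono hε.2).normal_form hε.1 h23 hne).2.2.2.2⟩
  obtain ⟨h1, h2, h3, h4, -⟩ := (hA.mono he.2).normal_form he.1 h23 hne'
  exact ⟨h1, h2, h3, h4, (hA.mono he.2).exists_smooth_function_of_tau he.1 h23 hne'⟩
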